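/- **Setting.** Let $R$ be a commutative ring, $G$ a locally profinite group, and $\mathscr K$ a set of open subgroups of $G$ that is cofinal (every open subgroup contains a member), closed under conjugation, and contains every open subgroup of each of its members. Let $\mathscr S$ be the site of left $G$-sets all of whose stabilizers lie in $\mathscr K$; its coverings are the jointly surjective families. For an open subgroup $K$, $\mathscr S_K$ is the site of all discrete left $K$-sets. Let $\mathcal C$ be a site with fibre products, equalizers and coproducts. An *$\mathscr S$-object* is a functor $X:\mathscr S\to\mathcal C$, $S\mapsto X_S$, that sends coverings to coverings and preserves fibre products and coproducts; it is *exact* if it also preserves equalizers. Write $X_K=X_{G/K}$. (Size convention: the sets in $\mathscr S$ and the Hom-sets of $\mathcal C$ are small, and $R$ and all modules may be as large as the class of objects of $\mathcal C$.) The site $\mathcal C/\operatorname{colim}X$ has as objects the pairs $(U,\alpha)$ with $U\in\mathcal C$ and $\alpha\in\operatorname{colim}_{S\in\mathscr S}\operatorname{Hom}(U,X_S)$, as morphisms $(U,\alpha)\to(V,\beta)$ the $\varphi:U\to V$ with $\varphi^*\beta=\alpha$, and its coverings are the families whose underlying families cover in $\mathcal C$. Let $\alpha_S$ be the class of $1_{X_S}$.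 Let $\mathrm{Sh}(X,R)$ be the category of sheaves of $R$-modules on $\mathcal C/\operatorname{colim}X$ and $\mathrm{Mod}^{sm}_R(G)$ that of smooth $R[G]$-modules. For $\mathscr F\in \mathrm{Sh}(X,R)$ put $H^0(X_\infty,\mathscr F)=\varinjlim_{K\in\mathscr K}\mathscr F(X_K,\alpha_K)$, where $g\in G$ acts through the maps $G/gKg^{-1}\to G/K$, $h\mapsto hg$. Let $H^s(X_\infty,\cdot):\mathrm{Sh}(X,R)\to\mathrm{Mod}^{sm}_R(G)$ be the right derived functors of $H^0(X_\infty,\cdot)$. For $M\in\mathrm{Mod}^{sm}_R(G)$ let $H^n_R(X;M,\cdot)$ be the $n$-th right derived functor of $\mathscr F\mapsto\operatorname{Hom}_{R[G]}(M,H^0(X_\infty,\mathscr F))$. Let $M_{X,G}\in\mathrm{Sh}(X,R)$ be the inverse image (sheafified left Kan extension) of the sheaf $S\mapsto\operatorname{Maps}_G(S,M)$ along $\mathscr S\to\mathcal C/\operatorname{colim}X$, $S\mapsto(X_S,\alpha_S)$. For $K\in\mathscr K$ let $X|_K:\mathscr S_K\to\mathcal C$, $S\mapsto X_{G\times_KS}$,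 and let $\mathscr F_K$ denote the restriction of $\mathscr F$ to $\mathcal C/\operatorname{colim}X|_K$, respectively to $\mathcal C/X_K$ (via $(\psi:U\to X_K)\mapsto(U,\psi^*\alpha_K)$). Let $H^n(X_K,\cdot)$ be the right derived functors of sections over the final object of $\mathcal C/X_K$. Finally, $\operatorname{cInd}_K^GM$ consists of the smooth functions $\Phi:G\to M$ with $\Phi(kg)=k\Phi(g)$ for $k\in K$ whose support is compact modulo $K$, and $G$ acts by right translation. A *morphism* $f:X\to Y$ of $\mathscr S$-objects is a natural transformation all of whose naturality squares are cartesian. It induces $u_f:\mathcal C/\operatorname{colim}X\to\mathcal C/\operatorname{colim}Y$, $(U,\alpha)\mapsto(U,f\circ\alpha)$. Let $f_*:\mathrm{Sh}(X,R)\to\mathrm{Sh}(Y,R)$ be the right adjoint of restriction along $u_f$, and $R^sf_*$ its right derived functors. **Proposition.** Let $X$ be an $\mathscr S$-object in $\mathcal C$. Then, for $M\in\mathrm{Mod}^{sm}_R(G)$ and $\mathscr F\in\mathrm{Sh}(X,R)$, one has $H^n_R(X;M,\mathscr F)\cong\operatorname{Ext}^n_{\mathrm{Sh}(X,R)}(M_{X,G},\mathscr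 F)$ as $R$-modules for all $n\ge 0$, naturally in $\mathscr F$. Moreover: (a) For $K\in\mathscr K$, $M\in\mathrm{Mod}^{sm}_R(K)$ and $n\ge0$ there is an isomorphism, natural in $\mathscr F\in\mathrm{Sh}(X,R)$, $$H^n_R(X;\operatorname{cInd}_K^GM,\mathscr F)\cong H^n_R(X|_K;M,\mathscr F_K).$$ In particular, for $R$ with trivial $K$-action, $H^n_R(X;\operatorname{cInd}_K^GR,\mathscr F)\cong H^n(X_K,\mathscr F_K)$, naturally in $\mathscr F$. (b) If $X$ is exact, then for all $M\in\mathrm{Mod}^{sm}_R(G)$ and $\mathscr F\in\mathrm{Sh}(X,R)$ there is a convergent first quadrant spectral sequence of $R$-modules $$E_2^{rs}=\operatorname{Ext}^r_{R,G}(M,H^s(X_\infty,\mathscr F))\Longrightarrow H^{r+s}_R(X;M,\mathscr F),$$ where $\operatorname{Ext}_{R,G}$ is taken in $\mathrm{Mod}^{sm}_R(G)$. (c) Let $f:X\to Y$ be a morphism of $\mathscr S$-objects. Assume that $Y$ is exact or, more generally, that for all $S\in\mathscr S$ and $U\in\mathcal C$ two morphisms $a,b:U\to X_S$ with $f_S\circ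 a=f_S\circ b$ and with the same class in $\operatorname{colim}_{T}\operatorname{Hom}(U,X_T)$ are equal. Then for all $M\in\mathrm{Mod}^{sm}_R(G)$ and $\mathscr F\in\mathrm{Sh}(X,R)$ there is a convergent first quadrant spectral sequence of $R$-modules $$E_2^{rs}=H^r_R(Y;M,R^sf_*\mathscr F)\Longrightarrow H^{r+s}_R(X;M,\mathscr F).$$ -/

import Mathlib

open CategoryTheory Limits Opposite
universe u
noncomputable section
namespace SSheaf

/-! ### Smooth representations -/

section Smooth

variable (R : Type (u + 1)) [CommRing R] (G : Type u) [Group G] [TopologicalSpace G]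

/-- A representation is smooth (discrete) if the stabilizer of every vector is open. -/
def isSmooth : ObjectProperty (Rep.{u + 1} R G) := fun V ↦
  ∀ v : V.V, IsOpen {g : G | V.ρ g v = v}

/-- The category of smooth representations of `G` on `R`-modules. -/
abbrev SmoothRep := (isSmooth R G).FullSubcategory

variable {R G}

lemma isOpen_stabilizer_of_subset [IsTopologicalGroup G] {V : Rep.{u + 1} R G} (v : V.V)
    {S : Set G} (hS : IsOpen S) (h1 : 1 ∈ S) (h : ∀ g ∈ S, V.ρ g v = v) :
    IsOpen {g : G | V.ρ g v = v} := by
  let H : Subgroup G :=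
    { carrier := {g : G | V.ρ g v = v}
      one_mem' := by simp
      mul_mem' := fun {a b} ha hb ↦ by
        simp only [Set.mem_ofPred_eq] at ha hb ⊢
        rw [map_mul, Module.End.mul_apply, hb, ha]
      inv_mem' := fun {a} ha ↦ by
        simp only [Set.mem_ofPred_eq] at ha ⊢
        conv_lhs => rw [← ha]
        rw [← Module.End.mul_apply, ← map_mul]
        simp }
  exact H.isOpen_of_mem_nhds (g := 1) (Filter.mem_of_superset (hS.mem_nhds h1) h)

instance : (isSmooth R G).IsClosedUnderSubobjects where
  prop_of_mono {X Y} f hf hY := fun v ↦ by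
    have hinj := (Rep.mono_iff_injective f).1 hf
    convert hY (f.hom v) using 3 with g
    rw [← Rep.hom_comm_apply]
    exact hinj.eq_iff.symm

instance [IsTopologicalGroup G] : (isSmooth R G).IsClosedUnderQuotients where
  prop_of_epi {X Y} f hf hX := fun v ↦ by
    obtain ⟨w, rfl⟩ := (Rep.epi_iff_surjective f).1 hf v
    refine isOpen_stabilizer_of_subset _ (hX w) (by simp) fun g hg ↦ ?_
    rw [← Rep.hom_comm_apply, hg]

instance : (isSmooth R G).ContainsZero where
  exists_zero := ⟨Rep.trivial R G PUnit, (Rep.isZero_iff _ _ _).2 inferInstance, fun v ↦ by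
    simp⟩

instance [IsTopologicalGroup G] : (isSmooth R G).IsClosedUnderBinaryProducts where
  limitsOfShape_le := by
    rintro X ⟨p⟩ v
    have hp := isLimitOfPreserves (forget₂ (Rep.{u + 1} R G) (ModuleCat.{u + 1} R)) p.isLimit
    refine isOpen_stabilizer_of_subset v
      (S := ⋂ j : WalkingPair, {g | (p.diag.obj ⟨j⟩).ρ g ((p.π.app ⟨j⟩).hom v) =
        (p.π.app ⟨j⟩).hom v}) ?_ (by simp) fun g hg ↦ ?_
    · exact isOpen_iInter_of_finite fun j ↦ p.prop_diag_obj ⟨j⟩ _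
    · refine Concrete.isLimit_ext _ hp _ _ ?_
      rintro ⟨j⟩
      have := Set.mem_iInter.1 hg j
      change (p.π.app ⟨j⟩).hom (X.ρ g v) = (p.π.app ⟨j⟩).hom v
      exact (Rep.hom_comm_apply (p.π.app ⟨j⟩) g v).trans this

instance [IsTopologicalGroup G] : (isSmooth R G).IsClosedUnderFiniteProducts :=
  .mk'

instance [IsTopologicalGroup G] : Abelian (SmoothRep R G) := inferInstance

instance : EnoughInjectives (Rep.{u + 1} R G) :=
  Rep.equivalenceModuleMonoidAlgebra.enoughInjectives_iff.2 inferInstance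

/-- The largest smooth subrepresentation. -/
def smoothPart [IsTopologicalGroup G] (V : Rep.{u + 1} R G) : Submodule R V.V where
  carrier := {v | IsOpen {g : G | V.ρ g v = v}}
  zero_mem' := by simp
  add_mem' {v w} hv hw := isOpen_stabilizer_of_subset _ (hv.inter hw) (by simp) fun g hg ↦ by
    rw [map_add, hg.1, hg.2]
  smul_mem' r v hv := isOpen_stabilizer_of_subset _ hv (by simp) fun g hg ↦ by
    rw [map_smul, hg]

lemma ρ_mem_smoothPart [IsTopologicalGroup G] (V : Rep.{u + 1} R G) (g : G) {v : V.V}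
    (hv : v ∈ smoothPart V) : V.ρ g v ∈ smoothPart V := by
  change IsOpen _
  have : {h : G | V.ρ h (V.ρ g v) = V.ρ g v} =
      (fun h ↦ g⁻¹ * h * g) ⁻¹' {h : G | V.ρ h v = v} := by
    ext h
    simp only [Set.mem_ofPred_eq, Set.mem_preimage, map_mul, Module.End.mul_apply]
    constructor
    · intro e
      rw [e, ← Module.End.mul_apply, ← map_mul]; simp
    · intro e
      conv_rhs => rw [← e]
      simp only [← Module.End.mul_apply, ← map_mul]; group
  rw [this]
  exact IsOpen.preimage (by fun_prop) hv

/-- The action of `G` on the largest smooth subrepresentation. -/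
def smoothPartRho [IsTopologicalGroup G] (V : Rep.{u + 1} R G) :
    Representation R G (smoothPart V) where
  toFun g := (V.ρ g).restrict fun _ hv ↦ ρ_mem_smoothPart V g hv
  map_one' := by ext; simp
  map_mul' g h := by ext; simp

/-- The largest smooth subrepresentation as an object of `SmoothRep R G`. -/
def smoothPartRep [IsTopologicalGroup G] (V : Rep.{u + 1} R G) : SmoothRep R G where
  obj := Rep.of (smoothPartRho V)
  property v := by
    have : {g : G | V.ρ g v.1 = v.1} = {g : G | smoothPartRho V g v = v} := by
      ext g
      exact (Subtype.ext_iff (a1 := smoothPartRho V g v) (a2 := v)).symm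
    exact this ▸ v.2

/-- A map from a smooth representation lands in the smooth part of the target. -/
def liftSmoothPart [IsTopologicalGroup G] (X : SmoothRep R G) {V : Rep.{u + 1} R G}
    (f : X.obj ⟶ V) : X ⟶ smoothPartRep V :=
  ObjectProperty.homMk (Rep.ofHom
    { toLinearMap := f.hom.toLinearMap.codRestrict (smoothPart V) fun x ↦
        isOpen_stabilizer_of_subset _ (X.property x) (by simp) fun g hg ↦ by
          change V.ρ g (f.hom x) = f.hom x
          rw [← Rep.hom_comm_apply, hg]
      isIntertwining' := fun g ↦ by
        ext x
        exact Rep.hom_comm_apply f g x })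

/-- The inclusion of the smooth part. -/
def smoothPartι [IsTopologicalGroup G] (V : Rep.{u + 1} R G) : (smoothPartRep V).obj ⟶ V :=
  Rep.ofHom
    { toLinearMap := (smoothPart V).subtype
      isIntertwining' := fun _ ↦ rfl }

instance [IsTopologicalGroup G] : EnoughInjectives (SmoothRep R G) where
  presentation X := by
    have := (isSmooth R G).preservesMonomorphisms_ι_of_isNormalEpiCategory
    let I := Injective.under X.obj
    refine ⟨⟨smoothPartRep I, ⟨fun {Y Z} g f hf ↦ ?_⟩, liftSmoothPart X (Injective.ι X.obj), ?_⟩⟩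
    · have : Mono f.hom := inferInstanceAs (Mono ((isSmooth R G).ι.map f))
      refine ⟨liftSmoothPart Z (Injective.factorThru (g.hom ≫ smoothPartι I) f.hom), ?_⟩
      ext y
      refine Subtype.ext ?_
      exact congr($(Injective.comp_factorThru (g.hom ≫ smoothPartι I) f.hom).hom y)
    · apply (isSmooth R G).ι.mono_of_mono_map
      refine (Rep.mono_iff_injective _).2 fun a b hab ↦ ?_
      exact (Rep.mono_iff_injective (Injective.ι X.obj)).1 inferInstance congr($(hab).1)

instance [IsTopologicalGroup G] : HasExt.{u + 1} (SmoothRep R G) :=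
  hasExt_of_enoughInjectives _

end Smooth

/-! ### Discrete `G`-sets with stabilizers in a family of open subgroups -/

section GSets

/-- A cofinal family of open subgroups which is closed under conjugation and under passing to
open subgroups. -/
structure SubgroupFamily (G : Type u) [Group G] [TopologicalSpace G] where
  /-- the members of the family -/
  carrier : Set (Subgroup G)
  isOpen : ∀ K ∈ carrier, IsOpen (K : Set G)
  cofinal : ∀ U : Subgroup G, IsOpen (U : Set G) → ∃ K ∈ carrier, K ≤ U
  conj_mem : ∀ K ∈ carrier, ∀ g : G, K.map (MulAut.conj g).toMonoidHom ∈ carrier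
  mem_of_le : ∀ K ∈ carrier, ∀ K' : Subgroup G, K' ≤ K → IsOpen (K' : Set G) → K' ∈ carrier

/-- The family of all open subgroups. -/
def SubgroupFamily.all (G : Type u) [Group G] [TopologicalSpace G] [IsTopologicalGroup G] :
    SubgroupFamily G where
  carrier := {K | IsOpen (K : Set G)}
  isOpen _ hK := hK
  cofinal U hU := ⟨U, hU, le_rfl⟩
  conj_mem K hK g := by
    have : ((K.map (MulAut.conj g).toMonoidHom : Subgroup G) : Set G) =
        (fun h ↦ g⁻¹ * h * g) ⁻¹' (K : Set G) := by
      ext h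
      simp only [Subgroup.coe_map, Set.mem_image, SetLike.mem_coe, Set.mem_preimage]
      constructor
      · rintro ⟨k, hk, rfl⟩
        simpa [mul_assoc] using hk
      · intro hk
        exact ⟨_, hk, by simp [mul_assoc]⟩
    change IsOpen ((K.map (MulAut.conj g).toMonoidHom : Subgroup G) : Set G)
    rw [this]
    exact IsOpen.preimage (by fun_prop) hK
  mem_of_le _ _ _ _ h := h

variable {G : Type u} [Group G] [TopologicalSpace G]

/-- Sets with a left `G`-action all of whose stabilizers belong to the family `𝒦`. -/
structure GSet (𝒦 : SubgroupFamily G) where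
  /-- the underlying set -/
  carrier : Type u
  [action : MulAction G carrier]
  stabilizer_mem : ∀ s : carrier, MulAction.stabilizer G s ∈ 𝒦.carrier

attribute [instance] GSet.action

namespace GSet

variable {𝒦 : SubgroupFamily G}

/-- `G`-equivariant maps. -/
@[ext]
structure Hom (S T : GSet 𝒦) where
  /-- the underlying map -/
  toFun : S.carrier → T.carrier
  map_smul : ∀ (g : G) (s : S.carrier), toFun (g • s) = g • toFun s

instance : Category (GSet 𝒦) where
  Hom := Hom
  id S := ⟨id, fun _ _ ↦ rfl⟩
  comp f h := ⟨h.toFun ∘ f.toFun, fun g s ↦ by simp [f.map_smul, h.map_smul]⟩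

@[simp] lemma id_toFun (S : GSet 𝒦) (s : S.carrier) : Hom.toFun (𝟙 S) s = s := rfl

@[simp] lemma comp_toFun {S T U : GSet 𝒦} (f : S ⟶ T) (h : T ⟶ U) (s : S.carrier) :
    Hom.toFun (f ≫ h) s = h.toFun (f.toFun s) := rfl

@[ext] lemma hom_ext {S T : GSet 𝒦} {f h : S ⟶ T} (w : ∀ s, f.toFun s = h.toFun s) : f = h :=
  Hom.ext (funext w)

/-- The `G`-set `G ⧸ K` for `K` in the family. -/
def quot (K : 𝒦.carrier) : GSet 𝒦 where
  carrier := G ⧸ K.1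
  stabilizer_mem := by
    rintro ⟨g⟩
    change MulAction.stabilizer G ((g : G) : G ⧸ K.1) ∈ _
    have : ((g : G) : G ⧸ K.1) = g • ((1 : G) : G ⧸ K.1) := by
      rw [MulAction.Quotient.smul_coe, smul_eq_mul, mul_one]
    rw [this, MulAction.stabilizer_smul_eq_stabilizer_map_conj, MulAction.stabilizer_quotient]
    exact 𝒦.conj_mem _ K.2 g

/-- The equivariant map `G ⧸ K ⟶ S`, `h K ↦ h • s`, for `s` fixed by `K`. -/
def quotHom (K : 𝒦.carrier) {S : GSet 𝒦} (s : S.carrier)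
    (h : K.1 ≤ MulAction.stabilizer G s) : quot K ⟶ S where
  toFun := fun x : G ⧸ K.1 ↦ Quotient.liftOn' x (fun g ↦ g • s) fun a b hab ↦ by
    have := h (QuotientGroup.leftRel_apply.1 hab)
    rw [MulAction.mem_stabilizer_iff, mul_smul, inv_smul_eq_iff] at this
    exact this.symm
  map_smul := by
    rintro g ⟨x⟩
    exact mul_smul g x s

/-- The map `h K ↦ h g L` from `G ⧸ K` to `G ⧸ L` for `K ⊆ g L g⁻¹`. -/
def quotMul (K L : 𝒦.carrier) (g : G) (h : ∀ k ∈ K.1, g⁻¹ * k * g ∈ L.1) : quot K ⟶ quot L :=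
  quotHom K (S := quot L) ((g : G) : G ⧸ L.1) fun k hk ↦ by
    change ((k * g : G) : G ⧸ L.1) = (g : G ⧸ L.1)
    refine (QuotientGroup.eq.2 ?_).symm
    simpa [mul_assoc] using h k hk

lemma quotMul_apply (K L : 𝒦.carrier) (g : G) (h : ∀ k ∈ K.1, g⁻¹ * k * g ∈ L.1) (x : G) :
    (quotMul K L g h).toFun ((x : G) : G ⧸ K.1) = ((x * g : G) : G ⧸ L.1) := rfl

lemma quotMul_comp (K L N : 𝒦.carrier) (g g' : G) (h : ∀ k ∈ K.1, g⁻¹ * k * g ∈ L.1)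
    (h' : ∀ k ∈ L.1, g'⁻¹ * k * g' ∈ N.1) (h'' : ∀ k ∈ K.1, (g * g')⁻¹ * k * (g * g') ∈ N.1) :
    quotMul K L g h ≫ quotMul L N g' h' = quotMul K N (g * g') h'' := by
  ext s
  obtain ⟨x, rfl⟩ := QuotientGroup.mk_surjective (s : G ⧸ K.1)
  change ((x * g * g' : G) : G ⧸ N.1) = ((x * (g * g') : G) : G ⧸ N.1)
  rw [mul_assoc]

lemma quotMul_eq_id (K : 𝒦.carrier) (g : G) (hg : g ∈ K.1) (h : ∀ k ∈ K.1, g⁻¹ * k * g ∈ K.1) :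
    quotMul K K g h = 𝟙 _ := by
  ext s
  obtain ⟨x, rfl⟩ := QuotientGroup.mk_surjective (s : G ⧸ K.1)
  change ((x * g : G) : G ⧸ K.1) = ((x : G) : G ⧸ K.1)
  exact (QuotientGroup.eq.2 (by simpa using hg)).symm

variable (𝒦) in
/-- The topology on the category of `G`-sets for which a family of maps is covering if and only if
it is jointly surjective. -/
def topology : GrothendieckTopology (GSet 𝒦) where
  sieves S := {A | ∀ s : S.carrier, ∃ (T : GSet 𝒦) (f : T ⟶ S) (t : T.carrier),
    A f ∧ f.toFun t = s}
  top_mem' S s := ⟨S, 𝟙 S, s, trivial, rfl⟩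
  pullback_stable' S T A f hA t := by
    obtain ⟨W, p, w, hp, hw⟩ := hA (f.toFun t)
    have hopen : IsOpen ((MulAction.stabilizer G t ⊓ MulAction.stabilizer G w : Subgroup G) :
        Set G) := (𝒦.isOpen _ (T.stabilizer_mem t)).inter (𝒦.isOpen _ (W.stabilizer_mem w))
    let K : 𝒦.carrier := ⟨MulAction.stabilizer G t ⊓ MulAction.stabilizer G w,
      𝒦.mem_of_le _ (T.stabilizer_mem t) _ inf_le_left hopen⟩
    refine ⟨quot K, quotHom K t inf_le_left, ((1 : G) : G ⧸ K.1), ?_, one_smul G t⟩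
    have : quotHom K t inf_le_left ≫ f = quotHom K w inf_le_right ≫ p := by
      ext s
      obtain ⟨x, rfl⟩ := QuotientGroup.mk_surjective (s : G ⧸ K.1)
      change f.toFun (x • t) = p.toFun (x • w)
      rw [f.map_smul, p.map_smul, hw]
    change A _
    rw [this]
    exact A.downward_closed hp _
  transitive' S A hA B hB s := by
    obtain ⟨T, f, t, hf, rfl⟩ := hA s
    obtain ⟨W, p, w, hp, rfl⟩ := hB hf t
    exact ⟨W, p ≫ f, w, hp, rfl⟩

end GSet

section Induction

variable [IsTopologicalGroup G] {𝒦 : SubgroupFamily G} (K : 𝒦.carrier)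

/-- The equivalence relation on `G × S` with `(g k, k⁻¹ • s) ∼ (g, s)` for `k` in `K`. -/
def inducedSetoid (S : GSet (SubgroupFamily.all K.1)) : Setoid (G × S.carrier) where
  r a b := ∃ k : K.1, b = (a.1 * (k : G), k⁻¹ • a.2)
  iseqv :=
    { refl := fun a ↦ ⟨1, by simp⟩
      symm := by
        rintro a b ⟨k, rfl⟩
        exact ⟨k⁻¹, by simp⟩
      trans := by
        rintro a b c ⟨k, rfl⟩ ⟨l, rfl⟩
        exact ⟨k * l, by simp [mul_assoc, mul_smul]⟩ }

instance (S : GSet (SubgroupFamily.all K.1)) : MulAction G (Quotient (inducedSetoid K S)) where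
  smul g := Quotient.map (fun a ↦ (g * a.1, a.2)) (by
    rintro a b ⟨k, rfl⟩
    exact ⟨k, by simp [mul_assoc]⟩)
  one_smul := by
    rintro ⟨a⟩
    exact congrArg (Quotient.mk (inducedSetoid K S)) (by simp)
  mul_smul g h := by
    rintro ⟨a⟩
    exact congrArg (Quotient.mk (inducedSetoid K S)) (by simp [mul_assoc])

/-- The `G`-set `G ×_K S` induced from a `K`-set `S`. -/
def inducedObj (S : GSet (SubgroupFamily.all K.1)) : GSet 𝒦 where
  carrier := Quotient (inducedSetoid K S)
  stabilizer_mem := by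
    rintro ⟨g, s⟩
    let H : Subgroup G := (MulAction.stabilizer K.1 s).map K.1.subtype
    have hopen : IsOpen (H : Set G) := by
      have := (𝒦.isOpen _ K.2).isOpenMap_subtype_val _ (S.stabilizer_mem s)
      exact this
    have hH : H ∈ 𝒦.carrier := 𝒦.mem_of_le _ K.2 H (by
      rintro _ ⟨k, -, rfl⟩
      exact k.2) hopen
    have key : MulAction.stabilizer G (Quotient.mk (inducedSetoid K S) (g, s)) =
        H.map (MulAut.conj g).toMonoidHom := by
      ext h
      simp only [MulAction.mem_stabilizer_iff, Subgroup.mem_map]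
      constructor
      · intro e
        obtain ⟨k, hk⟩ := Quotient.exact (s := inducedSetoid K S) e.symm
        obtain ⟨h1, h2⟩ := Prod.ext_iff.1 hk
        dsimp at h1 h2
        refine ⟨k, ⟨k, ?_, rfl⟩, ?_⟩
        · exact (eq_inv_smul_iff.1 h2)
        · simp [← h1]
      · rintro ⟨_, ⟨k, hk, rfl⟩, rfl⟩
        refine (Quotient.sound (s := inducedSetoid K S) ⟨k, ?_⟩).symm
        refine Prod.ext (by simp) ?_
        exact eq_inv_smul_iff.2 hk
    exact key ▸ 𝒦.conj_mem _ hH g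

/-- Induction `S ↦ G ×_K S` from discrete `K`-sets. -/
def inducedFunctor : GSet (SubgroupFamily.all K.1) ⥤ GSet 𝒦 where
  obj S := inducedObj K S
  map {S T} f :=
    { toFun := Quotient.map (sa := inducedSetoid K S) (sb := inducedSetoid K T)
        (fun a ↦ (a.1, f.toFun a.2)) (by
          rintro a b ⟨k, rfl⟩
          exact ⟨k, by simp [f.map_smul]⟩)
      map_smul := by
        rintro g ⟨a⟩
        rfl }
  map_id S := by
    ext s
    obtain ⟨a, rfl⟩ := Quotient.exists_rep (s := inducedSetoid K S) s
    rfl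
  map_comp f g := by
    ext s
    obtain ⟨a, rfl⟩ := Quotient.exists_rep (s := inducedSetoid K _) s
    rfl

end Induction

end GSets

/-! ### Categories of elements of presheaves of sets, and their topologies -/

section Elements

variable {C : Type (u + 1)} [Category.{u} C]

/-- The category of pairs `(U, α)` with `α ∈ P(U)`, for a presheaf of sets `P`. -/
structure El (P : Cᵒᵖ ⥤ Type (u + 1)) where
  /-- the underlying object -/
  base : C
  /-- the section -/
  sec : P.obj (op base)

namespace El

variable {P Q : Cᵒᵖ ⥤ Type (u + 1)}

/-- Morphisms `(U, α) ⟶ (V, β)` are morphisms `φ : U ⟶ V` with `φ^* β = α`. -/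
@[ext]
structure Hom (a b : El P) where
  /-- the underlying morphism -/
  hom : a.base ⟶ b.base
  map_sec : P.map hom.op b.sec = a.sec

@[simps id_hom comp_hom]
instance : Category (El P) where
  Hom := Hom
  id a := ⟨𝟙 _, by simp⟩
  comp f g := ⟨f.hom ≫ g.hom, by simp [g.map_sec, f.map_sec]⟩

@[ext]
lemma hom_ext {a b : El P} {f g : a ⟶ b} (h : f.hom = g.hom) : f = g := Hom.ext h

/-- The object `(V, φ^* α)` for `φ : V ⟶ U`. -/
def pull (a : El P) {V : C} (φ : V ⟶ a.base) : El P := ⟨V, P.map φ.op a.sec⟩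

/-- The morphism `(V, φ^* α) ⟶ (U, α)`. -/
def pullHom (a : El P) {V : C} (φ : V ⟶ a.base) : a.pull φ ⟶ a := ⟨φ, rfl⟩

/-- The forgetful functor. -/
@[simps]
def forget (P : Cᵒᵖ ⥤ Type (u + 1)) : El P ⥤ C where
  obj a := a.base
  map f := f.hom

lemma mem_iff {a b : El P} (A : Sieve a) (f : b ⟶ a) : A f ↔ A (a.pullHom f.hom) := by
  have key : ∀ {V : C} (β : P.obj (op V)) (φ : V ⟶ a.base) (h : P.map φ.op a.sec = β),
      A (Y := ⟨V, β⟩) ⟨φ, h⟩ ↔ A (a.pullHom φ) := by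
    rintro V _ φ rfl
    rfl
  exact key b.sec f.hom f.map_sec

/-- The sieve on `U` of the morphisms underlying a sieve on `(U, α)`. -/
def under {a : El P} (A : Sieve a) : Sieve a.base where
  arrows V φ := A (a.pullHom φ)
  downward_closed {V W φ} h ψ := by
    have h' := A.downward_closed h ((a.pull φ).pullHom ψ)
    rw [mem_iff] at h'
    exact h'

lemma under_apply {a : El P} (A : Sieve a) {V : C} (φ : V ⟶ a.base) :
    under A φ ↔ A (a.pullHom φ) := Iff.rfl

lemma under_pullback {a b : El P} (A : Sieve a) (f : b ⟶ a) :
    under (A.pullback f) = (under A).pullback f.hom := by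
  ext V φ
  change A (b.pullHom φ ≫ f) ↔ A (a.pullHom (φ ≫ f.hom))
  rw [mem_iff]
  rfl

/-- The topology on the category of elements: a family of morphisms is covering if and only if the
family of the underlying morphisms is covering. -/
def topology (J : GrothendieckTopology C) (P : Cᵒᵖ ⥤ Type (u + 1)) :
    GrothendieckTopology (El P) where
  sieves a := {A | under A ∈ J a.base}
  top_mem' a := J.top_mem a.base
  pullback_stable' a b A f hA := by
    change under (A.pullback f) ∈ J b.base
    rw [under_pullback]
    exact J.pullback_stable _ hA
  transitive' a A hA B hB := by
    refine J.transitive hA _ fun V φ hφ ↦ ?_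
    have h : under (B.pullback (a.pullHom φ)) ∈ J V := hB hφ
    rw [under_pullback] at h
    exact h

lemma mem_topology_iff (J : GrothendieckTopology C) {a : El P} (A : Sieve a) :
    A ∈ topology J P a ↔ under A ∈ J a.base := Iff.rfl

/-- The functor between categories of elements induced by a morphism of presheaves. -/
@[simps]
def map (τ : P ⟶ Q) : El P ⥤ El Q where
  obj a := ⟨a.base, τ.app _ a.sec⟩
  map {a b} f := ⟨f.hom, by
    rw [← NatTrans.naturality_apply, f.map_sec]⟩

lemma under_functorPullback_map (τ : P ⟶ Q) {a : El P} (A : Sieve ((map τ).obj a)) :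
    under (A.functorPullback (map τ)) = under A := by
  ext V φ
  change A ((map τ).map (a.pullHom φ)) ↔ _
  rw [mem_iff]
  rfl

instance (J : GrothendieckTopology C) (τ : P ⟶ Q) :
    (map τ).IsCocontinuous (topology J P) (topology J Q) where
  cover_lift {a A} hA := by
    rw [mem_topology_iff, under_functorPullback_map]
    exact hA

instance (J : GrothendieckTopology C) (τ : P ⟶ Q) :
    (map τ).IsContinuous (topology J P) (topology J Q) :=
  Functor.isContinuous_of_coverPreserving
    { compatible := by
        intro ℱ Z T x hx Y₁ Y₂ W f₁ f₂ g₁ g₂ hg₁ hg₂ h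
        have h' : f₁.hom ≫ g₁.hom = f₂.hom ≫ g₂.hom := congr_arg Hom.hom h
        let p₁ : W.base ⟶ Y₁.base := f₁.hom
        let p₂ : W.base ⟶ Y₂.base := f₂.hom
        have hp : p₁ ≫ g₁.hom = p₂ ≫ g₂.hom := h'
        let k : Y₁.pull p₁ ⟶ Y₂ := ⟨p₂, by
          change P.map p₂.op Y₂.sec = P.map p₁.op Y₁.sec
          rw [← g₂.map_sec, ← g₁.map_sec, ← Functor.map_comp_apply, ← Functor.map_comp_apply,
            ← op_comp, ← op_comp, hp]⟩
        let e : W ⟶ (map τ).obj (Y₁.pull p₁) := ⟨𝟙 _, by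
          have h₁ : Q.map p₁.op (τ.app _ Y₁.sec) = W.sec := f₁.map_sec
          change Q.map (𝟙 _) (τ.app _ (P.map p₁.op Y₁.sec)) = W.sec
          rw [NatTrans.naturality_apply, h₁]
          simp⟩
        have e₁ : f₁ = e ≫ (map τ).map (Y₁.pullHom p₁) := by
          ext
          exact (Category.id_comp p₁).symm
        have e₂ : f₂ = e ≫ (map τ).map k := by
          ext
          exact (Category.id_comp p₂).symm
        have key := hx (Y₁.pullHom p₁) k hg₁ hg₂ (by ext; exact hp)
        rw [e₁, e₂, op_comp, op_comp, Functor.map_comp_apply, Functor.map_comp_apply]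
        exact congrArg (ℱ.obj.map e.op) key }
    { cover_preserve := fun {a A} hA ↦ by
        rw [mem_topology_iff] at hA ⊢
        refine J.superset_covering ?_ hA
        intro V φ hφ
        refine ⟨a.pull φ, a.pullHom φ, ⟨𝟙 _, ?_⟩, hφ, ?_⟩
        · change Q.map (𝟙 _) (τ.app _ (P.map φ.op a.sec)) = Q.map φ.op (τ.app _ a.sec)
          have h : τ.app _ (P.map φ.op a.sec) = Q.map φ.op (τ.app _ a.sec) :=
            NatTrans.naturality_apply τ _ _
          rw [h]
          simp
        · ext
          exact (Category.id_comp φ).symm }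

variable (P) in
/-- The functor from the category of objects over `U` to the category of elements which is given by
a section over `U`. -/
@[simps]
def ofOver {U : C} (α : P.obj (op U)) : Over U ⥤ El P where
  obj V := ⟨V.left, P.map V.hom.op α⟩
  map {V W} f := ⟨f.left, by simp [← Functor.map_comp_apply, ← op_comp]⟩

instance (J : GrothendieckTopology C) {U : C} (α : P.obj (op U)) :
    (ofOver P α).IsContinuous (J.over U) (topology J P) :=
  Functor.isContinuous_of_coverPreserving
    { compatible := by
        intro ℱ Z T x hx Y₁ Y₂ W f₁ f₂ g₁ g₂ hg₁ hg₂ h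
        let p₁ : W.base ⟶ Y₁.left := f₁.hom
        let p₂ : W.base ⟶ Y₂.left := f₂.hom
        have hp : p₁ ≫ g₁.left = p₂ ≫ g₂.left := congr_arg Hom.hom h
        have hp' : p₂ ≫ Y₂.hom = p₁ ≫ Y₁.hom := by
          rw [← Over.w g₁, ← Over.w g₂, reassoc_of% hp]
        let k₁ : Over.mk (p₁ ≫ Y₁.hom) ⟶ Y₁ := Over.homMk p₁
        let k₂ : Over.mk (p₁ ≫ Y₁.hom) ⟶ Y₂ := Over.homMk p₂ hp'
        let e : W ⟶ (ofOver P α).obj (Over.mk (p₁ ≫ Y₁.hom)) := ⟨𝟙 _, by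
          have h₁ : P.map p₁.op (P.map Y₁.hom.op α) = W.sec := f₁.map_sec
          change P.map (𝟙 _) (P.map (p₁ ≫ Y₁.hom).op α) = W.sec
          rw [← h₁, op_comp, Functor.map_comp_apply]
          simp⟩
        have e₁ : f₁ = e ≫ (ofOver P α).map k₁ := by
          ext
          exact (Category.id_comp p₁).symm
        have e₂ : f₂ = e ≫ (ofOver P α).map k₂ := by
          ext
          exact (Category.id_comp p₂).symm
        have key := hx k₁ k₂ hg₁ hg₂ (by ext; exact hp)
        rw [e₁, e₂, op_comp, op_comp, Functor.map_comp_apply, Functor.map_comp_apply]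
        exact congrArg (ℱ.obj.map e.op) key }
    { cover_preserve := fun {V A} hA ↦ by
        rw [GrothendieckTopology.mem_over_iff] at hA
        rw [mem_topology_iff]
        refine J.superset_covering ?_ hA
        intro W (φ : W ⟶ V.left) hφ
        replace hφ := (Sieve.overEquiv_iff A φ).1 hφ
        refine ⟨_, _, ⟨𝟙 _, ?_⟩, hφ, ?_⟩
        · change P.map (𝟙 _) (P.map (φ ≫ V.hom).op α) = P.map φ.op (P.map V.hom.op α)
          rw [op_comp, Functor.map_comp_apply]
          simp
        · ext
          exact (Category.id_comp φ).symm }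

end El

end Elements

/-! ### Objects of a site which are parametrized by `G`-sets -/

section SObjects

variable {G : Type u} [Group G] [TopologicalSpace G] {𝒦 : SubgroupFamily G}
variable {C : Type (u + 1)} [Category.{u} C]

/-- `𝒮`-objects of a site: continuous functors on `𝒮` which commute with coproducts. Since every
morphism of `𝒮` is part of a covering, continuous functors preserve all fibre products. -/
structure IsSObject (J : GrothendieckTopology C) (X : GSet 𝒦 ⥤ C) : Prop where
  coverPreserving : CoverPreserving (GSet.topology 𝒦) J X
  preservesPullbacks : PreservesLimitsOfShape WalkingCospan X
  preservesCoproducts : ∀ ι : Type u, PreservesColimitsOfShape (Discrete ι) X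

/-- An `𝒮`-object is exact if it preserves equalizers. -/
def IsExact (X : GSet 𝒦 ⥤ C) : Prop := PreservesLimitsOfShape WalkingParallelPair X

/-- The presheaf of sets `U ↦ colim_S Hom(U, X_S)`. -/
def colimPresheaf (X : GSet 𝒦 ⥤ C) : Cᵒᵖ ⥤ Type (u + 1) where
  obj U := (X ⋙ coyoneda.obj U).ColimitType
  map {U V} φ := ↾(Quot.map (fun p ↦ ⟨p.1, φ.unop ≫ p.2⟩) (by
    rintro ⟨S, a⟩ ⟨T, b⟩ ⟨f, hf⟩
    exact ⟨f, by simp at hf; simp [hf]⟩))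
  map_id U := by
    ext ⟨S, a⟩
    exact congrArg (Quot.mk _) (by simp)
  map_comp φ ψ := by
    ext ⟨S, a⟩
    exact congrArg (Quot.mk _) (by simp)

/-- The class in `colim_S Hom(U, X_S)` of a morphism `U ⟶ X_S`. -/
def colimMk (X : GSet 𝒦 ⥤ C) {U : C} {S : GSet 𝒦} (a : U ⟶ X.obj S) :
    (colimPresheaf X).obj (op U) :=
  (X ⋙ coyoneda.obj (op U)).ιColimitType S a

lemma colimPresheaf_map_colimMk (X : GSet 𝒦 ⥤ C) {U V : C} {S : GSet 𝒦} (a : U ⟶ X.obj S)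
    (φ : V ⟶ U) : (colimPresheaf X).map φ.op (colimMk X a) = colimMk X (φ ≫ a) := rfl

lemma colimMk_comp_map (X : GSet 𝒦 ⥤ C) {U : C} {S T : GSet 𝒦} (a : U ⟶ X.obj S) (f : S ⟶ T) :
    colimMk X (a ≫ X.map f) = colimMk X a :=
  (X ⋙ coyoneda.obj (op U)).ιColimitType_map f a

/-- The map on `colim_S Hom(U, X_S)` induced by a natural transformation. -/
def colimMap {X Y : GSet 𝒦 ⥤ C} (f : X ⟶ Y) : colimPresheaf X ⟶ colimPresheaf Y where
  app U := ↾(Quot.map (fun p ↦ ⟨p.1, p.2 ≫ f.app p.1⟩) (by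
    rintro ⟨S, a⟩ ⟨T, b⟩ ⟨h, hf⟩
    exact ⟨h, by simp at hf; simp [hf]⟩))
  naturality U V φ := by
    ext ⟨S, a⟩
    exact congrArg (Quot.mk _) (by simp)

/-- The map on `colim_S Hom(U, X_S)` induced by reindexing along a functor. -/
def colimReindex {G' : Type u} [Group G'] [TopologicalSpace G'] {𝒦' : SubgroupFamily G'}
    (I : GSet 𝒦' ⥤ GSet 𝒦) (X : GSet 𝒦 ⥤ C) : colimPresheaf (I ⋙ X) ⟶ colimPresheaf X where
  app U := ↾(Quot.map (fun p ↦ ⟨I.obj p.1, p.2⟩) (by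
    rintro ⟨S, a⟩ ⟨T, b⟩ ⟨h, hf⟩
    exact ⟨I.map h, hf⟩))
  naturality U V φ := by
    ext ⟨S, a⟩
    rfl

/-- The category `C/colim X`. -/
abbrev OverColim (X : GSet 𝒦 ⥤ C) := El (colimPresheaf X)

/-- The lift `S ↦ (X_S, α_S)` of `X` to `C/colim X`, where `α_S` is the class of the identity. -/
def liftColim (X : GSet 𝒦 ⥤ C) : GSet 𝒦 ⥤ OverColim X where
  obj S := ⟨X.obj S, colimMk X (𝟙 _)⟩
  map {S T} f := ⟨X.map f, by
    rw [colimPresheaf_map_colimMk, Category.comp_id]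
    simpa using colimMk_comp_map X (𝟙 (X.obj S)) f⟩

variable (R : Type (u + 1)) [CommRing R]

/-- The category of sheaves of `R`-modules on `C/colim X`. -/
abbrev Sh (J : GrothendieckTopology C) (X : GSet 𝒦 ⥤ C) :=
  Sheaf (El.topology J (colimPresheaf X)) (ModuleCat.{u + 1} R)

end SObjects

/-! ### Instances for categories of sheaves -/

section Instances

variable (R : Type (u + 1)) [CommRing R] {E : Type (u + 1)} [Category.{u} E]
  (K : GrothendieckTopology E)

instance : IsGrothendieckAbelian.{u + 1} (Sheaf K (ModuleCat.{u + 1} R)) := by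
  have : EssentiallySmall.{u + 1} E := inferInstance
  exact Sheaf.isGrothendieckAbelian_of_essentiallySmall K (ModuleCat.{u + 1} R)

instance (U : Eᵒᵖ) : ((sheafSections K (ModuleCat.{u + 1} R)).obj U).Additive where
  map_add := rfl

variable {E' : Type (u + 1)} [Category.{u} E'] (K' : GrothendieckTopology E') (F : E ⥤ E')

instance [F.IsContinuous K K'] :
    (F.sheafPushforwardContinuous (ModuleCat.{u + 1} R) K K').Additive where
  map_add := rfl

instance [F.IsCocontinuous K K'] [F.IsContinuous K K'] :
    (F.sheafPushforwardCocontinuous (ModuleCat.{u + 1} R) K K').Additive :=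
  (F.sheafAdjunctionCocontinuous (ModuleCat.{u + 1} R) K K').right_adjoint_additive

end Instances

/-! ### The smooth representation attached to a presheaf on `𝒮` -/

section SmoothLimit

variable {G : Type u} [Group G] [TopologicalSpace G] (𝒦 : SubgroupFamily G)

instance : Nonempty (𝒦.carrier)ᵒᵈ :=
  let ⟨K, hK, _⟩ := 𝒦.cofinal ⊤ isOpen_univ
  ⟨OrderDual.toDual ⟨K, hK⟩⟩

instance : IsDirectedOrder (𝒦.carrier)ᵒᵈ where
  directed K L := ⟨OrderDual.toDual ⟨(OrderDual.ofDual K).1 ⊓ (OrderDual.ofDual L).1,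
    𝒦.mem_of_le _ (OrderDual.ofDual K).2 _ inf_le_left
      ((𝒦.isOpen _ (OrderDual.ofDual K).2).inter (𝒦.isOpen _ (OrderDual.ofDual L).2))⟩,
    (inf_le_left : (OrderDual.ofDual K).1 ⊓ (OrderDual.ofDual L).1 ≤ (OrderDual.ofDual K).1),
    (inf_le_right : (OrderDual.ofDual K).1 ⊓ (OrderDual.ofDual L).1 ≤ (OrderDual.ofDual L).1)⟩

instance : DecidableEq (𝒦.carrier)ᵒᵈ := Classical.decEq _

variable {𝒦}

/-- The conjugate subgroup `g K g⁻¹`. -/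
def conjK (K : 𝒦.carrier) (g : G) : 𝒦.carrier :=
  ⟨K.1.map (MulAut.conj g).toMonoidHom, 𝒦.conj_mem _ K.2 g⟩

lemma conjK_spec (K : 𝒦.carrier) (g : G) : ∀ k ∈ (conjK K g).1, g⁻¹ * k * g ∈ K.1 := by
  rintro _ ⟨k, hk, rfl⟩
  simpa [mul_assoc] using hk

variable {R : Type (u + 1)} [CommRing R] (N : (GSet 𝒦)ᵒᵖ ⥤ ModuleCat.{u + 1} R)

/-- The map `N(G ⧸ L) ⟶ N(G ⧸ K)` induced by `h K ↦ h g L`, for `K ⊆ g L g⁻¹`. -/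
def transMap (K L : 𝒦.carrier) (g : G) (h : ∀ k ∈ K.1, g⁻¹ * k * g ∈ L.1) :
    N.obj (op (GSet.quot L)) →ₗ[R] N.obj (op (GSet.quot K)) :=
  (N.map (GSet.quotMul K L g h).op).hom

lemma transMap_transMap (K L P : 𝒦.carrier) (g g' : G) (h : ∀ k ∈ K.1, g⁻¹ * k * g ∈ L.1)
    (h' : ∀ k ∈ L.1, g'⁻¹ * k * g' ∈ P.1) (h'' : ∀ k ∈ K.1, (g * g')⁻¹ * k * (g * g') ∈ P.1)
    (x : N.obj (op (GSet.quot P))) :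
    transMap N K L g h (transMap N L P g' h' x) = transMap N K P (g * g') h'' x := by
  change (N.map _ ≫ N.map _).hom x = _
  rw [← Functor.map_comp, ← op_comp, GSet.quotMul_comp (h'' := h'')]
  rfl

lemma transMap_of_mem (K : 𝒦.carrier) (g : G) (hg : g ∈ K.1) (h : ∀ k ∈ K.1, g⁻¹ * k * g ∈ K.1)
    (x : N.obj (op (GSet.quot K))) : transMap N K K g h x = x := by
  rw [transMap, GSet.quotMul_eq_id K g hg]
  simp

/-- The transition maps `N(G ⧸ K) ⟶ N(G ⧸ L)` for `L ⊆ K`. -/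
def res (K L : (𝒦.carrier)ᵒᵈ) (h : K ≤ L) :
    N.obj (op (GSet.quot (OrderDual.ofDual K))) →ₗ[R] N.obj (op (GSet.quot (OrderDual.ofDual L))) :=
  transMap N (OrderDual.ofDual L) (OrderDual.ofDual K) 1 fun k hk ↦ by
    simpa using (show (OrderDual.ofDual L).1 ≤ (OrderDual.ofDual K).1 from h) hk

instance : DirectedSystem (fun K : (𝒦.carrier)ᵒᵈ ↦ N.obj (op (GSet.quot (OrderDual.ofDual K))))
    (fun K L h ↦ res N K L h) where
  map_self K x := transMap_of_mem N _ 1 (one_mem _) _ x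
  map_map {P L K} h h' x := by
    have := transMap_transMap N (OrderDual.ofDual P) (OrderDual.ofDual L) (OrderDual.ofDual K) 1 1
      (fun k hk ↦ by
        simpa using (show (OrderDual.ofDual P).1 ≤ (OrderDual.ofDual L).1 from h') hk)
      (fun k hk ↦ by
        simpa using (show (OrderDual.ofDual L).1 ≤ (OrderDual.ofDual K).1 from h) hk)
      (fun k hk ↦ by
        simpa using (show (OrderDual.ofDual P).1 ≤ (OrderDual.ofDual K).1 from h.trans h') hk) x
    simp only [mul_one] at this
    exact this

/-- The colimit of the modules `N(G ⧸ K)`, for `K` in the family. -/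
abbrev Lim : Type (u + 1) :=
  Module.DirectLimit (fun K : (𝒦.carrier)ᵒᵈ ↦ N.obj (op (GSet.quot (OrderDual.ofDual K))))
    (fun K L h ↦ res N K L h)

/-- The canonical map `N(G ⧸ K) ⟶ colim_K N(G ⧸ K)`. -/
def toLim (K : 𝒦.carrier) : N.obj (op (GSet.quot K)) →ₗ[R] Lim N :=
  Module.DirectLimit.of R (𝒦.carrier)ᵒᵈ
    (fun K : (𝒦.carrier)ᵒᵈ ↦ N.obj (op (GSet.quot (OrderDual.ofDual K))))
    (fun K L h ↦ res N K L h) (OrderDual.toDual K)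

lemma toLim_transMap_one (K L : 𝒦.carrier) (h : ∀ k ∈ L.1, (1 : G)⁻¹ * k * 1 ∈ K.1)
    (x : N.obj (op (GSet.quot K))) : toLim N L (transMap N L K 1 h x) = toLim N K x :=
  Module.DirectLimit.of_f
    (G := fun K : (𝒦.carrier)ᵒᵈ ↦ N.obj (op (GSet.quot (OrderDual.ofDual K))))
    (f := fun K L h ↦ res N K L h) (i := OrderDual.toDual K) (j := OrderDual.toDual L)
    (hij := (show L.1 ≤ K.1 from fun k hk ↦ by simpa using h k hk))

lemma toLim_transMap (K L L' : 𝒦.carrier) (g : G) (h : ∀ k ∈ L.1, g⁻¹ * k * g ∈ K.1)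
    (h' : ∀ k ∈ L'.1, g⁻¹ * k * g ∈ K.1) (x : N.obj (op (GSet.quot K))) :
    toLim N L (transMap N L K g h x) = toLim N L' (transMap N L' K g h' x) := by
  let P : 𝒦.carrier := ⟨L.1 ⊓ L'.1,
    𝒦.mem_of_le _ L.2 _ inf_le_left ((𝒦.isOpen _ L.2).inter (𝒦.isOpen _ L'.2))⟩
  have h₁ : ∀ k ∈ P.1, (1 : G)⁻¹ * k * 1 ∈ L.1 := fun k hk ↦ by simpa using hk.1
  have h₂ : ∀ k ∈ P.1, (1 : G)⁻¹ * k * 1 ∈ L'.1 := fun k hk ↦ by simpa using hk.2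
  have h₃ : ∀ k ∈ P.1, (1 * g)⁻¹ * k * (1 * g) ∈ K.1 := fun k hk ↦ by simpa using h k hk.1
  rw [← toLim_transMap_one N L P h₁, ← toLim_transMap_one N L' P h₂,
    transMap_transMap N P L K 1 g h₁ h h₃, transMap_transMap N P L' K 1 g h₂ h' h₃]

lemma exists_toLim (v : Lim N) : ∃ K x, toLim N K x = v := by
  obtain ⟨K, x, rfl⟩ := Module.DirectLimit.exists_of v
  exact ⟨OrderDual.ofDual K, x, rfl⟩

/-- The action of `g` on the colimit, which maps `N(G ⧸ K)` to `N(G ⧸ g K g⁻¹)` by means of the map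
`G ⧸ g K g⁻¹ ⟶ G ⧸ K`, `h ↦ h g`. -/
def limAct (g : G) : Lim N →ₗ[R] Lim N :=
  Module.DirectLimit.lift R (𝒦.carrier)ᵒᵈ
    (fun K : (𝒦.carrier)ᵒᵈ ↦ N.obj (op (GSet.quot (OrderDual.ofDual K))))
    (fun K L h ↦ res N K L h)
    (fun K ↦ toLim N (conjK (OrderDual.ofDual K) g) ∘ₗ
      transMap N (conjK (OrderDual.ofDual K) g) (OrderDual.ofDual K) g (conjK_spec _ _))
    (fun K L h x ↦ by
      have hle : (OrderDual.ofDual L).1 ≤ (OrderDual.ofDual K).1 := h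
      have h₁ : ∀ k ∈ (conjK (OrderDual.ofDual L) g).1, (g * 1)⁻¹ * k * (g * 1) ∈
          (OrderDual.ofDual K).1 := fun k hk ↦ by
        simpa using hle (conjK_spec _ _ k hk)
      change toLim N _ (transMap N _ _ g _ (transMap N _ _ 1 _ x)) = toLim N _ (transMap N _ _ g _ x)
      rw [transMap_transMap (h'' := h₁)]
      simp only [mul_one] at h₁ ⊢
      exact toLim_transMap N _ _ _ g _ _ x)

lemma limAct_toLim (g : G) (K L : 𝒦.carrier) (h : ∀ k ∈ L.1, g⁻¹ * k * g ∈ K.1)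
    (x : N.obj (op (GSet.quot K))) :
    limAct N g (toLim N K x) = toLim N L (transMap N L K g h x) := by
  refine (Module.DirectLimit.lift_of
    (G := fun K : (𝒦.carrier)ᵒᵈ ↦ N.obj (op (GSet.quot (OrderDual.ofDual K))))
    (f := fun K L h ↦ res N K L h) _ _ x).trans ?_
  exact toLim_transMap N _ _ _ g _ _ x

/-- The action of `G` on the colimit. -/
def limRho : Representation R G (Lim N) where
  toFun := limAct N
  map_one' := by
    refine LinearMap.ext fun v ↦ ?_
    obtain ⟨K, x, rfl⟩ := exists_toLim N v
    rw [limAct_toLim N 1 K K (fun k hk ↦ by simpa using hk), transMap_of_mem N K 1 (one_mem _)]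
    rfl
  map_mul' g g' := by
    refine LinearMap.ext fun v ↦ ?_
    obtain ⟨K, x, rfl⟩ := exists_toLim N v
    have h : ∀ k ∈ (conjK (conjK K g') g).1, (g * g')⁻¹ * k * (g * g') ∈ K.1 := fun k hk ↦ by
      simpa [mul_assoc] using conjK_spec _ _ _ (conjK_spec _ _ k hk)
    rw [Module.End.mul_apply, limAct_toLim N (g * g') K _ h,
      limAct_toLim N g' K _ (conjK_spec _ _), limAct_toLim N g _ _ (conjK_spec _ _),
      transMap_transMap (h'' := h)]

lemma isOpen_stabilizer_lim [IsTopologicalGroup G] (v : Lim N) :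
    IsOpen {g : G | limRho N g v = v} := by
  obtain ⟨K, x, rfl⟩ := exists_toLim N v
  refine isOpen_stabilizer_of_subset (V := Rep.of (limRho N)) _ (𝒦.isOpen _ K.2) (one_mem K.1)
    fun g hg ↦ ?_
  have h : ∀ k ∈ K.1, g⁻¹ * k * g ∈ K.1 := fun k hk ↦ mul_mem (mul_mem (inv_mem hg) hk) hg
  change limAct N g (toLim N K x) = _
  rw [limAct_toLim N g K K h, transMap_of_mem N K g hg]

/-- The map between the colimits induced by a natural transformation. -/
def limMap {N N' : (GSet 𝒦)ᵒᵖ ⥤ ModuleCat.{u + 1} R} (φ : N ⟶ N') : Lim N →ₗ[R] Lim N' :=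
  Module.DirectLimit.lift R (𝒦.carrier)ᵒᵈ
    (fun K : (𝒦.carrier)ᵒᵈ ↦ N.obj (op (GSet.quot (OrderDual.ofDual K))))
    (fun K L h ↦ res N K L h)
    (fun K ↦ toLim N' (OrderDual.ofDual K) ∘ₗ (φ.app (op (GSet.quot (OrderDual.ofDual K)))).hom)
    (fun K L h x ↦ by
      change toLim N' _ ((N.map _ ≫ φ.app _).hom x) = _
      rw [φ.naturality]
      exact toLim_transMap_one N' (OrderDual.ofDual K) (OrderDual.ofDual L)
        (fun k hk ↦ by simpa using (show (OrderDual.ofDual L).1 ≤ (OrderDual.ofDual K).1 from h) hk)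
        ((φ.app _).hom x))

lemma limMap_toLim {N N' : (GSet 𝒦)ᵒᵖ ⥤ ModuleCat.{u + 1} R} (φ : N ⟶ N') (K : 𝒦.carrier)
    (x : N.obj (op (GSet.quot K))) :
    limMap φ (toLim N K x) = toLim N' K ((φ.app (op (GSet.quot K))).hom x) := by
  exact Module.DirectLimit.lift_of
    (G := fun K : (𝒦.carrier)ᵒᵈ ↦ N.obj (op (GSet.quot (OrderDual.ofDual K))))
    (f := fun K L h ↦ res N K L h) _ _ x

variable (R 𝒦) in
/-- The functor which maps a presheaf `N` on `𝒮` to the smooth representation `colim_K N(G ⧸ K)`. -/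
def limFunctor [IsTopologicalGroup G] : ((GSet 𝒦)ᵒᵖ ⥤ ModuleCat.{u + 1} R) ⥤ SmoothRep R G where
  obj N := ⟨Rep.of (limRho N), isOpen_stabilizer_lim N⟩
  map {N N'} φ := ObjectProperty.homMk (Rep.ofHom
    { toLinearMap := limMap φ
      isIntertwining' := fun g ↦ by
        refine LinearMap.ext fun v ↦ ?_
        obtain ⟨K, x, rfl⟩ := exists_toLim N v
        change limMap φ (limAct N g (toLim N K x)) = limAct N' g (limMap φ (toLim N K x))
        rw [limMap_toLim, limAct_toLim N g K _ (conjK_spec _ _), limMap_toLim,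
          limAct_toLim N' g K _ (conjK_spec _ _)]
        refine congrArg _ ?_
        exact congr($(φ.naturality (GSet.quotMul _ K g (conjK_spec _ _)).op).hom x) })
  map_id N := by
    apply ObjectProperty.hom_ext
    apply Rep.hom_ext
    apply Representation.IntertwiningMap.toLinearMap_injective
    refine LinearMap.ext fun v ↦ ?_
    obtain ⟨K, x, rfl⟩ := exists_toLim N v
    exact (limMap_toLim (𝟙 N) K x)
  map_comp {N N' N''} φ ψ := by
    apply ObjectProperty.hom_ext
    apply Rep.hom_ext
    apply Representation.IntertwiningMap.toLinearMap_injective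
    refine LinearMap.ext fun v ↦ ?_
    obtain ⟨K, x, rfl⟩ := exists_toLim N v
    change limMap (φ ≫ ψ) (toLim N K x) = limMap ψ (limMap φ (toLim N K x))
    rw [limMap_toLim, limMap_toLim, limMap_toLim]
    rfl

instance [IsTopologicalGroup G] : (limFunctor 𝒦 R).Additive where
  map_add {N N' φ ψ} := by
    apply ObjectProperty.hom_ext
    apply Rep.hom_ext
    apply Representation.IntertwiningMap.toLinearMap_injective
    refine LinearMap.ext fun v ↦ ?_
    obtain ⟨K, x, rfl⟩ := exists_toLim N v
    change limMap (φ + ψ) (toLim N K x) = limMap φ (toLim N K x) + limMap ψ (toLim N K x)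
    rw [limMap_toLim, limMap_toLim, limMap_toLim, ← map_add]
    rfl

end SmoothLimit

/-! ### Compact induction -/

section CompactInduction

variable {R : Type (u + 1)} [CommRing R] {G : Type u} [Group G] [TopologicalSpace G]
  [IsTopologicalGroup G] (K : Subgroup G) (V : SmoothRep R K)

/-- The functions `Φ : G → V` with `Φ(k g) = k Φ(g)` for `k ∈ K` which are invariant under right
translation by an open subgroup and whose support is compact modulo `K`. -/
def cIndModule : Submodule R (G → V.obj.V) where
  carrier := {Φ | (∀ (k : K) (g : G), Φ (k * g) = V.obj.ρ k (Φ g)) ∧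
    (∃ U : Subgroup G, IsOpen (U : Set G) ∧ ∀ g, ∀ u ∈ U, Φ (g * u) = Φ g) ∧
    ∃ Z : Set G, IsCompact Z ∧ ∀ g, Φ g ≠ 0 → ∃ k : K, ∃ z ∈ Z, g = k * z}
  zero_mem' := ⟨by simp, ⟨⊤, isOpen_univ, by simp⟩, ∅, isCompact_empty, by simp⟩
  add_mem' := by
    rintro Φ Ψ ⟨h₁, ⟨U, hU, h₂⟩, Z, hZ, h₃⟩ ⟨h₁', ⟨U', hU', h₂'⟩, Z', hZ', h₃'⟩
    refine ⟨fun k g ↦ by simp [h₁, h₁'], ⟨U ⊓ U', hU.inter hU', fun g u hu ↦ by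
      simp [h₂ g u hu.1, h₂' g u hu.2]⟩, Z ∪ Z', hZ.union hZ', fun g hg ↦ ?_⟩
    by_cases h : Φ g = 0
    · obtain ⟨k, z, hz, e⟩ := h₃' g (by simpa [h] using hg)
      exact ⟨k, z, Or.inr hz, e⟩
    · obtain ⟨k, z, hz, e⟩ := h₃ g h
      exact ⟨k, z, Or.inl hz, e⟩
  smul_mem' := by
    rintro r Φ ⟨h₁, ⟨U, hU, h₂⟩, Z, hZ, h₃⟩
    refine ⟨fun k g ↦ by simp [h₁], ⟨U, hU, fun g u hu ↦ by simp [h₂ g u hu]⟩, Z, hZ,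
      fun g hg ↦ h₃ g fun h ↦ hg (by simp [h])⟩

/-- The action of `G` on the compact induction, `(g Φ)(x) = Φ(x g)`. -/
def cIndRho : Representation R G (cIndModule K V) where
  toFun g :=
    { toFun := fun Φ ↦ ⟨fun x ↦ Φ.1 (x * g), by
        obtain ⟨Φ, h₁, ⟨U, hU, h₂⟩, Z, hZ, h₃⟩ := Φ
        refine ⟨fun k x ↦ by simpa [mul_assoc] using h₁ k (x * g),
          ⟨U.map (MulAut.conj g).toMonoidHom,
            (SubgroupFamily.all G).conj_mem U hU g, ?_⟩,
          (fun z ↦ z * g⁻¹) '' Z, hZ.image (by fun_prop), fun x hx ↦ ?_⟩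
        · rintro x _ ⟨u, hu, rfl⟩
          simpa [mul_assoc] using h₂ (x * g) u hu
        · obtain ⟨k, z, hz, e⟩ := h₃ _ hx
          exact ⟨k, _, ⟨z, hz, rfl⟩, by rw [← mul_assoc, ← e]; simp⟩⟩
      map_add' := fun _ _ ↦ rfl
      map_smul' := fun _ _ ↦ rfl }
  map_one' := by
    refine LinearMap.ext fun Φ ↦ Subtype.ext (funext fun x ↦ ?_)
    exact congrArg Φ.1 (mul_one x)
  map_mul' g g' := by
    refine LinearMap.ext fun Φ ↦ Subtype.ext (funext fun x ↦ ?_)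
    exact congrArg Φ.1 (mul_assoc x g g').symm

/-- The compactly induced representation. -/
def cInd : SmoothRep R G where
  obj := Rep.of (cIndRho K V)
  property Φ := by
    obtain ⟨U, hU, h⟩ := Φ.2.2.1
    refine isOpen_stabilizer_of_subset (V := Rep.of (cIndRho K V)) Φ hU (one_mem U) fun u hu ↦ ?_
    exact Subtype.ext (funext fun x ↦ h x u hu)

variable (R G) in
/-- The trivial representation on `R`. -/
def trivialRep : SmoothRep R G where
  obj := Rep.trivial R G R
  property v := by
    have : {g : G | (Rep.trivial R G R).ρ g v = v} = Set.univ := by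
      ext
      simp
    rw [this]
    exact isOpen_univ

end CompactInduction

/-! ### Cohomology -/

section Cohomology

variable {G : Type u} [Group G] [TopologicalSpace G] [IsTopologicalGroup G] {𝒦 : SubgroupFamily G}
variable {C : Type (u + 1)} [Category.{u} C] (J : GrothendieckTopology C)
variable (R : Type (u + 1)) [CommRing R]

/-- The restriction of presheaves on `C/colim X` to `𝒮` along `S ↦ (X_S, α_S)`. -/
def toPresheaf (X : GSet 𝒦 ⥤ C) : Sh R J X ⥤ (GSet 𝒦)ᵒᵖ ⥤ ModuleCat.{u + 1} R :=
  sheafToPresheaf _ _ ⋙ (Functor.whiskeringLeft _ _ _).obj (liftColim X).op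

instance (X : GSet 𝒦 ⥤ C) : (toPresheaf J R X).Additive where
  map_add := rfl

/-- The functor `H⁰(X_∞, ·)`, `F ↦ colim_K F(X_K, α_K)`. -/
def HZeroInf (X : GSet 𝒦 ⥤ C) : Sh R J X ⥤ SmoothRep R G := toPresheaf J R X ⋙ limFunctor 𝒦 R

instance (X : GSet 𝒦 ⥤ C) : (HZeroInf J R X).Additive := by
  unfold HZeroInf
  infer_instance

/-- The functors `Hⁿ(X_∞, ·)`. -/
def HInf (X : GSet 𝒦 ⥤ C) (n : ℕ) : Sh R J X ⥤ SmoothRep R G := (HZeroInf J R X).rightDerived n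

variable {R}

/-- The functor `H⁰_R(X; M, ·) = Hom_{R[G]}(M, H⁰(X_∞, ·))`. -/
def HZero (X : GSet 𝒦 ⥤ C) (M : SmoothRep R G) : Sh R J X ⥤ ModuleCat.{u + 1} R :=
  HZeroInf J R X ⋙ (linearCoyoneda R (SmoothRep R G)).obj (op M)

instance (X : GSet 𝒦 ⥤ C) (M : SmoothRep R G) : (HZero J X M).Additive := by
  unfold HZero
  infer_instance

/-- The functors `Hⁿ_R(X; M, ·)`: the right derived functors of `H⁰_R(X; M, ·)`. -/
def HR (X : GSet 𝒦 ⥤ C) (M : SmoothRep R G) (n : ℕ) : Sh R J X ⥤ ModuleCat.{u + 1} R :=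
  (HZero J X M).rightDerived n

/-- The `R`-module of `G`-equivariant maps from a `G`-set to a representation. -/
def equivariantMaps (S : GSet 𝒦) (M : SmoothRep R G) : Submodule R (S.carrier → M.obj.V) where
  carrier := {φ | ∀ (g : G) (s : S.carrier), φ (g • s) = M.obj.ρ g (φ s)}
  zero_mem' := by simp
  add_mem' hφ hψ g s := by simp [hφ g s, hψ g s]
  smul_mem' r φ hφ g s := by simp [hφ g s]

variable (𝒦) in
/-- The presheaf `S ↦ Maps_G(S, M)` on `𝒮`. -/
def mapsPresheaf (M : SmoothRep R G) : (GSet 𝒦)ᵒᵖ ⥤ ModuleCat.{u + 1} R where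
  obj S := ModuleCat.of R (equivariantMaps S.unop M)
  map {S T} f := ModuleCat.ofHom
    { toFun := fun φ ↦ ⟨φ.1 ∘ f.unop.toFun, fun g s ↦ by
        simp [f.unop.map_smul, φ.2 g (f.unop.toFun s)]⟩
      map_add' := fun _ _ ↦ rfl
      map_smul' := fun _ _ ↦ rfl }

/-- The sheaf `M_{X, G}`: the inverse image of the sheaf `S ↦ Maps_G(S, M)` along `𝒮 → C/colim X`,
i.e. the sheafification of its left Kan extension. -/
def inverseImage (X : GSet 𝒦 ⥤ C) (M : SmoothRep R G) : Sh R J X :=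
  (presheafToSheaf (El.topology J (colimPresheaf X)) (ModuleCat.{u + 1} R)).obj
    ((liftColim X).op.lan.obj (mapsPresheaf 𝒦 M))

variable (R)

/-- The `𝒮_K`-object `X|_K`, `S ↦ X(G ×_K S)`. -/
abbrev restrictSub (X : GSet 𝒦 ⥤ C) (K : 𝒦.carrier) : GSet (SubgroupFamily.all K.1) ⥤ C :=
  inducedFunctor K ⋙ X

/-- The restriction `F ↦ F_K` from sheaves on `X` to sheaves on `X|_K`. -/
def resSub (X : GSet 𝒦 ⥤ C) (K : 𝒦.carrier) : Sh R J X ⥤ Sh R J (restrictSub X K) :=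
  (El.map (colimReindex (inducedFunctor K) X)).sheafPushforwardContinuous _ _ _

/-- The restriction `F ↦ F_S` from sheaves on `X` to sheaves on `C/X_S`. -/
def resLayer (X : GSet 𝒦 ⥤ C) (S : GSet 𝒦) :
    Sh R J X ⥤ Sheaf (J.over (X.obj S)) (ModuleCat.{u + 1} R) :=
  (El.ofOver (colimPresheaf X) (colimMk X (𝟙 (X.obj S)))).sheafPushforwardContinuous _ _ _

/-- The cohomology `Hⁿ(U, ·)` of sheaves on `C/U`: the right derived functors of the functor of
sections over the final object. -/
def HOver (U : C) (n : ℕ) : Sheaf (J.over U) (ModuleCat.{u + 1} R) ⥤ ModuleCat.{u + 1} R :=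
  ((sheafSections (J.over U) (ModuleCat.{u + 1} R)).obj (op (Over.mk (𝟙 U)))).rightDerived n

/-- The direct image along a natural transformation `f : X ⟶ Y`. -/
def directImage {X Y : GSet 𝒦 ⥤ C} (f : X ⟶ Y) : Sh R J X ⥤ Sh R J Y :=
  (El.map (colimMap f)).sheafPushforwardCocontinuous _ _ _

instance {X Y : GSet 𝒦 ⥤ C} (f : X ⟶ Y) : (directImage J R f).Additive := by
  unfold directImage
  infer_instance

/-- For all `S` and all morphisms `a b : U ⟶ X_S`: if `a` and `b` have the same image in
`Hom(U, Y_S)` and the same class in `colim_S Hom(U, X_S)`, then they are equal. In other words,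
`(X_S, α_S)` is the pullback of `(Y_S, α_S)` along `colim X ⟶ colim Y` (if `f` is cartesian, then
the map from `Hom(U, X_S)` to `Hom(U, Y_S) ×_{colim Hom(U, Y)} colim Hom(U, X)` is always
surjective). -/
def IsRepresentable {X Y : GSet 𝒦 ⥤ C} (f : X ⟶ Y) : Prop :=
  ∀ (S : GSet 𝒦) (U : C) (a b : U ⟶ X.obj S), a ≫ f.app S = b ≫ f.app S →
    colimMk X a = colimMk X b → a = b

/-- The higher direct images along a natural transformation `f : X ⟶ Y`. -/
def higherDirectImage {X Y : GSet 𝒦 ⥤ C} (f : X ⟶ Y) (n : ℕ) : Sh R J X ⥤ Sh R J Y :=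
  (directImage J R f).rightDerived n

end Cohomology

/-! ### Convergence of spectral sequences -/

section Convergence

variable {R : Type (u + 1)} [CommRing R]

/-- The term `E_∞^{p,q}` of a first quadrant spectral sequence: all differentials into and out of
the term `(p, q)` vanish from the page `p + q + 2` on. -/
def eInfty (E : E₂CohomologicalSpectralSequenceNat (ModuleCat.{u + 1} R)) (p q : ℕ) :
    ModuleCat.{u + 1} R :=
  (E.page (p + q + 2)).X (p, q)

/-- The data which express that a first quadrant spectral sequence converges to a family `H` of
modules: finite decreasing filtrations of the `H n` and isomorphisms between the graded pieces and
the terms `E_∞^{p,q}`. -/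
structure Convergence (E : E₂CohomologicalSpectralSequenceNat (ModuleCat.{u + 1} R))
    (H : ℕ → ModuleCat.{u + 1} R) where
  /-- the filtration -/
  fil (n : ℕ) : ℕ → Submodule R (H n)
  antitone (n : ℕ) : Antitone (fil n)
  fil_zero (n : ℕ) : fil n 0 = ⊤
  fil_succ (n : ℕ) : fil n (n + 1) = ⊥
  /-- the identification of the graded pieces -/
  graded (p q : ℕ) :
    (fil (p + q) p ⧸ (fil (p + q) (p + 1)).submoduleOf (fil (p + q) p)) ≃ₗ[R] eInfty E p q

/-- There is a first quadrant spectral sequence `E₂^{r,s} = A r s ⟹ H (r + s)`. -/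
def HasSpectralSequence (A : ℕ → ℕ → ModuleCat.{u + 1} R) (H : ℕ → ModuleCat.{u + 1} R) : Prop :=
  ∃ E : E₂CohomologicalSpectralSequenceNat (ModuleCat.{u + 1} R),
    (∀ r s, Nonempty ((E.page 2).X (r, s) ≅ A r s)) ∧ Nonempty (Convergence E H)

end Convergence

end SSheaf

end

open SSheaf

/-! Everything rests on one representability statement. For an `𝒮`-object `X` the functor `S ↦ (X_S,
α_S)` is continuous, so a sheaf `F` on `C/colim X` restricts to a sheaf `N` on `𝒮`. Such an `N` is
determined by the smooth module `V = colim_K N(G ⧸ K)`: its sections over `S` are the equivariant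
maps from `S` to `V` (`isDetermined_of_isSheaf`). Since `colim_K Maps_G(G ⧸ K, M) = M` for smooth
`M`, this gives `Hom(Maps_G(·, M), N) = Hom_G(M, V)`, and the adjunction given by left Kan extension
and sheafification turns the left side into `Hom(M_{X, G}, F)` (`IsSObject.hZeroIso`). Deriving in
`F` gives the first claim, because the derived functors of a Hom functor are Ext.

For (a), Frobenius reciprocity (`frobeniusEquiv`) is combined with `colim_L N(G ×_K (K ⧸ L)) = V`
(`limInducedIso`) or, for trivial coefficients, with `N(G ⧸ K) = V^K`
(`IsDetermined.bijective_toInvariants`). This identifies the functors in degree zero. The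
identification passes to derived functors because restriction along `El.map` and `El.ofOver` is
exact and preserves injectives: the Kan extensions in question are coproducts at each object, so the
left adjoint preserves monomorphisms.

Parts (b) and (c) are cases of Grothendieck's spectral sequence (`hasSpectralSequence_comp`) for a
functor that preserves injectives, followed by `Hom(A, ·)`. The functor maps an injective resolution
to a complex `C` of injectives. The morphisms from `A` to the shifted truncations of `C` in the
derived category form a spectral object with graded pieces `Ext^r(A, H^s C)` and total term `H^n
Hom(A, C)`.

In (b) the functor is `H⁰(X_∞, ·)`. Exactness of `X` makes the colimits in the Kan extension
filtered, so `M ↦ M_{X, G}` preserves monomorphisms and `H⁰(X_∞, ·)` preserves injectives. In (c)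
the functor is `f_*`, whose left adjoint is exact, and `A = M_{Y, G}`. There the hypothesis makes
`(X_S, α_S)` final among the objects of `C/colim X` over `(Y_S, α_S)`, so that `f_* F` and `F` have
the same restriction to `𝒮`. -/

noncomputable section
namespace SSheaf

/-! ### Convergence of the spectral sequence of a first quadrant spectral object. -/

section SpectralSequences

open ComposableArrows Abelian

variable {R : Type (u + 1)} [CommRing R]

/-- The graded piece of a filtration by images, as a quotient of the source of the larger image. -/
def rangeQuotientEquiv {A' A T E : Type*} [AddCommGroup A'] [AddCommGroup A] [AddCommGroup T]
    [AddCommGroup E] [Module R A'] [Module R A] [Module R T] [Module R E]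
    (a : A' →ₗ[R] A) (t : A →ₗ[R] T) (φ : A →ₗ[R] E) (hφ : Function.Surjective φ)
    (h : ∀ x, φ x = 0 ↔ ∃ y, t x = t (a y)) :
    (LinearMap.range t ⧸ (LinearMap.range (t ∘ₗ a)).submoduleOf (LinearMap.range t)) ≃ₗ[R] E :=
  let π := ((LinearMap.range (t ∘ₗ a)).submoduleOf (LinearMap.range t)).mkQ ∘ₗ t.rangeRestrict
  have hπ : Function.Surjective π :=
    (Submodule.mkQ_surjective _).comp t.surjective_rangeRestrict
  have hk : LinearMap.ker π = LinearMap.ker φ := by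
    ext x
    simp only [π, LinearMap.mem_ker, LinearMap.comp_apply, Submodule.mkQ_apply,
      Submodule.Quotient.mk_eq_zero, h]
    exact exists_congr fun y ↦ eq_comm
  (π.quotKerEquivOfSurjective hπ).symm ≪≫ₗ Submodule.quotEquivOfEq _ _ hk ≪≫ₗ
    φ.quotKerEquivOfSurjective hφ

variable (Y : SpectralObject (ModuleCat.{u + 1} R) EInt)

/-- The map `H^n(⊥ ≤ j) ⟶ H^n(⊥ ≤ ⊤)`. -/
def toAbutment (n : ℤ) (j : EInt) :
    (Y.H n).obj (mk₁ (homOfLE (bot_le : ⊥ ≤ j))) ⟶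
      (Y.H n).obj (mk₁ (homOfLE (bot_le : (⊥ : EInt) ≤ ⊤))) :=
  (Y.H n).map (twoδ₂Toδ₁ (homOfLE bot_le) (homOfLE le_top) _ rfl)

lemma map_toAbutment (n : ℤ) {i j : EInt} (h : i ≤ j) :
    (Y.H n).map (twoδ₂Toδ₁ (homOfLE bot_le) (homOfLE h) (homOfLE bot_le) rfl) ≫
      toAbutment Y n j = toAbutment Y n i := by
  rw [toAbutment, toAbutment, ← Functor.map_comp]
  rfl

/-- The term `E` is the cokernel of `H^n(⊥ ≤ i) ⊞ H^{n-1}(j ≤ ⊤) ⟶ H^n(⊥ ≤ j)`. The second summand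
has the kernel of `toAbutment` as its image, so `φ x = 0` only says that `x` and some element coming
from `i` agree in the abutment. This is the hypothesis of `rangeQuotientEquiv`. -/
lemma exists_eInfty_desc (n : ℤ) (i j : EInt) (hij : i ≤ j) :
    ∃ φ : (Y.H n).obj (mk₁ (homOfLE (bot_le : ⊥ ≤ j))) →ₗ[R]
        Y.E (homOfLE (bot_le : ⊥ ≤ i)) (homOfLE hij) (homOfLE (le_top : j ≤ ⊤)) (n - 1) n (n + 1),
      Function.Surjective φ ∧ ∀ x, φ x = 0 ↔ ∃ y, (toAbutment Y n j).hom x =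
        (toAbutment Y n j).hom (((Y.H n).map (twoδ₂Toδ₁ (homOfLE bot_le) (homOfLE hij)
          (homOfLE bot_le) rfl)).hom y) := by
  let S := Y.cokernelSequenceE (homOfLE (bot_le : ⊥ ≤ i)) (homOfLE hij)
    (homOfLE (le_top : j ≤ ⊤)) (homOfLE bot_le) rfl (n - 1) n (n + 1)
  have ex : S.Exact := Y.cokernelSequenceE_exact (homOfLE (bot_le : ⊥ ≤ i)) (homOfLE hij)
    (homOfLE (le_top : j ≤ ⊤)) (homOfLE bot_le) rfl (n - 1) n (n + 1)
  have hepi : Epi S.g := inferInstanceAs (Epi (Y.cokernelSequenceE (homOfLE (bot_le : ⊥ ≤ i))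
    (homOfLE hij) (homOfLE (le_top : j ≤ ⊤)) (homOfLE bot_le) rfl (n - 1) n (n + 1)).g)
  have ex₁ := Y.exact₁ (homOfLE (bot_le : ⊥ ≤ j)) (homOfLE (le_top : j ≤ ⊤)) _ rfl (n - 1) n
  let a := (Y.H n).map (twoδ₂Toδ₁ (homOfLE (bot_le : ⊥ ≤ i)) (homOfLE hij) (homOfLE bot_le) rfl)
  let d := Y.δ (homOfLE (bot_le : ⊥ ≤ j)) (homOfLE (le_top : j ≤ ⊤)) (n - 1) n
  have z : biprod.desc a d ≫ S.g = 0 := S.zero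
  have z₁ : a ≫ S.g = 0 := (biprod.inl_desc_assoc a d S.g).symm.trans
    ((congrArg (biprod.inl ≫ ·) z).trans comp_zero)
  have z₂ : d ≫ S.g = 0 := (biprod.inr_desc_assoc a d S.g).symm.trans
    ((congrArg (biprod.inr ≫ ·) z).trans comp_zero)
  have z₃ : biprod.desc a d ≫ toAbutment Y n j = biprod.fst ≫ a ≫ toAbutment Y n j := by
    apply biprod.hom_ext'
    · rw [biprod.inl_desc_assoc, biprod.inl_fst_assoc]
    · rw [biprod.inr_desc_assoc, biprod.inr_fst_assoc, zero_comp]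
      exact Y.zero₁ _ _ _ _ _ _ _
  refine ⟨S.g.hom, (ModuleCat.epi_iff_surjective _).1 hepi, fun x ↦ ⟨fun hx ↦ ?_, ?_⟩⟩
  · obtain ⟨y, rfl⟩ := (ShortComplex.moduleCat_exact_iff _).1 ex x hx
    exact ⟨(biprod.fst : _ ⊞ (Y.H (n - 1)).obj (mk₁ (homOfLE (le_top : j ≤ ⊤))) ⟶ _).hom y,
      congr($(z₃).hom y)⟩
  · rintro ⟨y, hy⟩
    rw [← sub_eq_zero, ← map_sub] at hy
    obtain ⟨c, hc⟩ := (ShortComplex.moduleCat_exact_iff _).1 ex₁ _ hy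
    replace hc : d.hom c = x - a.hom y := hc
    rw [eq_sub_iff_add_eq'] at hc
    rw [← hc]
    refine (map_add S.g.hom _ _).trans ?_
    exact (congrArg₂ (· + ·) congr($(z₁).hom y) congr($(z₂).hom c)).trans (add_zero _)

variable [Y.IsFirstQuadrant]

/-- The term `E_∞^{p,q}` only involves the full truncations on both sides. -/
def eInftyIso (p q : ℕ) : eInfty Y.E₂SpectralSequenceNat p q ≅
    Y.E (homOfLE (bot_le : ⊥ ≤ ((q : ℤ) : EInt)))
      (homOfLE (show ((q : ℤ) : EInt) ≤ ((q + 1 : ℤ) : EInt) by simp))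
      (homOfLE (le_top : ((q + 1 : ℤ) : EInt) ≤ ⊤)) (p + q - 1) (p + q) (p + q + 1) :=
  -- On page `p + q + 2` the four indices are `q - (p + q)`, `q`, `q + 1` and `q + 1 + (p + q)`. The
  -- first is at most `0` and can be lowered to `⊥`; the last exceeds the total degree `p + q` and
  -- can be raised to `⊤`.
  Y.spectralSequencePageXIso SpectralObject.coreE₂CohomologicalNat (p + q + 2) (by lia) (p, q)
    ((-p : ℤ) : EInt) ((q : ℤ) : EInt) ((q + 1 : ℤ) : EInt) ((2 * q + p + 1 : ℤ) : EInt)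
    (by simp; lia) (by simp) (by simp) (by simp; lia) (p + q - 1) (p + q) (p + q + 1) (by simp) ≪≫
  (Y.isoMapFourδ₁Toδ₀' ⊥ ((-p : ℤ) : EInt) ((q : ℤ) : EInt) ((q + 1 : ℤ) : EInt)
    ((2 * q + p + 1 : ℤ) : EInt) bot_le (by simp) (by simp) (by simp; lia)
    (p + q - 1) (p + q) (p + q + 1) (Y.isZero₁_of_isFirstQuadrant _ _ _ (by simp) _)).symm ≪≫
  Y.isoMapFourδ₄Toδ₃' ⊥ ((q : ℤ) : EInt) ((q + 1 : ℤ) : EInt)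
    ((2 * q + p + 1 : ℤ) : EInt) ⊤ bot_le (by simp) (by simp; lia) le_top
    (p + q - 1) (p + q) (p + q + 1) (Y.isZero₂_of_isFirstQuadrant _ _ _ _ (by simp; lia))

/-- The spectral sequence of a first quadrant spectral object converges. -/
lemma nonempty_convergence :
    Nonempty (Convergence Y.E₂SpectralSequenceNat
      (fun n ↦ (Y.H n).obj (mk₁ (homOfLE (bot_le : (⊥ : EInt) ≤ ⊤))))) := by
  refine ⟨{
    -- The bound is `n - p + 1` because truncations are strict on the right: step `0` is everything
    -- since `H^n(n + 1 ≤ ⊤) = 0`, and step `n + 1` is zero since `H^n(⊥ ≤ 0) = 0`.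
    fil := fun n p ↦ LinearMap.range (toAbutment Y n ((n - p + 1 : ℤ) : EInt)).hom
    antitone := fun n ↦ antitone_nat_of_succ_le fun p ↦ ?_
    fil_zero := fun n ↦ ?_
    fil_succ := fun n ↦ ?_
    graded := fun p q ↦ ?_ }⟩
  · have h : ((n - (p + 1 : ℕ) + 1 : ℤ) : EInt) ≤ ((n - p + 1 : ℤ) : EInt) := by
      simp only [WithBotTop.coe_le_coe]
      lia
    rw [← map_toAbutment Y n h, ModuleCat.hom_comp]
    exact LinearMap.range_comp_le_range _ _
  · refine LinearMap.range_eq_top.2 ((ModuleCat.epi_iff_surjective _).1 ?_)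
    exact (Y.exact₂ _ _ _ rfl n).epi_f
      ((Y.isZero₂_of_isFirstQuadrant _ _ _ _ (by simp)).eq_of_tgt _ _)
  · refine LinearMap.range_eq_bot.2 ?_
    have h := Y.isZero₁_of_isFirstQuadrant ⊥ ((n - (n + 1 : ℕ) + 1 : ℤ) : EInt) bot_le (by simp) n
    exact congrArg ModuleCat.Hom.hom (h.eq_of_src (toAbutment Y n _) 0)
  -- In total degree `p + q` the bounds of two consecutive steps are `q + 1` and `q`, the inner
  -- indices of `E_∞^{p,q}`.
  · have hq : ((p + q : ℕ) - p + 1 : ℤ) = q + 1 := by push_cast; ring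
    have hq' : ((p + q : ℕ) - (p + 1 : ℕ) + 1 : ℤ) = q := by push_cast; ring
    have hn : (((p + q : ℕ) : ℤ)) = p + q := by push_cast; rfl
    rw [hq, hq', hn]
    have hle : ((q : ℤ) : EInt) ≤ ((q + 1 : ℤ) : EInt) := by simp
    choose φ hφ h using exists_eInfty_desc Y (p + q) _ _ hle
    rw [← map_toAbutment Y (p + q) hle, ModuleCat.hom_comp]
    exact rangeQuotientEquiv _ _ φ hφ h ≪≫ₗ (eInftyIso Y p q).symm.toLinearEquiv

lemma hasSpectralSequence_of_isFirstQuadrant :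
    HasSpectralSequence
      (fun r s ↦ (Y.H (r + s)).obj (mk₁ (homOfLE
        (show ((s : ℤ) : EInt) ≤ ((s + 1 : ℤ) : EInt) by simp))))
      (fun n ↦ (Y.H n).obj (mk₁ (homOfLE (bot_le : (⊥ : EInt) ≤ ⊤)))) :=
  ⟨Y.E₂SpectralSequenceNat, fun r s ↦
    ⟨Y.spectralSequenceFirstPageXIso SpectralObject.coreE₂CohomologicalNat (r, s) _ _
      (by simp) (by simp) _ (by simp)⟩, nonempty_convergence Y⟩

lemma HasSpectralSequence.of_iso {A A' : ℕ → ℕ → ModuleCat.{u + 1} R}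
    {H H' : ℕ → ModuleCat.{u + 1} R} (h : HasSpectralSequence A H)
    (eA : ∀ r s, Nonempty (A r s ≅ A' r s)) (eH : ∀ n, Nonempty (H n ≅ H' n)) :
    HasSpectralSequence A' H' := by
  obtain ⟨E, h₂, ⟨c⟩⟩ := h
  let e n := (eH n).some.toLinearEquiv
  refine ⟨E, fun r s ↦ ⟨(h₂ r s).some ≪≫ (eA r s).some⟩, ⟨{
    fil := fun n p ↦ (c.fil n p).map (e n).toLinearMap
    antitone := fun n p q h ↦ Submodule.map_mono (c.antitone n h)
    fil_zero := fun n ↦ by rw [c.fil_zero, Submodule.map_top, LinearEquiv.range]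
    fil_succ := fun n ↦ by rw [c.fil_succ, Submodule.map_bot]
    graded := fun p q ↦ ?_ }⟩⟩
  refine (Submodule.Quotient.equiv _ _ ((e (p + q)).submoduleMap (c.fil (p + q) p)) ?_).symm ≪≫ₗ
    c.graded p q
  ext ⟨x, hx⟩
  simp only [Submodule.mem_map, Submodule.submoduleOf, Submodule.mem_comap]
  constructor
  · rintro ⟨y, hy, h⟩
    exact ⟨y, hy, congrArg Subtype.val h⟩
  · rintro ⟨y, hy, rfl⟩
    exact ⟨⟨y, c.antitone _ (Nat.le_succ p) hy⟩, hy, rfl⟩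

end SpectralSequences

/-! ### Morphisms from a fixed object into a spectral object of a triangulated category. -/

section HomSpectralObject

open ComposableArrows Pretriangulated

variable {R : Type (u + 1)} [CommRing R]

section

universe v w

variable {D : Type w} [Category.{v} D] [Preadditive D] [Linear R D]

/-- The morphism of modules between small models of Hom-modules given by a postcomposition. -/
def shrinkPostcomp (A : D) {X Y : D} [Small.{u + 1} (A ⟶ X)] [Small.{u + 1} (A ⟶ Y)] (f : X ⟶ Y) :
    ModuleCat.of R (Shrink.{u + 1} (A ⟶ X)) ⟶ ModuleCat.of R (Shrink.{u + 1} (A ⟶ Y)) :=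
  ModuleCat.ofHom ((Shrink.linearEquiv R (A ⟶ Y)).symm.toLinearMap ∘ₗ
    Linear.rightComp R A f ∘ₗ (Shrink.linearEquiv R (A ⟶ X)).toLinearMap)

lemma shrinkPostcomp_apply (A : D) {X Y : D} [Small.{u + 1} (A ⟶ X)] [Small.{u + 1} (A ⟶ Y)]
    (f : X ⟶ Y) (x : Shrink.{u + 1} (A ⟶ X)) :
    (shrinkPostcomp (R := R) A f).hom x =
      (equivShrink _) ((equivShrink (A ⟶ X)).symm x ≫ f) := rfl

lemma shrinkPostcomp_id (A X : D) [Small.{u + 1} (A ⟶ X)] :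
    shrinkPostcomp (R := R) A (𝟙 X) = 𝟙 _ := by
  refine ModuleCat.hom_ext (LinearMap.ext fun x ↦ ?_)
  rw [shrinkPostcomp_apply, Category.comp_id, Equiv.apply_symm_apply]
  rfl

lemma shrinkPostcomp_comp (A : D) {X Y Z : D} [Small.{u + 1} (A ⟶ X)] [Small.{u + 1} (A ⟶ Y)]
    [Small.{u + 1} (A ⟶ Z)] (f : X ⟶ Y) (g : Y ⟶ Z) :
    shrinkPostcomp (R := R) A (f ≫ g) = shrinkPostcomp A f ≫ shrinkPostcomp A g := by
  refine ModuleCat.hom_ext (LinearMap.ext fun x ↦ ?_)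
  rw [ModuleCat.hom_comp, LinearMap.comp_apply, shrinkPostcomp_apply, shrinkPostcomp_apply,
    shrinkPostcomp_apply, ← Category.assoc]
  exact congrArg (fun y : A ⟶ Y ↦ equivShrink (A ⟶ Z) (y ≫ g)) (Equiv.symm_apply_apply _ _).symm

lemma shrinkPostcomp_exact (A : D) {X Y Z : D} [Small.{u + 1} (A ⟶ X)] [Small.{u + 1} (A ⟶ Y)]
    [Small.{u + 1} (A ⟶ Z)] (f : X ⟶ Y) (g : Y ⟶ Z) (hfg : f ≫ g = 0)
    (h : ∀ y : A ⟶ Y, y ≫ g = 0 → ∃ x : A ⟶ X, x ≫ f = y) :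
    (mk₂ (shrinkPostcomp (R := R) A f) (shrinkPostcomp A g)).Exact := by
  have z : shrinkPostcomp (R := R) A f ≫ shrinkPostcomp A g = 0 := by
    rw [← shrinkPostcomp_comp, hfg]
    refine ModuleCat.hom_ext (LinearMap.ext fun x ↦ ?_)
    refine (congrArg (equivShrink (A ⟶ Z))
      (comp_zero (f := (equivShrink (A ⟶ X)).symm x))).trans ?_
    exact map_zero (Shrink.linearEquiv R (A ⟶ Z)).symm
  refine ShortComplex.Exact.exact_toComposableArrows (S := ShortComplex.mk _ _ z)
    ((ShortComplex.moduleCat_exact_iff _).2 fun y hy ↦ ?_)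
  replace hy : (shrinkPostcomp (R := R) A g).hom y = 0 := hy
  rw [shrinkPostcomp_apply] at hy
  have hy' : (equivShrink (A ⟶ Y)).symm y ≫ g = 0 := by
    apply (Shrink.linearEquiv R (A ⟶ Z)).symm.injective
    exact hy.trans (map_zero _).symm
  obtain ⟨x, hx⟩ := h _ hy'
  refine ⟨equivShrink _ x, ?_⟩
  change (shrinkPostcomp (R := R) A f).hom _ = _
  rw [shrinkPostcomp_apply, Equiv.symm_apply_apply, hx, Equiv.apply_symm_apply]

variable [HasZeroObject D] [HasShift D ℤ] [∀ (n : ℤ), (shiftFunctor D n).Additive]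
  [Pretriangulated D] {ι : Type*} [Category* ι] (A : D) (Z : Triangulated.SpectralObject D ι)
  [∀ (X : ComposableArrows ι 1) (n : ℤ), Small.{u + 1} (A ⟶ (Z.ω₁.obj X)⟦n⟧)]

/-- The connecting homomorphism, shifted. -/
def shiftedδ (X : ComposableArrows ι 2) (n₀ n₁ : ℤ) (h : n₀ + 1 = n₁) :
    (Z.ω₁.obj ((functorArrows ι 1 2 2).obj X))⟦n₀⟧ ⟶
      (Z.ω₁.obj ((functorArrows ι 0 1 2).obj X))⟦n₁⟧ :=
  (Z.δ'.app X)⟦n₀⟧' ≫ (shiftFunctorAdd' D 1 n₀ n₁ (by lia)).inv.app _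

lemma shiftedδ_naturality {X Y : ComposableArrows ι 2} (φ : X ⟶ Y) (n₀ n₁ : ℤ)
    (h : n₀ + 1 = n₁) :
    (Z.ω₁.map ((functorArrows ι 1 2 2).map φ))⟦n₀⟧' ≫ shiftedδ Z Y n₀ n₁ h =
      shiftedδ Z X n₀ n₁ h ≫ (Z.ω₁.map ((functorArrows ι 0 1 2).map φ))⟦n₁⟧' := by
  have h₁ := Z.δ'.naturality φ
  have h₂ := (shiftFunctorAdd' D 1 n₀ n₁ (by lia)).inv.naturality
    (Z.ω₁.map ((functorArrows ι 0 1 2).map φ))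
  dsimp only [Functor.comp_map, Functor.comp_obj] at h₁ h₂
  rw [shiftedδ, shiftedδ, ← Functor.map_comp_assoc, h₁, Functor.map_comp_assoc, Category.assoc, h₂]

/-- The spectral object which consists of small models of the modules of morphisms from a fixed
object to the shifts of the terms of a spectral object of a triangulated category. -/
def homSpectralObject : Abelian.SpectralObject (ModuleCat.{u + 1} R) ι where
  H n :=
    { obj X := ModuleCat.of R (Shrink.{u + 1} (A ⟶ (Z.ω₁.obj X)⟦n⟧))
      map φ := shrinkPostcomp A ((Z.ω₁.map φ)⟦n⟧')
      map_id X := by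
        rw [CategoryTheory.Functor.map_id, CategoryTheory.Functor.map_id, shrinkPostcomp_id]
      map_comp φ ψ := by rw [Functor.map_comp, Functor.map_comp, shrinkPostcomp_comp] }
  δ' n₀ n₁ h :=
    { app X := shrinkPostcomp A (shiftedδ Z X n₀ n₁ h)
      naturality X Y φ := by
        refine (shrinkPostcomp_comp A _ _).symm.trans (Eq.trans ?_ (shrinkPostcomp_comp A _ _))
        exact congrArg _ (shiftedδ_naturality Z φ n₀ n₁ h) }
  exact₁' n₀ n₁ h X := by
    -- Two composable arrows of the index category give a distinguished triangle. The three
    -- exactness statements are the three positions in its long exact sequence for the homological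
    -- functor `Hom(A, ·)`.
    let T := Z.ω₂.obj X
    have hT : T ∈ distTriang D := Z.ω₂_obj_distinguished X
    refine shrinkPostcomp_exact A _ _ ?_ fun y hy ↦ ?_
    · exact (Category.assoc _ _ _).trans <| by
        refine (congrArg _
          ((shiftFunctorAdd' D 1 n₀ n₁ (by lia)).inv.naturality T.mor₁).symm).trans ?_
        refine (Category.assoc _ _ _).symm.trans ?_
        have z : T.mor₃⟦n₀⟧' ≫ (T.mor₁⟦(1 : ℤ)⟧')⟦n₀⟧' = 0 := by
          rw [← Functor.map_comp, comp_distTriang_mor_zero₃₁ _ hT, Functor.map_zero]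
        exact (congrArg (· ≫ _) z).trans zero_comp
    · have := (ShortComplex.ab_exact_iff _).1
        ((preadditiveCoyoneda.obj (op A)).homologySequence_exact₁ T hT n₀ n₁ h) y hy
      obtain ⟨x, hx⟩ := this
      exact ⟨x, (preadditiveCoyoneda_homologySequenceδ_apply T n₀ n₁ h x).symm.trans hx⟩
  exact₂' n X := by
    let T := Z.ω₂.obj X
    have hT : T ∈ distTriang D := Z.ω₂_obj_distinguished X
    refine shrinkPostcomp_exact A _ _ ?_ fun y hy ↦ ?_
    · have z : T.mor₁⟦n⟧' ≫ T.mor₂⟦n⟧' = 0 := by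
        rw [← Functor.map_comp, comp_distTriang_mor_zero₁₂ _ hT, Functor.map_zero]
      exact z
    · exact (ShortComplex.ab_exact_iff _).1
        ((preadditiveCoyoneda.obj (op A)).homologySequence_exact₂ T hT n) y hy
  exact₃' n₀ n₁ h X := by
    let T := Z.ω₂.obj X
    have hT : T ∈ distTriang D := Z.ω₂_obj_distinguished X
    refine shrinkPostcomp_exact A _ _ ?_ fun y hy ↦ ?_
    · refine (Category.assoc _ _ _).symm.trans ?_
      have z : T.mor₂⟦n₀⟧' ≫ T.mor₃⟦n₀⟧' = 0 := by
        rw [← Functor.map_comp, comp_distTriang_mor_zero₂₃ _ hT, Functor.map_zero]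
      exact (congrArg (· ≫ _) z).trans zero_comp
    · exact (ShortComplex.ab_exact_iff _).1
        ((preadditiveCoyoneda.obj (op A)).homologySequence_exact₃ T hT n₀ n₁ h) y
        ((preadditiveCoyoneda_homologySequenceδ_apply T n₀ n₁ h y).trans hy)

end

end HomSpectralObject

/-! ### The derived functors of `Hom(A, ·)` as Ext modules. -/

section ExtComparison

open HomologicalComplex Abelian

variable {R : Type (u + 1)} [CommRing R]

section Homology

variable (S : ShortComplex (ModuleCat.{u + 1} R)) {E : Type*} [AddCommGroup E] [Module R E]
  (φ : LinearMap.ker S.g.hom →ₗ[R] E) (hφ : Function.Surjective φ)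
  (h : ∀ z, φ z = 0 ↔ ∃ y, S.f.hom y = z.1)

/-- The homology of a short complex of modules is identified with the target of a surjective map
on the cycles whose kernel is the module of boundaries. -/
def homologyEquivOfSurjective : S.homology ≃ₗ[R] E :=
  S.moduleCatHomologyIso.toLinearEquiv ≪≫ₗ
    (Submodule.quotEquivOfEq _ _ (by
      ext z
      rw [LinearMap.mem_ker, h]
      exact exists_congr fun y ↦ Subtype.ext_iff) :
      (LinearMap.ker S.g.hom ⧸ LinearMap.range S.moduleCatToCycles) ≃ₗ[R] _) ≪≫ₗ
    φ.quotKerEquivOfSurjective hφ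

lemma homologyEquivOfSurjective_apply (c : S.cycles) (z : LinearMap.ker S.g.hom)
    (hz : S.iCycles.hom c = z.1) :
    homologyEquivOfSurjective S φ hφ h (S.homologyπ.hom c) = φ z := by
  have h₁ : S.moduleCatHomologyIso.hom.hom (S.homologyπ.hom c) =
      S.moduleCatLeftHomologyData.π.hom (S.moduleCatCyclesIso.hom.hom c) :=
    congr($(S.π_moduleCatCyclesIso_hom).hom c)
  have h₂ : S.moduleCatCyclesIso.hom.hom c = z :=
    Subtype.ext ((congr($(S.moduleCatCyclesIso_hom_i).hom c)).trans hz)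
  rw [h₂] at h₁
  have hk : LinearMap.range S.moduleCatToCycles = LinearMap.ker φ := by
    ext z
    rw [LinearMap.mem_ker, h]
    exact exists_congr fun y ↦ Subtype.ext_iff
  exact congrArg (⇑(φ.quotKerEquivOfSurjective hφ) ∘ Submodule.quotEquivOfEq _ _ hk) h₁

lemma exists_homologyπ (x : S.homology) : ∃ c, S.homologyπ.hom c = x :=
  (ModuleCat.epi_iff_surjective S.homologyπ).1 inferInstance x

/-- A cycle, considered as an element of the kernel. -/
def cycleElement (c : S.cycles) : LinearMap.ker S.g.hom :=
  ⟨S.iCycles.hom c, congr($(S.iCycles_g).hom c)⟩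

end Homology

universe v

variable {B : Type v} [Category.{u + 1} B] [Abelian B] [Linear R B]

/-- The complex of morphisms from an object to a complex. -/
abbrev homComplex (R : Type (u + 1)) [CommRing R] [Linear R B] (A : B) (C : CochainComplex B ℕ) :
    CochainComplex (ModuleCat.{u + 1} R) ℕ :=
  (((linearCoyoneda R B).obj (op A)).mapHomologicalComplex _).obj C

lemma homComplex_cycle (A : B) (C : CochainComplex B ℕ) (n : ℕ)
    (z : LinearMap.ker ((homComplex R A C).sc n).g.hom) :
    (z.1 : A ⟶ C.X n) ≫ C.d n (n + 1) = 0 := by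
  have h : (z.1 : A ⟶ C.X n) ≫ C.d n ((ComplexShape.up ℕ).next n) = 0 := z.2
  rwa [CochainComplex.next] at h

/-- The extension by zero of a complex to negative degrees, in nonnegative degrees. -/
def extendNatXIso (C : CochainComplex B ℕ) (n : ℕ) :
    (C.extend ComplexShape.embeddingUpNat).X (n : ℤ) ≅ C.X n :=
  C.extendXIso ComplexShape.embeddingUpNat rfl

lemma extendNat_d (C : CochainComplex B ℕ) (n m : ℕ) :
    (C.extend ComplexShape.embeddingUpNat).d (n : ℤ) (m : ℤ) =
      (extendNatXIso C n).hom ≫ C.d n m ≫ (extendNatXIso C m).inv :=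
  C.extend_d_eq ComplexShape.embeddingUpNat rfl rfl

/-- Ext classes and morphisms of the derived category involve complexes indexed by the integers,
while derived functors use complexes indexed by the natural numbers. This is the comparison of the
two notions of boundary. -/
lemma exists_comp_d_extend_iff {A : B} {C : CochainComplex B ℕ} {n : ℕ} (f : A ⟶ C.X n) (m : ℤ)
    (hm : m + 1 = n) :
    (∃ g : A ⟶ (C.extend ComplexShape.embeddingUpNat).X m,
      g ≫ (C.extend ComplexShape.embeddingUpNat).d m n = f ≫ (extendNatXIso C n).inv) ↔
    ∃ y, ((homComplex R A C).sc n).f.hom y = f := by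
  change _ ↔ ∃ y : A ⟶ C.X ((ComplexShape.up ℕ).prev n), y ≫ C.d _ n = f
  -- In degree `0` the index `prev 0` takes its default value and the differential from it vanishes;
  -- on the other side the extended complex is zero in degree `-1`. So both conditions say `f = 0`.
  obtain _ | p := n
  · have h₁ : C.d ((ComplexShape.up ℕ).prev 0) 0 = 0 := C.shape _ _ (by simp)
    have h₂ : IsZero ((C.extend ComplexShape.embeddingUpNat).X m) :=
      C.isZero_extend_X _ _ (by intro i; simp; lia)
    rw [h₁]
    constructor
    · rintro ⟨g, hg⟩
      refine ⟨0, ?_⟩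
      rw [h₂.eq_of_tgt g 0, zero_comp] at hg
      rw [zero_comp, ← cancel_mono (extendNatXIso C 0).inv, zero_comp]
      exact hg
    · rintro ⟨y, hy⟩
      refine ⟨0, ?_⟩
      rw [← hy, comp_zero, zero_comp]
      exact zero_comp.symm
  · obtain rfl : m = p := by push_cast at hm; lia
    rw [extendNat_d, CochainComplex.prev_nat_succ]
    constructor
    · rintro ⟨g, hg⟩
      refine ⟨g ≫ (extendNatXIso C p).hom, ?_⟩
      rw [← cancel_mono (extendNatXIso C (p + 1)).inv, ← hg]
      simp only [Category.assoc]
    · rintro ⟨y, rfl⟩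
      refine ⟨y ≫ (extendNatXIso C p).inv, ?_⟩
      simp only [Category.assoc, Iso.inv_hom_id_assoc]

section Ext

variable [HasExt.{u + 1} B]

/-- The class in the Ext-group of a cocycle with values in an injective resolution. -/
def extOfCycle (A : B) {F : B} (I : InjectiveResolution F) (n : ℕ) :
    LinearMap.ker ((homComplex R A I.cocomplex).sc n).g.hom →ₗ[R] Ext A F n where
  toFun z := I.extMk z.1 (n + 1) rfl (homComplex_cycle A _ n z)
  map_add' z w := (I.add_extMk _ _ _ _ _ _).symm
  map_smul' r z := by
    -- The scalar is absorbed into the endomorphism `r • 𝟙 A`, since `extMk` is compatible with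
    -- precomposition.
    have h : ∀ f : A ⟶ I.cocomplex.X n, r • f = (r • 𝟙 A) ≫ f := fun f ↦ by
      rw [Linear.smul_comp, Category.id_comp]
    let f : A ⟶ I.cocomplex.X n := z.1
    have hf : f ≫ I.cocomplex.d n (n + 1) = 0 := homComplex_cycle A _ n z
    have hf' : (r • f) ≫ I.cocomplex.d n (n + 1) = 0 := by
      rw [Linear.smul_comp, hf, smul_zero]
    change I.extMk (r • f) (n + 1) rfl hf' = r • I.extMk f (n + 1) rfl hf
    have h₁ : I.extMk (r • f) (n + 1) rfl hf' = I.extMk ((r • 𝟙 A) ≫ f) (n + 1) rfl (by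
        rw [← h, hf']) := by
      congr 1
      exact h _
    rw [h₁, ← I.mk₀_comp_extMk, Ext.mk₀_smul, Ext.smul_comp, Ext.mk₀_id_comp]

lemma extOfCycle_surjective (A : B) {F : B} (I : InjectiveResolution F) (n : ℕ) :
    Function.Surjective (extOfCycle (R := R) A I n) := fun x ↦ by
  obtain ⟨f, hf, rfl⟩ := I.extMk_surjective x (n + 1) rfl
  refine ⟨⟨f, ?_⟩, rfl⟩
  change f ≫ I.cocomplex.d n ((ComplexShape.up ℕ).next n) = 0
  rwa [CochainComplex.next]

lemma extOfCycle_eq_zero_iff (A : B) {F : B} (I : InjectiveResolution F) (n : ℕ)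
    (z : LinearMap.ker ((homComplex R A I.cocomplex).sc n).g.hom) :
    extOfCycle A I n z = 0 ↔ ∃ y, ((homComplex R A I.cocomplex).sc n).f.hom y = z.1 := by
  let f : A ⟶ I.cocomplex.X n := z.1
  have hf : f ≫ I.cocomplex.d n (n + 1) = 0 := homComplex_cycle A _ n z
  refine Iff.trans ?_ (exists_comp_d_extend_iff (R := R) (C := I.cocomplex) f (n - 1) (by simp))
  change I.extMk f (n + 1) rfl hf = 0 ↔ _
  rw [← I.extEquivCohomologyClass.apply_eq_iff_eq, I.extEquivCohomologyClass_zero,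
    I.extEquivCohomologyClass_extMk, CochainComplex.HomComplex.CohomologyClass.mk_eq_zero_iff]
  exact CochainComplex.HomComplex.Cocycle.fromSingleMk_mem_coboundaries_iff _ _ _ _ _ (n - 1)
    (by lia)

variable [EnoughInjectives B]

/-- The derived functors of `Hom(A, ·)` are the Ext-modules. -/
def rightDerivedCoyonedaEquiv (A F : B) (n : ℕ) :
    (((linearCoyoneda R B).obj (op A)).rightDerived n).obj F ≃ₗ[R] Ext A F n :=
  ((injectiveResolution F).isoRightDerivedObj ((linearCoyoneda R B).obj (op A)) n).toLinearEquiv ≪≫ₗ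
    homologyEquivOfSurjective ((homComplex R A (injectiveResolution F).cocomplex).sc n)
      (extOfCycle A (injectiveResolution F) n) (extOfCycle_surjective _ _ _)
      (extOfCycle_eq_zero_iff _ _ _)

/-- The map of derived functors is induced by a lift of `f` to injective resolutions. Composing a
cocycle with this lift represents the product of its Ext class with `f`, so it suffices to follow
one representing cycle through both sides. -/
lemma rightDerivedCoyonedaEquiv_naturality (A : B) {F F' : B} (f : F ⟶ F') (n : ℕ)
    (x : (((linearCoyoneda R B).obj (op A)).rightDerived n).obj F) :
    rightDerivedCoyonedaEquiv A F' n
        (((((linearCoyoneda R B).obj (op A)).rightDerived n).map f).hom x) =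
      (rightDerivedCoyonedaEquiv A F n x).comp (Ext.mk₀ f) (add_zero n) := by
  let I := injectiveResolution F
  let I' := injectiveResolution F'
  let T := (linearCoyoneda R B).obj (op A)
  let φ : InjectiveResolution.Hom I I' f :=
    { hom := InjectiveResolution.desc f I' I
      ι_f_zero_comp_hom_f_zero :=
        HomologicalComplex.congr_hom (InjectiveResolution.desc_commutes f I' I) 0 }
  have nat := congr($(InjectiveResolution.isoRightDerivedObj_hom_naturality f I I' φ.hom
    (by
      have := φ.ι_f_zero_comp_hom_f_zero
      rwa [CochainComplex.single₀_map_f_zero] at this) T n).hom x)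
  let S := (homComplex R A I.cocomplex).sc n
  let S' := (homComplex R A I'.cocomplex).sc n
  let τ : S ⟶ S' := (shortComplexFunctor _ _ n).map ((T.mapHomologicalComplex _).map φ.hom)
  obtain ⟨c, hc⟩ := exists_homologyπ S ((I.isoRightDerivedObj T n).hom.hom x)
  have e₁ : rightDerivedCoyonedaEquiv A F n x = extOfCycle A I n (cycleElement S c) :=
    (congrArg (homologyEquivOfSurjective S (extOfCycle A I n) (extOfCycle_surjective _ _ _)
      (extOfCycle_eq_zero_iff _ _ _)) hc.symm).trans
      (homologyEquivOfSurjective_apply S _ _ _ c (cycleElement S c) rfl)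
  have h₂ : (I'.isoRightDerivedObj T n).hom.hom (((T.rightDerived n).map f).hom x) =
      S'.homologyπ.hom ((ShortComplex.cyclesMap τ).hom c) := by
    refine nat.trans ?_
    refine (congrArg (ShortComplex.homologyMap τ).hom hc.symm).trans ?_
    exact congr($(ShortComplex.homologyπ_naturality τ).hom c)
  have e₂ : rightDerivedCoyonedaEquiv A F' n (((T.rightDerived n).map f).hom x) =
      extOfCycle A I' n (cycleElement S' ((ShortComplex.cyclesMap τ).hom c)) :=
    (congrArg (homologyEquivOfSurjective S' (extOfCycle A I' n) (extOfCycle_surjective _ _ _)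
      (extOfCycle_eq_zero_iff _ _ _)) h₂).trans
      (homologyEquivOfSurjective_apply S' _ _ _ _ _ rfl)
  rw [e₁]
  refine e₂.trans ?_
  let f₁ : A ⟶ I.cocomplex.X n := (cycleElement S c).1
  let f₂ : A ⟶ I'.cocomplex.X n := (cycleElement S' ((ShortComplex.cyclesMap τ).hom c)).1
  have hf₁ : f₁ ≫ I.cocomplex.d n (n + 1) = 0 := homComplex_cycle A _ n (cycleElement S c)
  have hf₂ : f₂ ≫ I'.cocomplex.d n (n + 1) = 0 := homComplex_cycle A _ n (cycleElement S' _)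
  have h₃ : f₂ = f₁ ≫ φ.hom.f n := congr($(ShortComplex.cyclesMap_i τ).hom c)
  change I'.extMk f₂ (n + 1) rfl hf₂ = (I.extMk f₁ (n + 1) rfl hf₁).comp _ _
  rw [InjectiveResolution.extMk_comp_mk₀ _ _ _ _ φ]
  congr 1

end Ext

end ExtComparison

/-! ### Truncations and morphisms in the derived category. -/

section DerivedHom

open HomologicalComplex Abelian Pretriangulated

universe v w

variable {R : Type (u + 1)} [CommRing R] {B : Type v} [Category.{u + 1} B] [Abelian B]
  [HasDerivedCategory.{w} B]

/-- A bounded below object is isomorphic to a bounded below complex of injectives. That complex is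
K-injective, so every morphism into it comes from the homotopy category, whose Hom sets lie in the
right universe. Only the target has to be bounded. -/
lemma small_hom_of_isGE [EnoughInjectives B] (M K : DerivedCategory B) (n : ℤ) [K.IsGE n] :
    Small.{u + 1} (M ⟶ K) := by
  obtain ⟨M', ⟨eM⟩⟩ : ∃ M', Nonempty (DerivedCategory.Qh.obj M' ≅ M) :=
    ⟨_, ⟨DerivedCategory.Qh.objObjPreimageIso M⟩⟩
  let K' : DerivedCategory.Plus B := ⟨K, n, inferInstance⟩
  have : K'.IsGE n := (DerivedCategory.Plus.isGE_ι_obj_iff K' n).1 ‹K.IsGE n›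
  obtain ⟨L, _, ⟨e⟩⟩ := DerivedCategory.Plus.exists_injective_nonempty_iso K' n
  let L' := ((InjectiveObject.ι B).mapCochainComplexPlus.obj L).obj
  have : CochainComplex.IsKInjective L' := by
    have (i : ℤ) : Injective (L'.X i) := (L.obj.X i).property
    have : L'.IsStrictlyGE n :=
      (CochainComplex.isStrictlyGE_mapHomologicalComplex_obj_iff L.obj (InjectiveObject.ι B) n).2
        inferInstance
    exact CochainComplex.isKInjective_of_injective L' n
  let e' : DerivedCategory.Qh.obj ((HomotopyCategory.quotient B (.up ℤ)).obj L') ≅ K :=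
    DerivedCategory.Plus.ι.mapIso e
  have : Small.{u + 1} (M' ⟶ (HomotopyCategory.quotient B (.up ℤ)).obj L') :=
    small_self.{u + 1} (M' ⟶ (HomotopyCategory.quotient B (.up ℤ)).obj L')
  refine small_of_surjective (α := M' ⟶ (HomotopyCategory.quotient B (.up ℤ)).obj L')
    (f := fun f ↦ eM.inv ≫ DerivedCategory.Qh.map f ≫ e'.hom) fun g ↦ ?_
  obtain ⟨f, hf⟩ := (CochainComplex.IsKInjective.Qh_map_bijective M' L').surjective
    (eM.hom ≫ g ≫ e'.inv)
  exact ⟨f, by simp [hf]⟩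

/-- The truncation to degrees below `n` has no homology in degrees `n` and `n + 1`, so the long
exact sequence of the truncation triangle leaves an isomorphism in degree `n`. -/
lemma isIso_homologyFunctor_map_truncGEπ (X : DerivedCategory B) (n : ℤ) :
    IsIso ((DerivedCategory.homologyFunctor B n).map
      ((DerivedCategory.TStructure.t.eTruncGEπ (n : EInt)).app X)) := by
  let t := DerivedCategory.TStructure.t (C := B)
  let T := (t.eTriangleLTGE.obj (n : EInt)).obj X
  have hT : T ∈ distTriang _ := t.eTriangleLTGE_distinguished _ X
  have hle : t.IsLE T.obj₁ (n - 1) := t.isLE_eTruncLT_obj_obj (n - 1) n (by simp) X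
  have h₀ : IsZero ((DerivedCategory.homologyFunctor B n).obj T.obj₁) :=
    DerivedCategory.isZero_of_isLE _ (n - 1) n (by lia)
  have h₁ : IsZero ((DerivedCategory.homologyFunctor B (n + 1)).obj T.obj₁) :=
    DerivedCategory.isZero_of_isLE _ (n - 1) (n + 1) (by lia)
  have hm : Mono ((DerivedCategory.homologyFunctor B n).map T.mor₂) :=
    (DerivedCategory.HomologySequence.mono_homologyMap_mor₂_iff T hT n).2 (h₀.eq_of_src _ _)
  have he : Epi ((DerivedCategory.homologyFunctor B n).map T.mor₂) :=
    (DerivedCategory.HomologySequence.epi_homologyMap_mor₂_iff T hT n (n + 1)).2 (h₁.eq_of_tgt _ _)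
  exact isIso_of_mono_of_epi ((DerivedCategory.homologyFunctor B n).map T.mor₂)

/-- Dually, the truncation to degrees at least `n + 1` has no homology in degrees `n - 1` and `n`.
-/
lemma isIso_homologyFunctor_map_truncLTι (X : DerivedCategory B) (n : ℤ) :
    IsIso ((DerivedCategory.homologyFunctor B n).map
      ((DerivedCategory.TStructure.t.eTruncLTι ((n + 1 : ℤ) : EInt)).app X)) := by
  let t := DerivedCategory.TStructure.t (C := B)
  let T := (t.eTriangleLTGE.obj ((n + 1 : ℤ) : EInt)).obj X
  have hT : T ∈ distTriang _ := t.eTriangleLTGE_distinguished _ X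
  have hle : t.IsGE T.obj₃ (n + 1) := t.isGE_eTruncGE_obj_obj (n + 1) _ le_rfl X
  have h₀ : IsZero ((DerivedCategory.homologyFunctor B n).obj T.obj₃) :=
    DerivedCategory.isZero_of_isGE _ (n + 1) n (by lia)
  have h₁ : IsZero ((DerivedCategory.homologyFunctor B (n - 1)).obj T.obj₃) :=
    DerivedCategory.isZero_of_isGE _ (n + 1) (n - 1) (by lia)
  have he : Epi ((DerivedCategory.homologyFunctor B n).map T.mor₁) :=
    (DerivedCategory.HomologySequence.epi_homologyMap_mor₁_iff T hT n).2 (h₀.eq_of_tgt _ _)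
  have hm : Mono ((DerivedCategory.homologyFunctor B n).map T.mor₁) :=
    (DerivedCategory.HomologySequence.mono_homologyMap_mor₁_iff T hT (n - 1) n).2
      (h₁.eq_of_src _ _)
  exact isIso_of_mono_of_epi ((DerivedCategory.homologyFunctor B n).map T.mor₁)

/-- The double truncation is concentrated in degree `s`, hence comes from an object of the heart
placed there. Taking homology in degree `s`, which neither truncation changes, identifies that
object. -/
lemma nonempty_iso_singleFunctor (X : DerivedCategory B) (s : ℤ) :
    Nonempty (((DerivedCategory.TStructure.t.eTruncGE.obj (s : EInt)).obj
      ((DerivedCategory.TStructure.t.eTruncLT.obj ((s + 1 : ℤ) : EInt)).obj X)) ≅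
        (DerivedCategory.singleFunctor B s).obj ((DerivedCategory.homologyFunctor B s).obj X)) := by
  let t := DerivedCategory.TStructure.t (C := B)
  let Z := (t.eTruncLT.obj ((s + 1 : ℤ) : EInt)).obj X
  let Z' := (t.eTruncGE.obj (s : EInt)).obj Z
  have : t.IsGE Z' s := t.isGE_eTruncGE_obj_obj s _ le_rfl Z
  have : t.IsLE Z s := t.isLE_eTruncLT_obj_obj s _ le_rfl X
  have : t.IsLE Z' s := inferInstanceAs (t.IsLE ((t.eTruncGE.obj (s : EInt)).obj Z) s)
  obtain ⟨Y, ⟨e⟩⟩ := DerivedCategory.exists_iso_singleFunctor_obj_of_isGE_of_isLE Z' s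
  have := isIso_homologyFunctor_map_truncGEπ Z s
  have := isIso_homologyFunctor_map_truncLTι X s
  refine ⟨e ≪≫ (DerivedCategory.singleFunctor B s).mapIso ?_⟩
  exact ((DerivedCategory.singleFunctorCompHomologyFunctorIso B s).app Y).symm ≪≫
    (DerivedCategory.homologyFunctor B s).mapIso e.symm ≪≫
    (asIso ((DerivedCategory.homologyFunctor B s).map ((t.eTruncGEπ (s : EInt)).app Z))).symm ≪≫
    asIso ((DerivedCategory.homologyFunctor B s).map ((t.eTruncLTι ((s + 1 : ℤ) : EInt)).app X))

lemma nonempty_iso_singleFunctor_shift (X : DerivedCategory B) (r s : ℤ) :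
    Nonempty (((DerivedCategory.TStructure.t.eTruncGE.obj (s : EInt)).obj
      ((DerivedCategory.TStructure.t.eTruncLT.obj ((s + 1 : ℤ) : EInt)).obj X))⟦r + s⟧ ≅
        ((DerivedCategory.singleFunctor B 0).obj
          ((DerivedCategory.homologyFunctor B s).obj X))⟦r⟧) := by
  obtain ⟨e⟩ := nonempty_iso_singleFunctor X s
  exact ⟨(shiftFunctor _ (r + s)).mapIso e ≪≫
    (shiftFunctorAdd' (DerivedCategory B) s r (r + s) (by lia)).app _ ≪≫
    (shiftFunctor _ r).mapIso (((DerivedCategory.singleFunctors B).shiftIso s 0 s (by lia)).app _)⟩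

section Cocycles

variable [Linear R B] (A : B) (C : CochainComplex B ℕ)

/-- The extension by zero of a complex to negative degrees. -/
abbrev extendNat : CochainComplex B ℤ := C.extend ComplexShape.embeddingUpNat

open CochainComplex.HomComplex

/-- The cocycle of the complex of morphisms defined by a cycle. -/
def cocycleOfHom {n : ℕ} (f : A ⟶ C.X n) (hf : f ≫ C.d n (n + 1) = 0) :
    Cocycle ((CochainComplex.singleFunctor B 0).obj A) (extendNat C) n :=
  Cocycle.fromSingleMk (f ≫ (extendNatXIso C n).inv) (zero_add _) ((n + 1 : ℕ) : ℤ) (by simp) (by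
    rw [extendNat_d, Category.assoc, Iso.inv_hom_id_assoc, reassoc_of% hf, zero_comp])

/-- The morphism in the derived category defined by a cycle. -/
def derivedHom {n : ℕ} (f : A ⟶ C.X n) (hf : f ≫ C.d n (n + 1) = 0) :
    DerivedCategory.Q.obj ((CochainComplex.singleFunctor B 0).obj A) ⟶
      (DerivedCategory.Q.obj (extendNat C))⟦(n : ℤ)⟧ :=
  DerivedCategory.Q.map (Cocycle.equivHomShift.symm (cocycleOfHom A C f hf)) ≫
    (DerivedCategory.Q.commShiftIso (n : ℤ)).hom.app _

lemma derivedHom_add {n : ℕ} (f g : A ⟶ C.X n) (hf : f ≫ C.d n (n + 1) = 0)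
    (hg : g ≫ C.d n (n + 1) = 0) (hfg : (f + g) ≫ C.d n (n + 1) = 0) :
    derivedHom A C (f + g) hfg = derivedHom A C f hf + derivedHom A C g hg := by
  have : cocycleOfHom A C (f + g) hfg = cocycleOfHom A C f hf + cocycleOfHom A C g hg := by
    ext : 1
    change Cochain.fromSingleMk _ (zero_add (n : ℤ)) = Cochain.fromSingleMk _ (zero_add (n : ℤ)) +
      Cochain.fromSingleMk _ (zero_add (n : ℤ))
    rw [← Cochain.fromSingleMk_add, Preadditive.add_comp]
  have h₁ : Cocycle.equivHomShift.symm (cocycleOfHom A C (f + g) hfg) =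
      Cocycle.equivHomShift.symm (cocycleOfHom A C f hf) +
        Cocycle.equivHomShift.symm (cocycleOfHom A C g hg) := by
    rw [this]
    exact AddEquiv.map_add _ _ _
  rw [derivedHom, h₁, Functor.map_add, Preadditive.add_comp]
  rfl

/-- As for Ext, scalars act through the endomorphism `r • 𝟙 A`, and the embedding of `B` in degree
zero is linear. -/
lemma derivedHom_smul {n : ℕ} (r : R) (f : A ⟶ C.X n) (hf : f ≫ C.d n (n + 1) = 0)
    (hrf : (r • f) ≫ C.d n (n + 1) = 0) :
    derivedHom A C (r • f) hrf = r • derivedHom A C f hf := by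
  have : cocycleOfHom A C (r • f) hrf = (cocycleOfHom A C f hf).precomp
      ((CochainComplex.singleFunctor B 0).map (r • 𝟙 A)) := by
    rw [cocycleOfHom, cocycleOfHom, ← Cocycle.fromSingleMk_precomp]
    congr 1
    rw [Linear.smul_comp, Linear.smul_comp, Category.id_comp]
  rw [derivedHom, this, Cocycle.equivHomShift_symm_precomp, Functor.map_comp, Category.assoc]
  have h : DerivedCategory.Q.map ((CochainComplex.singleFunctor B 0).map (r • 𝟙 A)) =
      r • 𝟙 ((DerivedCategory.singleFunctor B 0).obj A) := by
    have h₁ : DerivedCategory.Q.map ((CochainComplex.singleFunctor B 0).map (r • 𝟙 A)) =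
      (DerivedCategory.singleFunctor B 0).map (r • 𝟙 A) := rfl
    rw [h₁, Functor.map_smul, CategoryTheory.Functor.map_id]
  refine (congrArg (· ≫ _) h).trans ?_
  exact (Linear.smul_comp _ _ _ _ _ _).trans (congrArg (r • ·) (Category.id_comp _))

variable [∀ n, Injective (C.X n)]

/-- The shifted complex of injectives is K-injective, so a morphism into it vanishes in the derived
category only if it is null-homotopic, which means that the cocycle is a coboundary. -/
lemma derivedHom_eq_zero_iff {n : ℕ} (f : A ⟶ C.X n) (hf : f ≫ C.d n (n + 1) = 0) :
    derivedHom A C f hf = 0 ↔ ∃ y, ((homComplex R A C).sc n).f.hom y = f := by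
  refine Iff.trans ?_ (exists_comp_d_extend_iff (R := R) f (n - 1) (by simp))
  refine Iff.trans ?_ (Cocycle.fromSingleMk_mem_coboundaries_iff _ (zero_add _)
    ((n + 1 : ℕ) : ℤ) (by simp) (by
      rw [extendNat_d, Category.assoc, Iso.inv_hom_id_assoc, reassoc_of% hf, zero_comp]) _
        (by simp))
  rw [← CohomologyClass.toHom_mk_eq_zero_iff, CohomologyClass.toHom_mk, derivedHom]
  have hinj := (CochainComplex.IsKInjective.Qh_map_bijective
    ((HomotopyCategory.quotient B _).obj ((CochainComplex.singleFunctor B 0).obj A))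
    ((extendNat C)⟦(n : ℤ)⟧)).injective
  constructor
  · intro h
    apply hinj
    refine ((cancel_mono ((DerivedCategory.Q.commShiftIso (n : ℤ)).hom.app _)).1
      (h.trans zero_comp.symm)).trans ?_
    exact (DerivedCategory.Qh.map_zero _ _).symm
  · intro h
    have h' : DerivedCategory.Q.map (Cocycle.equivHomShift.symm (cocycleOfHom A C f hf)) = 0 :=
      (congrArg DerivedCategory.Qh.map h).trans (DerivedCategory.Qh.map_zero _ _)
    rw [h', zero_comp]

lemma derivedHom_surjective (n : ℕ)
    (g : DerivedCategory.Q.obj ((CochainComplex.singleFunctor B 0).obj A) ⟶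
      (DerivedCategory.Q.obj (extendNat C))⟦(n : ℤ)⟧) :
    ∃ f hf, derivedHom A C (n := n) f hf = g := by
  obtain ⟨x, hx⟩ := (CochainComplex.IsKInjective.Qh_map_bijective
    ((HomotopyCategory.quotient B _).obj ((CochainComplex.singleFunctor B 0).obj A))
    ((extendNat C)⟦(n : ℤ)⟧)).surjective
      (g ≫ (DerivedCategory.Q.commShiftIso (n : ℤ)).inv.app _)
  obtain ⟨y, rfl⟩ := (HomotopyCategory.quotient B _).map_surjective x
  obtain ⟨f, hf, hfy⟩ := Cocycle.fromSingleMk_surjective (Cocycle.equivHomShift y) (n : ℤ)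
    (zero_add _) ((n + 1 : ℕ) : ℤ) (by simp)
  have hf' : (f ≫ (extendNatXIso C n).hom) ≫ C.d n (n + 1) = 0 := by
    rw [extendNat_d] at hf
    rw [← cancel_mono (extendNatXIso C (n + 1)).inv, Category.assoc, Category.assoc, hf, zero_comp]
  refine ⟨f ≫ (extendNatXIso C n).hom, hf', ?_⟩
  have h : cocycleOfHom A C _ hf' = Cocycle.equivHomShift y := by
    rw [← hfy, cocycleOfHom]
    congr 1
    rw [Category.assoc, Iso.hom_inv_id, Category.comp_id]
  rw [derivedHom, h, AddEquiv.symm_apply_apply]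
  refine (congrArg (· ≫ _) hx).trans ((Category.assoc _ _ _).trans ?_)
  exact (congrArg (g ≫ ·) (Iso.inv_hom_id_app (DerivedCategory.Q.commShiftIso (n : ℤ))
    (extendNat C))).trans (Category.comp_id _)

/-- The homology of the complex of morphisms into a complex of injective objects. -/
def homologyHomComplexEquiv (n : ℕ) :
    (homComplex R A C).homology n ≃ₗ[R]
      ((DerivedCategory.singleFunctor B 0).obj A ⟶
        (DerivedCategory.Q.obj (extendNat C))⟦(n : ℤ)⟧) :=
  homologyEquivOfSurjective ((homComplex R A C).sc n)
    { toFun := fun z ↦ derivedHom A C (z.1 : A ⟶ C.X n) (homComplex_cycle A C n z)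
      map_add' := fun z z' ↦ derivedHom_add A C _ _ _ _ _
      map_smul' := fun r z ↦ derivedHom_smul A C r _ _ _ }
    (fun g ↦ by
      obtain ⟨f, hf, rfl⟩ := derivedHom_surjective A C n g
      refine ⟨⟨f, ?_⟩, rfl⟩
      change f ≫ C.d n ((ComplexShape.up ℕ).next n) = 0
      rwa [CochainComplex.next])
    (fun z ↦ derivedHom_eq_zero_iff A C (z.1 : A ⟶ C.X n) _)

end Cocycles

end DerivedHom

/-! ### Grothendieck's spectral sequence. -/

section Grothendieck

open Abelian Pretriangulated ComposableArrows

universe v w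

variable {R : Type (u + 1)} [CommRing R] {B : Type v} [Category.{u + 1} B] [Abelian B]
  [Linear R B] [EnoughInjectives B]

section

variable [HasDerivedCategory.{w} B]

instance small_hom_spectralObject (A W : DerivedCategory B)
    [hW : DerivedCategory.TStructure.t.IsGE W 0] (X : ComposableArrows EInt 1) (n : ℤ) :
    Small.{u + 1} (A ⟶ ((DerivedCategory.TStructure.t.spectralObject W).ω₁.obj X)⟦n⟧) := by
  let t := DerivedCategory.TStructure.t (C := B)
  let Z := (t.eTruncGE.obj (X.obj 0)).obj ((t.eTruncLT.obj (X.obj 1)).obj W)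
  have : t.IsGE Z 0 := inferInstance
  have : (Z⟦n⟧).IsGE (-n) := t.isGE_shift Z 0 n (-n)
  exact small_hom_of_isGE A (Z⟦n⟧) (-n)

variable (R) in
/-- The spectral object which consists of the modules of morphisms from an object of the heart to
the truncations of an object of the derived category. -/
def derivedSpectralObject (A : B) (W : DerivedCategory B)
    [hW : DerivedCategory.TStructure.t.IsGE W 0] :
    Abelian.SpectralObject (ModuleCat.{u + 1} R) EInt :=
  homSpectralObject ((DerivedCategory.singleFunctor B 0).obj A)
    (DerivedCategory.TStructure.t.spectralObject W)

lemma isZero_of_hom_eq_zero {D : Type*} [Category* D] [Preadditive D] [Linear R D] {A Z : D}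
    [Small.{u + 1} (A ⟶ Z)] (h : ∀ f : A ⟶ Z, f = 0) :
    IsZero (ModuleCat.of R (Shrink.{u + 1} (A ⟶ Z))) := by
  have : Subsingleton (A ⟶ Z) := ⟨fun f g ↦ (h f).trans (h g).symm⟩
  have : Subsingleton (Shrink.{u + 1} (A ⟶ Z)) := (equivShrink (A ⟶ Z)).symm.subsingleton
  exact ModuleCat.isZero_of_subsingleton _

instance (A : B) (W : DerivedCategory B) [hW : DerivedCategory.TStructure.t.IsGE W 0] :
    (derivedSpectralObject R A W).IsFirstQuadrant where
  isZero₁ i j hij hj n := by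
    let t := DerivedCategory.TStructure.t (C := B)
    have h : IsZero ((t.eTruncLT.obj j).obj W) := t.isZero_eTruncLT_obj_obj W 0 j hj
    exact isZero_of_hom_eq_zero fun f ↦
      ((shiftFunctor _ n).map_isZero ((t.eTruncGE.obj i).map_isZero h)).eq_of_tgt _ _
  isZero₂ i j hij n hi := by
    let t := DerivedCategory.TStructure.t (C := B)
    let Z := (t.eTruncGE.obj i).obj ((t.eTruncLT.obj j).obj W)
    -- The bound `n < i` puts `Z` in degrees at least `n + 1`, so its shift by `n` lies in degrees
    -- at least `1`. An object of the heart has no nonzero morphism to it.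
    have : t.IsGE Z (n + 1) := t.isGE_eTruncGE_obj_obj (n + 1) i (by
      induction i using WithBotTop.rec with
      | bot => simp at hi
      | coe i => simp at hi ⊢; lia
      | top => simp) _
    have : t.IsGE (Z⟦n⟧) 1 := t.isGE_shift Z (n + 1) n 1
    have : t.IsLE ((DerivedCategory.singleFunctor B 0).obj A) 0 :=
      inferInstanceAs (((DerivedCategory.singleFunctor B 0).obj A).IsLE 0)
    exact isZero_of_hom_eq_zero fun f ↦ t.zero (Y := Z⟦n⟧) f 0 1

lemma nonempty_iso_of_shrink {D : Type*} [Category* D] [Preadditive D] [Linear R D] {A Z : D}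
    [Small.{u + 1} (A ⟶ Z)] (M : ModuleCat.{u + 1} R) (e : (A ⟶ Z) ≃ₗ[R] M) :
    Nonempty (ModuleCat.of R (Shrink.{u + 1} (A ⟶ Z)) ≅ M) :=
  ⟨((Shrink.linearEquiv R (A ⟶ Z)).trans e).toModuleIso⟩

end

variable [HasExt.{u + 1} B]

/-- The isomorphism of `Ext`-modules induced by an isomorphism in the second variable. -/
def extLinearEquiv (A : B) {Y Z : B} (e : Y ≅ Z) (n : ℕ) : Ext A Y n ≃ₗ[R] Ext A Z n where
  toFun x := x.comp (Ext.mk₀ e.hom) (add_zero n)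
  invFun x := x.comp (Ext.mk₀ e.inv) (add_zero n)
  map_add' _ _ := Ext.add_comp _ _ _ _
  map_smul' _ _ := Ext.smul_comp _ _ _ _
  left_inv x := by simp
  right_inv x := by simp

/-- The piece of the truncation filtration between `s` and `s + 1` is `H^s(C)` placed in degree `s`,
which produces the Ext terms. Injectivity of the terms of `C` enters only in the abutment, where it
makes the complex `Hom(A, C)` compute morphisms in the derived category. -/
lemma hasSpectralSequence_homComplex (A : B) (C : CochainComplex B ℕ) [∀ n, Injective (C.X n)] :
    HasSpectralSequence (fun r s ↦ ModuleCat.of R (Ext A (C.homology s) r))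
      (fun n ↦ (homComplex R A C).homology n) := by
  let := HasDerivedCategory.standard B
  let t := DerivedCategory.TStructure.t (C := B)
  let W := DerivedCategory.Q.obj (extendNat C)
  have : (extendNat C).IsGE 0 := inferInstance
  have hW : t.IsGE W 0 := inferInstanceAs ((DerivedCategory.Q.obj (extendNat C)).IsGE 0)
  refine (hasSpectralSequence_of_isFirstQuadrant (derivedSpectralObject R A W)).of_iso
    (fun r s ↦ ?_) (fun n ↦ ?_)
  · obtain ⟨e⟩ := nonempty_iso_singleFunctor_shift W r s
    let e' : (DerivedCategory.homologyFunctor B s).obj W ≅ C.homology s :=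
      (DerivedCategory.homologyFunctorFactors B s).app (extendNat C) ≪≫
        C.extendHomologyIso ComplexShape.embeddingUpNat rfl
    refine nonempty_iso_of_shrink _ ?_
    exact (Linear.homCongr R (Iso.refl _) (e ≪≫ (shiftFunctor _ (r : ℤ)).mapIso
      ((DerivedCategory.singleFunctor B 0).mapIso e'))).trans
      (Ext.homLinearEquiv (R := R)).symm
  · refine nonempty_iso_of_shrink _ ?_
    exact (homologyHomComplexEquiv (R := R) A C n).symm

/-- Grothendieck's spectral sequence for the composition of an additive functor which preserves
injective objects and a functor represented by an object. -/
theorem hasSpectralSequence_comp {D : Type*} [Category* D] [Abelian D] [EnoughInjectives D]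
    (F : D ⥤ B) [F.Additive] [F.PreservesInjectiveObjects] (A : B) (X : D) :
    HasSpectralSequence (fun r s ↦ ModuleCat.of R (Ext A ((F.rightDerived s).obj X) r))
      (fun n ↦ ((F ⋙ (linearCoyoneda R B).obj (op A)).rightDerived n).obj X) := by
  -- Left exactness of `F` plays no role: `F(I)` is a complex of injectives with homology the
  -- derived functors of `F`, and `Hom(A, F(I))` computes those of the composition. Hence `F(I)`
  -- needs no further resolution.
  let I := injectiveResolution X
  let C := (F.mapHomologicalComplex (.up ℕ)).obj I.cocomplex
  have (n : ℕ) : Injective (C.X n) := F.injective_obj (I.cocomplex.X n)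
  refine (hasSpectralSequence_homComplex (R := R) A C).of_iso (fun r s ↦ ?_) (fun n ↦ ?_)
  · let e := I.isoRightDerivedObj F s
    exact ⟨(extLinearEquiv A e.symm r).toModuleIso⟩
  · exact ⟨(I.isoRightDerivedObj (F ⋙ (linearCoyoneda R B).obj (op A)) n).symm⟩

end Grothendieck

/-! ### Left Kan extensions that preserve monomorphisms. -/

section Lan

universe v w

/-- It suffices to be mono at every object. There the pointwise formula turns the map of Kan
extensions into the map of colimits induced by `φ` over the costructured arrows. -/
lemma mono_lan_map {C D E : Type*} [Category* C] [Category* D] [Category* E] [HasPullbacks E]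
    (L : C ⥤ D) [∀ F : C ⥤ E, L.HasLeftKanExtension F]
    [∀ X, HasColimitsOfShape (CostructuredArrow L X) E]
    [∀ X, (colim (J := CostructuredArrow L X) (C := E)).PreservesMonomorphisms]
    {G₁ G₂ : C ⥤ E} (φ : G₁ ⟶ G₂) [Mono φ] : Mono ((L.lan (H := E)).map φ) := by
  have (X : D) : Mono (((L.lan (H := E)).map φ).app X) := by
    have : Mono (Functor.whiskerLeft (CostructuredArrow.proj L X) φ) :=
      have (j : CostructuredArrow L X) :
          Mono ((Functor.whiskerLeft (CostructuredArrow.proj L X) φ).app j) :=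
        inferInstanceAs (Mono (φ.app j.left))
      NatTrans.mono_of_mono_app _
    have : Mono (colim.map (Functor.whiskerLeft (CostructuredArrow.proj L X) φ)) := inferInstance
    let e₁ : (L.lan.obj G₁).obj X ≅ colim.obj (CostructuredArrow.proj L X ⋙ G₁) :=
      L.leftKanExtensionObjIsoColimit G₁ X
    let e₂ : (L.lan.obj G₂).obj X ≅ colim.obj (CostructuredArrow.proj L X ⋙ G₂) :=
      L.leftKanExtensionObjIsoColimit G₂ X
    have key : e₁.inv ≫ (L.lan.map φ).app X ≫ e₂.hom =
        colim.map (Functor.whiskerLeft (CostructuredArrow.proj L X) φ) := by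
      refine colimit.hom_ext fun j ↦ ?_
      have h₁ : colimit.ι (CostructuredArrow.proj L X ⋙ G₁) j ≫ e₁.inv =
          (L.lanUnit.app G₁).app j.left ≫ (L.lan.obj G₁).map j.hom :=
        L.ι_leftKanExtensionObjIsoColimit_inv G₁ X j
      have h₂ : φ.app j.left ≫ (L.lanUnit.app G₂).app j.left =
          (L.lanUnit.app G₁).app j.left ≫ (L.lan.map φ).app (L.obj j.left) :=
        congr_app ((L.lanUnit (H := E)).naturality φ) j.left
      have h₃ : (L.lan.obj G₁).map j.hom ≫ (L.lan.map φ).app X =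
          (L.lan.map φ).app (L.obj j.left) ≫ (L.lan.obj G₂).map j.hom :=
        (L.lan.map φ).naturality j.hom
      have h₄ : (L.lanUnit.app G₂).app j.left ≫ (L.lan.obj G₂).map j.hom ≫ e₂.hom =
          colimit.ι (CostructuredArrow.proj L X ⋙ G₂) j :=
        L.ι_leftKanExtensionObjIsoColimit_hom G₂ X j
      refine Eq.trans ?_ (ι_colimMap _ j).symm
      refine Eq.trans ?_ (congrArg (φ.app j.left ≫ ·) h₄)
      rw [reassoc_of% h₁]
      have h₅ := reassoc_of% h₃
      refine (Category.assoc _ _ _).trans ((congrArg (_ ≫ ·) (h₅ e₂.hom)).trans ?_)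
      exact ((reassoc_of% h₂) _).symm
    have : (L.lan.map φ).app X =
        e₁.hom ≫ colim.map (Functor.whiskerLeft (CostructuredArrow.proj L X) φ) ≫ e₂.inv := by
      rw [← key]
      simp
    rw [this]
    exact mono_comp' inferInstance (mono_comp' inferInstance inferInstance)
  exact NatTrans.mono_of_mono_app _

variable (R : Type (u + 1)) [CommRing R]

lemma preservesMonomorphisms_colim_of_isFiltered (I : Type (u + 1)) [Category.{u} I]
    [IsFiltered I] : (colim (J := I) (C := ModuleCat.{u + 1} R)).PreservesMonomorphisms := by
  have : AB5OfSize.{u, u + 1} (ModuleCat.{u + 1} R) :=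
    AB5OfSize_of_univLE.{u, u + 1, u + 1, u + 1} (ModuleCat.{u + 1} R)
  have : HasExactColimitsOfShape I (ModuleCat.{u + 1} R) := AB5OfSize.ofShape I
  infer_instance

/-- Finality of a discrete category turns the colimit into a coproduct, and coproducts of modules
are exact. -/
lemma preservesMonomorphisms_colim_of_final (I : Type (u + 1)) [Category.{u} I] (ι : Type (u + 1))
    (F : Discrete ι ⥤ I) [F.Final] :
    (colim (J := I) (C := ModuleCat.{u + 1} R)).PreservesMonomorphisms := by
  have : AB4 (ModuleCat.{u + 1} R) := AB4.of_AB5 _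
  have : HasExactColimitsOfShape (Discrete ι) (ModuleCat.{u + 1} R) := AB4OfSize.ofShape ι
  have : HasExactColimitsOfShape I (ModuleCat.{u + 1} R) := hasExactColimitsOfShape_of_final _ F
  infer_instance

variable {E E' : Type (u + 1)} [Category.{u} E] [Category.{u} E'] (J : GrothendieckTopology E)
  (J' : GrothendieckTopology E') (Φ : E ⥤ E')

lemma preservesMonomorphisms_lan
    (h : ∀ X, (colim (J := CostructuredArrow Φ.op X)
      (C := ModuleCat.{u + 1} R)).PreservesMonomorphisms) :
    (Φ.op.lan (H := ModuleCat.{u + 1} R)).PreservesMonomorphisms where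
  preserves φ _ := mono_lan_map Φ.op φ

/-- The left adjoint is Kan extension followed by the exact sheafification functor. It preserves
monomorphisms, so its right adjoint preserves injectives. -/
lemma preservesInjectiveObjects_sheafPushforwardContinuous [Φ.IsContinuous J J']
    (h : ∀ X, (colim (J := CostructuredArrow Φ.op X)
      (C := ModuleCat.{u + 1} R)).PreservesMonomorphisms) :
    (Φ.sheafPushforwardContinuous (ModuleCat.{u + 1} R) J J').PreservesInjectiveObjects := by
  have := preservesMonomorphisms_lan R Φ h
  have : (Functor.sheafPullbackConstruction.sheafPullback Φ (ModuleCat.{u + 1} R) J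
    J').PreservesMonomorphisms := by
    have h₁ : (sheafToPresheaf J (ModuleCat.{u + 1} R)).PreservesMonomorphisms :=
      Functor.preservesMonomorphisms_of_adjunction (sheafificationAdjunction J _)
    have h₂ : (presheafToSheaf J' (ModuleCat.{u + 1} R)).PreservesMonomorphisms := inferInstance
    unfold Functor.sheafPullbackConstruction.sheafPullback
    infer_instance
  exact Functor.preservesInjectiveObjects_of_adjunction_of_preservesMonomorphisms
    (Functor.sheafPullbackConstruction.sheafAdjunctionContinuous Φ (ModuleCat.{u + 1} R) J J')

/-- A functor all of whose categories of structured arrows are disjoint unions of categories with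
an initial object. -/
lemma preservesMonomorphisms_colim_costructuredArrow (U : E'ᵒᵖ)
    (ι : Type (u + 1)) (d : ι → StructuredArrow U.unop Φ)
    (h₁ : ∀ b, ∃ i, Nonempty (d i ⟶ b)) (h₂ : ∀ b i j, (d i ⟶ b) → (d j ⟶ b) → i = j)
    (h₃ : ∀ b i, Subsingleton (d i ⟶ b)) :
    (colim (J := CostructuredArrow Φ.op U) (C := ModuleCat.{u + 1} R)).PreservesMonomorphisms := by
  let F₀ : Discrete ι ⥤ (StructuredArrow U.unop Φ)ᵒᵖ := Discrete.functor fun i ↦ op (d i)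
  -- By `h₁` each comma category is nonempty. By `h₂` two of its objects have the same index and by
  -- `h₃` the same structure map, so it is connected.
  have : F₀.Final := by
    refine ⟨fun b ↦ ?_⟩
    obtain ⟨i, ⟨f⟩⟩ := h₁ b.unop
    have : Nonempty (StructuredArrow b F₀) :=
      ⟨StructuredArrow.mk (Y := Discrete.mk i) (S := b) (T := F₀) f.op⟩
    refine zigzag_isConnected fun x y ↦ ?_
    have e : x.right = y.right := Discrete.ext (h₂ _ _ _ x.hom.unop y.hom.unop)
    refine Zigzag.of_hom (StructuredArrow.homMk (eqToHom e) ?_)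
    have := h₃ b.unop y.right.as
    exact Quiver.Hom.unop_inj (Subsingleton.elim (α := d y.right.as ⟶ b.unop) _ _)
  let F : Discrete ι ⥤ CostructuredArrow Φ.op U :=
    F₀ ⋙ (structuredArrowOpEquivalence Φ U.unop).functor
  have : F.Final := inferInstance
  exact preservesMonomorphisms_colim_of_final R _ ι F

end Lan

/-! ### Exact restriction functors that preserve injectives. -/

section ExactRestriction

section RightDerived

variable {D E E' : Type*} [Category* D] [Category* E] [Category* E'] [Abelian D] [Abelian E]
  [Abelian E'] (F : D ⥤ E) [F.Additive] [PreservesFiniteLimits F] [PreservesFiniteColimits F]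
  [F.PreservesInjectiveObjects]

/-- The image of an injective resolution under an exact functor which preserves injectives. -/
@[simps cocomplex ι]
def mapInjectiveResolution {X : D} (I : InjectiveResolution X) :
    InjectiveResolution (F.obj X) where
  cocomplex := (F.mapHomologicalComplex (.up ℕ)).obj I.cocomplex
  injective n := F.injective_obj (I.cocomplex.X n)
  ι := (HomologicalComplex.singleMapHomologicalComplex F (.up ℕ) 0).inv.app X ≫
    (F.mapHomologicalComplex _).map I.ι
  quasiIso := by
    have : QuasiIso ((F.mapHomologicalComplex (.up ℕ)).map I.ι) := inferInstance
    exact quasiIso_comp _ _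

lemma mapInjectiveResolution_comm {X Y : D} (I : InjectiveResolution X) (I' : InjectiveResolution Y)
    (f : X ⟶ Y) (φ : I.cocomplex ⟶ I'.cocomplex) (h : I.ι.f 0 ≫ φ.f 0 = f ≫ I'.ι.f 0) :
    (mapInjectiveResolution F I).ι.f 0 ≫ ((F.mapHomologicalComplex (.up ℕ)).map φ).f 0 =
      F.map f ≫ (mapInjectiveResolution F I').ι.f 0 := by
  have h' (X : D) (I : InjectiveResolution X) : (mapInjectiveResolution F I).ι.f 0 =
      F.map (I.ι.f 0) := by
    rw [mapInjectiveResolution_ι, HomologicalComplex.comp_f]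
    refine (congrArg (· ≫ _)
      (HomologicalComplex.singleMapHomologicalComplex_inv_app_self F (c := .up ℕ) 0 X)).trans ?_
    simp
    exact Category.id_comp _
  rw [h', h']
  exact (F.map_comp _ _).symm.trans ((congrArg F.map h).trans (F.map_comp _ _))

variable [EnoughInjectives D] [EnoughInjectives E] (G : E ⥤ E') [G.Additive]

/-- The right derived functors of the composition of an exact functor which preserves injectives
and an additive functor. -/
def rightDerivedCompIso (n : ℕ) : (F ⋙ G).rightDerived n ≅ F ⋙ G.rightDerived n :=
  NatIso.ofComponents (fun X ↦ (injectiveResolution X).isoRightDerivedObj (F ⋙ G) n ≪≫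
    ((mapInjectiveResolution F (injectiveResolution X)).isoRightDerivedObj G n).symm)
    fun {X Y} f ↦ by
      have h₁ := InjectiveResolution.isoRightDerivedObj_hom_naturality f (injectiveResolution X)
        (injectiveResolution Y) (InjectiveResolution.desc f _ _)
        (InjectiveResolution.desc_commutes_zero _ _ _) (F ⋙ G) n
      have h₂ := InjectiveResolution.isoRightDerivedObj_inv_naturality (F.map f)
        (mapInjectiveResolution F (injectiveResolution X))
        (mapInjectiveResolution F (injectiveResolution Y))
        ((F.mapHomologicalComplex (.up ℕ)).map (InjectiveResolution.desc f _ _))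
        (mapInjectiveResolution_comm F _ _ f _ (InjectiveResolution.desc_commutes_zero _ _ _)) G n
      refine ((reassoc_of% h₁) _).trans ?_
      refine Eq.trans ?_ (Category.assoc _ _ _).symm
      exact congrArg (_ ≫ ·) h₂.symm

/-- The isomorphism between right derived functors induced by an isomorphism. -/
def rightDerivedIso {F G : E ⥤ E'} [F.Additive] [G.Additive] (e : F ≅ G) (n : ℕ) :
    F.rightDerived n ≅ G.rightDerived n where
  hom := NatTrans.rightDerived e.hom n
  inv := NatTrans.rightDerived e.inv n
  hom_inv_id := by rw [← NatTrans.rightDerived_comp, e.hom_inv_id, NatTrans.rightDerived_id]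
  inv_hom_id := by rw [← NatTrans.rightDerived_comp, e.inv_hom_id, NatTrans.rightDerived_id]

end RightDerived

variable (R : Type (u + 1)) [CommRing R] {E : Type (u + 1)} [Category.{u} E]
  (J : GrothendieckTopology E)

section

variable {E' : Type (u + 1)} [Category.{u} E'] (J' : GrothendieckTopology E') (Φ : E ⥤ E')
  [Φ.IsContinuous J J']

instance : PreservesFiniteLimits (Φ.sheafPushforwardContinuous (ModuleCat.{u + 1} R) J J') :=
  have : PreservesLimitsOfSize.{0, 0}
      (Φ.sheafPushforwardContinuous (ModuleCat.{u + 1} R) J J') :=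
    (Functor.sheafPullbackConstruction.sheafAdjunctionContinuous Φ (ModuleCat.{u + 1} R) J
      J').rightAdjoint_preservesLimits
  PreservesLimitsOfSize.preservesFiniteLimits _

/-- Cocontinuity gives restriction a right adjoint in addition to its left adjoint, so restriction
is exact. -/
instance [Φ.IsCocontinuous J J'] :
    PreservesFiniteColimits (Φ.sheafPushforwardContinuous (ModuleCat.{u + 1} R) J J') :=
  have : PreservesColimitsOfSize.{0, 0}
      (Φ.sheafPushforwardContinuous (ModuleCat.{u + 1} R) J J') :=
    (Φ.sheafAdjunctionCocontinuous (ModuleCat.{u + 1} R) J J').leftAdjoint_preservesColimits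
  PreservesColimitsOfSize.preservesFiniteColimits _

instance [Φ.IsCocontinuous J J'] :
    (Φ.sheafPushforwardCocontinuous (ModuleCat.{u + 1} R) J J').PreservesInjectiveObjects :=
  Functor.preservesInjectiveObjects_of_adjunction_of_preservesMonomorphisms
    (Φ.sheafAdjunctionCocontinuous (ModuleCat.{u + 1} R) J J')

end

variable {P Q : Eᵒᵖ ⥤ Type (u + 1)}

/-- The functor `El.map τ` is a discrete fibration. A structured arrow from `(U, β)` is determined
by its underlying morphism together with a section of `P` over the target; pulling the section back
to `U` gives a lift `α` of `β`. Each `(U, α)` is initial in its component, so the Kan extension is a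
coproduct over the lifts of `β`. -/
instance (τ : P ⟶ Q) : ((El.map τ).sheafPushforwardContinuous (ModuleCat.{u + 1} R)
    (El.topology J P) (El.topology J Q)).PreservesInjectiveObjects :=
  preservesInjectiveObjects_sheafPushforwardContinuous R _ _ _ fun U ↦
    preservesMonomorphisms_colim_costructuredArrow R (El.map τ) U
      {α : P.obj (op U.unop.base) // τ.app _ α = U.unop.sec}
      (fun α ↦ StructuredArrow.mk (Y := (⟨U.unop.base, α.1⟩ : El P))
        (⟨𝟙 _, (congrArg (Q.map (𝟙 _)) α.2).trans (El.Hom.map_sec (𝟙 U.unop))⟩ :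
           U.unop ⟶ (El.map τ).obj ⟨U.unop.base, α.1⟩))
      (fun b ↦ by
        let f : U.unop ⟶ (El.map τ).obj b.right := b.hom
        refine ⟨⟨P.map f.hom.op b.right.sec, ?_⟩, ⟨StructuredArrow.homMk ⟨f.hom, rfl⟩ ?_⟩⟩
        · exact (NatTrans.naturality_apply τ f.hom.op b.right.sec).trans f.map_sec
        · ext
          exact Category.id_comp f.hom)
      (fun b α β f g ↦ by
        have hf : 𝟙 _ ≫ f.right.hom = b.hom.hom := congrArg El.Hom.hom (StructuredArrow.w f)
        have hg : 𝟙 _ ≫ g.right.hom = b.hom.hom := congrArg El.Hom.hom (StructuredArrow.w g)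
        have h : f.right.hom = g.right.hom := (Category.id_comp _).symm.trans
          ((hf.trans hg.symm).trans (Category.id_comp _))
        refine Subtype.ext ?_
        refine f.right.map_sec.symm.trans (Eq.trans ?_ g.right.map_sec)
        exact congrArg (fun φ ↦ P.map φ b.right.sec) (congrArg Quiver.Hom.op h))
      (fun b α ↦ ⟨fun f g ↦ by
        have hf : 𝟙 _ ≫ f.right.hom = b.hom.hom := congrArg El.Hom.hom (StructuredArrow.w f)
        have hg : 𝟙 _ ≫ g.right.hom = b.hom.hom := congrArg El.Hom.hom (StructuredArrow.w g)
        exact StructuredArrow.hom_ext _ _ (El.hom_ext ((Category.id_comp _).symm.trans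
          ((hf.trans hg.symm).trans (Category.id_comp _))))⟩)

/-- The same argument applies: the components of the structured arrows are indexed by the morphisms
to `U` that pull `α` back to the given section. -/
instance {U : E} (α : P.obj (op U)) :
    ((El.ofOver P α).sheafPushforwardContinuous (ModuleCat.{u + 1} R)
      (J.over U) (El.topology J P)).PreservesInjectiveObjects :=
  preservesInjectiveObjects_sheafPushforwardContinuous R _ _ _ fun V ↦
    preservesMonomorphisms_colim_costructuredArrow R (El.ofOver P α) V
      (ULift.{u + 1} {g : V.unop.base ⟶ U // P.map g.op α = V.unop.sec})
      (fun g ↦ StructuredArrow.mk (Y := Over.mk g.down.1)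
        (⟨𝟙 _, (congrArg (P.map (𝟙 _)) g.down.2).trans (El.Hom.map_sec (𝟙 V.unop))⟩ :
           V.unop ⟶ (El.ofOver P α).obj (Over.mk g.down.1)))
      (fun b ↦ by
        let f : V.unop ⟶ (El.ofOver P α).obj b.right := b.hom
        let f' : V.unop.base ⟶ b.right.left := f.hom
        refine ⟨⟨f' ≫ b.right.hom, ?_⟩, ⟨StructuredArrow.homMk (Over.homMk f') ?_⟩⟩
        · rw [op_comp, Functor.map_comp_apply]
          exact f.map_sec
        · ext
          exact Category.id_comp f.hom)
      (fun b α β f g ↦ by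
        have hf : 𝟙 _ ≫ f.right.left = b.hom.hom := congrArg El.Hom.hom (StructuredArrow.w f)
        have hg : 𝟙 _ ≫ g.right.left = b.hom.hom := congrArg El.Hom.hom (StructuredArrow.w g)
        have h : f.right.left = g.right.left := (Category.id_comp _).symm.trans
          ((hf.trans hg.symm).trans (Category.id_comp _))
        refine ULift.ext _ _ (Subtype.ext ?_)
        refine (Over.w f.right).symm.trans (Eq.trans ?_ (Over.w g.right))
        exact congrArg (· ≫ _) h)
      (fun b α ↦ ⟨fun f g ↦ by
        have hf : 𝟙 _ ≫ f.right.left = b.hom.hom := congrArg El.Hom.hom (StructuredArrow.w f)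
        have hg : 𝟙 _ ≫ g.right.left = b.hom.hom := congrArg El.Hom.hom (StructuredArrow.w g)
        exact StructuredArrow.hom_ext _ _ (Over.OverMorphism.ext ((Category.id_comp _).symm.trans
          ((hf.trans hg.symm).trans (Category.id_comp _))))⟩)

instance {U : E} (α : P.obj (op U)) :
    (El.ofOver P α).IsCocontinuous (J.over U) (El.topology J P) where
  cover_lift {V A} hA := by
    rw [GrothendieckTopology.mem_over_iff]
    rw [El.mem_topology_iff] at hA
    refine J.superset_covering (fun W φ hφ ↦ ?_) hA
    refine (Sieve.overEquiv_iff _ φ).2 ?_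
    change A _
    rw [El.mem_iff]
    exact hφ

end ExactRestriction

/-! ### Sheaves on `𝒮` as equivariant maps into a smooth module. -/

section SmoothSheaves

variable {G : Type u} [Group G] [TopologicalSpace G] {𝒦 : SubgroupFamily G}

namespace GSet

/-- The stabilizer of an element as a member of the family. -/
abbrev stab {S : GSet 𝒦} (s : S.carrier) : 𝒦.carrier :=
  ⟨MulAction.stabilizer G s, S.stabilizer_mem s⟩

/-- The intersection of two members of the family. -/
abbrev inter (K L : 𝒦.carrier) : 𝒦.carrier :=
  ⟨K.1 ⊓ L.1, 𝒦.mem_of_le _ K.2 _ inf_le_left ((𝒦.isOpen _ K.2).inter (𝒦.isOpen _ L.2))⟩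

section Pullback

variable {S T U : GSet 𝒦} (f : S ⟶ U) (g : T ⟶ U)

instance : MulAction G {p : S.carrier × T.carrier // f.toFun p.1 = g.toFun p.2} where
  smul a p := ⟨(a • p.1.1, a • p.1.2), by rw [f.map_smul, g.map_smul, p.2]⟩
  one_smul _ := Subtype.ext (Prod.ext (one_smul G _) (one_smul G _))
  mul_smul a b _ := Subtype.ext (Prod.ext (mul_smul a b _) (mul_smul a b _))

/-- The fibre product of `G`-sets. -/
def pullbackObj : GSet 𝒦 where
  carrier := {p : S.carrier × T.carrier // f.toFun p.1 = g.toFun p.2}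
  stabilizer_mem p := by
    have h : MulAction.stabilizer G p = (inter (stab p.1.1) (stab p.1.2)).1 := by
      ext a
      exact Subtype.ext_iff.trans Prod.ext_iff
    rw [h]
    exact (inter _ _).2

/-- The first projection. -/
def pullbackFst : pullbackObj f g ⟶ S where
  toFun p := p.1.1
  map_smul _ _ := rfl

/-- The second projection. -/
def pullbackSnd : pullbackObj f g ⟶ T where
  toFun p := p.1.2
  map_smul _ _ := rfl

lemma isPullback : IsPullback (pullbackFst f g) (pullbackSnd f g) f g where
  w := hom_ext fun (p : (pullbackObj f g).carrier) ↦ Subtype.property p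
  isLimit' := ⟨PullbackCone.IsLimit.mk (hom_ext fun p ↦ Subtype.property p)
    (fun s ↦ ⟨fun x ↦ ⟨(s.fst.toFun x, s.snd.toFun x), congr_arg (fun h ↦ Hom.toFun h x)
      s.condition⟩, fun a x ↦ Subtype.ext (Prod.ext (s.fst.map_smul a x) (s.snd.map_smul a x))⟩)
    (fun _ ↦ rfl) (fun _ ↦ rfl) (fun _ _ h₁ h₂ ↦ hom_ext fun x ↦ Subtype.ext (Prod.ext
      (congr_arg (fun h ↦ Hom.toFun h x) h₁) (congr_arg (fun h ↦ Hom.toFun h x) h₂)))⟩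

end Pullback

section Equalizer

variable {S T : GSet 𝒦} (f g : S ⟶ T)

instance : MulAction G {s : S.carrier // f.toFun s = g.toFun s} where
  smul a s := ⟨a • s.1, by rw [f.map_smul, g.map_smul, s.2]⟩
  one_smul _ := Subtype.ext (one_smul G _)
  mul_smul a b _ := Subtype.ext (mul_smul a b _)

/-- The equalizer of two morphisms of `G`-sets. -/
def equalizerObj : GSet 𝒦 where
  carrier := {s : S.carrier // f.toFun s = g.toFun s}
  stabilizer_mem s := by
    have h : MulAction.stabilizer G s = (stab s.1).1 := by
      ext a
      exact Subtype.ext_iff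
    rw [h]
    exact (stab s.1).2

/-- The inclusion of the equalizer. -/
def equalizerι : equalizerObj f g ⟶ S where
  toFun s := s.1
  map_smul _ _ := rfl

lemma equalizer_condition : equalizerι f g ≫ f = equalizerι f g ≫ g :=
  hom_ext fun s ↦ Subtype.property s

/-- The universal property of the equalizer. -/
def isLimitEqualizer : IsLimit (Fork.ofι (equalizerι f g) (equalizer_condition f g)) :=
  Fork.IsLimit.mk _ (fun s ↦ ⟨fun x ↦ ⟨s.ι.toFun x, congr_arg (fun h ↦ Hom.toFun h x) s.condition⟩,
    fun a x ↦ Subtype.ext (s.ι.map_smul a x)⟩) (fun _ ↦ rfl)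
    (fun _ _ h ↦ hom_ext fun x ↦ Subtype.ext (congr_arg (fun h ↦ Hom.toFun h x) h))

end Equalizer

lemma quotHom_comp (K : 𝒦.carrier) {S T : GSet 𝒦} (s : S.carrier)
    (h : K.1 ≤ MulAction.stabilizer G s) (f : S ⟶ T)
    (h' : K.1 ≤ MulAction.stabilizer G (f.toFun s)) :
    quotHom K s h ≫ f = quotHom K (f.toFun s) h' := by
  ext x
  obtain ⟨x, rfl⟩ := QuotientGroup.mk_surjective (s := K.1) x
  exact f.map_smul x s

lemma stabilizer_le_map {S T : GSet 𝒦} (f : S ⟶ T) (s : S.carrier) :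
    MulAction.stabilizer G s ≤ MulAction.stabilizer G (f.toFun s) := fun a ha ↦ by
  rw [MulAction.mem_stabilizer_iff] at ha ⊢
  rw [← f.map_smul, ha]

lemma quotMul_quotHom (K L : 𝒦.carrier) (g : G) (h : ∀ k ∈ K.1, g⁻¹ * k * g ∈ L.1) {S : GSet 𝒦}
    (s : S.carrier) (h' : L.1 ≤ MulAction.stabilizer G s)
    (h'' : K.1 ≤ MulAction.stabilizer G (g • s)) :
    quotMul K L g h ≫ quotHom L s h' = quotHom K (g • s) h'' := by
  ext x
  obtain ⟨x, rfl⟩ := QuotientGroup.mk_surjective (s := K.1) x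
  exact mul_smul x g s

end GSet

section Eval

open GSet

variable {R : Type (u + 1)} [CommRing R] (N : (GSet 𝒦)ᵒᵖ ⥤ ModuleCat.{u + 1} R)

lemma map_map_apply {S T U : GSet 𝒦} (f : S ⟶ T) (g : T ⟶ U) (x : N.obj (op U)) :
    (N.map f.op).hom ((N.map g.op).hom x) = (N.map (f ≫ g).op).hom x := by
  rw [op_comp, N.map_comp]
  rfl

lemma transMap_one_map_quotHom {S : GSet 𝒦} (s : S.carrier) (K L : 𝒦.carrier)
    (hK : K.1 ≤ MulAction.stabilizer G s) (hL : L.1 ≤ MulAction.stabilizer G s)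
    (h : ∀ k ∈ K.1, (1 : G)⁻¹ * k * 1 ∈ L.1) (x : N.obj (op S)) :
    transMap N K L 1 h ((N.map (quotHom L s hL).op).hom x) = (N.map (quotHom K s hK).op).hom x := by
  refine (map_map_apply N _ _ x).trans ?_
  rw [quotMul_quotHom _ _ _ _ _ _ (by rwa [one_smul])]
  simp only [one_smul]

/-- The value of a section over `S` at a point of `S`. -/
def evalAt {S : GSet 𝒦} (s : S.carrier) : N.obj (op S) →ₗ[R] Lim N :=
  toLim N (stab s) ∘ₗ (N.map (quotHom (stab s) s le_rfl).op).hom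

/-- The stabilizer is only a canonical choice in `evalAt`; every smaller member of the family gives
the same value. -/
lemma toLim_map_quotHom {S : GSet 𝒦} (s : S.carrier) (K : 𝒦.carrier)
    (h : K.1 ≤ MulAction.stabilizer G s) (x : N.obj (op S)) :
    toLim N K ((N.map (quotHom K s h).op).hom x) = evalAt N s x := by
  have h' : ∀ k ∈ K.1, (1 : G)⁻¹ * k * 1 ∈ (stab s).1 := fun k hk ↦ by simpa using h hk
  rw [evalAt, LinearMap.comp_apply, ← toLim_transMap_one N (stab s) K h']
  exact congrArg _ (transMap_one_map_quotHom N s K _ h _ h' x).symm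

lemma evalAt_map {S T : GSet 𝒦} (f : S ⟶ T) (s : S.carrier) (x : N.obj (op T)) :
    evalAt N s ((N.map f.op).hom x) = evalAt N (f.toFun s) x := by
  rw [evalAt, LinearMap.comp_apply,
    ← toLim_map_quotHom N (f.toFun s) (stab s) (stabilizer_le_map f s)]
  refine congrArg _ ?_
  rw [map_map_apply, quotHom_comp]

/-- The conjugate by `g` of the stabilizer of `s` fixes `g • s`, and `limRho` is defined by
transport to conjugates. So the values of a section form an equivariant function. -/
lemma evalAt_smul {S : GSet 𝒦} (g : G) (s : S.carrier) (x : N.obj (op S)) :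
    evalAt N (g • s) x = limRho N g (evalAt N s x) := by
  have h := conjK_spec (stab s) g
  have h' : (conjK (stab s) g).1 ≤ MulAction.stabilizer G (g • s) := fun k hk ↦ by
    have : (g⁻¹ * k * g) • s = s := h k hk
    rw [MulAction.mem_stabilizer_iff, ← mul_smul]
    conv_rhs => rw [← this, ← mul_smul]
    congr 1
    group
  change _ = limAct N g (toLim N (stab s) _)
  rw [limAct_toLim N g _ _ h, ← toLim_map_quotHom N (g • s) _ h']
  refine congrArg _ ?_
  refine Eq.trans ?_ (map_map_apply N _ _ x).symm
  rw [quotMul_quotHom]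

lemma limMap_evalAt {N N' : (GSet 𝒦)ᵒᵖ ⥤ ModuleCat.{u + 1} R} (φ : N ⟶ N') {S : GSet 𝒦}
    (s : S.carrier) (x : N.obj (op S)) :
    limMap φ (evalAt N s x) = evalAt N' s ((φ.app (op S)).hom x) := by
  refine (limMap_toLim φ _ _).trans (congrArg _ ?_)
  exact congr($(φ.naturality (quotHom (stab s) s le_rfl).op).hom x)

lemma evalAt_one (K : 𝒦.carrier) (x : N.obj (op (quot K))) :
    evalAt N (S := quot K) ((1 : G) : G ⧸ K.1) x = toLim N K x := by
  have h : K.1 ≤ MulAction.stabilizer G ((1 : G) : G ⧸ K.1) := by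
    rw [MulAction.stabilizer_quotient]
  have h₁ : quotHom K (S := quot K) ((1 : G) : G ⧸ K.1) h = 𝟙 _ := by
    ext x
    obtain ⟨x, rfl⟩ := QuotientGroup.mk_surjective (s := K.1) x
    change x • ((1 : G) : G ⧸ K.1) = x
    rw [MulAction.Quotient.smul_coe, smul_eq_mul, mul_one]
  rw [← toLim_map_quotHom N (S := quot K) _ K h, h₁]
  simp

/-- The sections of `N` are the equivariant maps to the colimit of `N`. -/
structure IsDetermined : Prop where
  eq_zero {S : GSet 𝒦} (x : N.obj (op S)) (h : ∀ s, evalAt N s x = 0) : x = 0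
  exists_eq {S : GSet 𝒦} (ξ : S.carrier → Lim N) (hξ : ∀ (g : G) s, ξ (g • s) = limRho N g (ξ s)) :
    ∃ x : N.obj (op S), ∀ s, evalAt N s x = ξ s

lemma IsDetermined.ext {N : (GSet 𝒦)ᵒᵖ ⥤ ModuleCat.{u + 1} R} (hN : IsDetermined N) {S : GSet 𝒦}
    (x y : N.obj (op S)) (h : ∀ s, evalAt N s x = evalAt N s y) : x = y :=
  sub_eq_zero.1 (hN.eq_zero _ fun s ↦ by rw [map_sub, h s, sub_self])

lemma exists_map_quotHom_eq_zero {S : GSet 𝒦} (x : N.obj (op S)) (s : S.carrier)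
    (h : evalAt N s x = 0) : ∃ (K : 𝒦.carrier) (hK : K.1 ≤ MulAction.stabilizer G s),
      (N.map (quotHom K s hK).op).hom x = 0 := by
  obtain ⟨L, hL, hx⟩ := Module.DirectLimit.of.zero_exact
    (G := fun K : (𝒦.carrier)ᵒᵈ ↦ N.obj (op (GSet.quot (OrderDual.ofDual K))))
    (f := fun K L h ↦ res N K L h) h
  have hL' : (OrderDual.ofDual L).1 ≤ (stab s).1 := hL
  exact ⟨OrderDual.ofDual L, hL', (transMap_one_map_quotHom N s (OrderDual.ofDual L) (stab s)
    hL' le_rfl _ x).symm.trans hx⟩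

/-- Both halves are sheaf arguments over coverings by spaces `G ⧸ K`. A section with zero values
vanishes on a small enough `G ⧸ K` through each point; an equivariant function comes locally from
sections, and uniqueness lets them be glued. -/
lemma isDetermined_of_isSheaf (hN : Presheaf.IsSheaf (GSet.topology 𝒦) N) : IsDetermined N := by
  have hN' : Presieve.IsSheaf (GSet.topology 𝒦) (N ⋙ forget _) :=
    (isSheaf_iff_isSheaf_of_type _ _).1 (Presheaf.isSheaf_comp_of_isSheaf _ N (forget _) hN)
  have h₀ {S : GSet 𝒦} (x : N.obj (op S)) (h : ∀ s, evalAt N s x = 0) : x = 0 := by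
    let A : Sieve S :=
      { arrows := fun T f ↦ (N.map f.op).hom x = 0
        downward_closed := fun {T U f} hf g ↦ by
          rw [op_comp, N.map_comp]
          exact (congrArg (N.map g.op).hom hf).trans (map_zero _) }
    have hA : A ∈ GSet.topology 𝒦 S := fun s ↦ by
      obtain ⟨K, hK, hx⟩ := exists_map_quotHom_eq_zero N x s (h s)
      exact ⟨quot K, quotHom K s hK, ((1 : G) : G ⧸ K.1), hx, one_smul G s⟩
    exact (hN' A hA).isSeparatedFor.ext fun T f hf ↦
      (show (N.map f.op).hom x = (N.map f.op).hom 0 from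
        (show (N.map f.op).hom x = 0 from hf).trans (map_zero _).symm)
  have h₁ {S : GSet 𝒦} (x y : N.obj (op S)) (h : ∀ s, evalAt N s x = evalAt N s y) : x = y :=
    sub_eq_zero.1 (h₀ _ fun s ↦ by rw [map_sub, h s, sub_self])
  refine ⟨h₀, fun {S} ξ hξ ↦ ?_⟩
  -- These are the morphisms along which `ξ` pulls back to the values of a section. Near `s` one
  -- takes the intersection of the stabilizer of `s` with a group `K` over which `ξ s` is defined.
  let A : Sieve S :=
    { arrows := fun T f ↦ ∃ x : N.obj (op T), ∀ t, evalAt N t x = ξ (f.toFun t)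
      downward_closed := by
        rintro T U f ⟨x, hx⟩ g
        exact ⟨(N.map g.op).hom x, fun t ↦ (evalAt_map N g t x).trans (hx _)⟩ }
  have hA : A ∈ GSet.topology 𝒦 S := fun s ↦ by
    obtain ⟨K, y, hy⟩ := exists_toLim N (ξ s)
    have h : ∀ k ∈ (inter (stab s) K).1, (1 : G)⁻¹ * k * 1 ∈ K.1 := fun k hk ↦ by simpa using hk.2
    refine ⟨quot (inter (stab s) K), quotHom _ s inf_le_left,
      ((1 : G) : G ⧸ (inter (stab s) K).1), ⟨transMap N _ K 1 h y, fun t ↦ ?_⟩, one_smul G s⟩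
    obtain ⟨t, rfl⟩ := QuotientGroup.mk_surjective (s := (inter (stab s) K).1) t
    have ht : ((t : G) : G ⧸ (inter (stab s) K).1) = t • ((1 : G) : G ⧸ (inter (stab s) K).1) := by
      rw [MulAction.Quotient.smul_coe, smul_eq_mul, mul_one]
    refine (congrArg (fun a ↦ evalAt N (S := quot (inter (stab s) K)) a (transMap N _ K 1 h y))
      ht).trans ?_
    refine (evalAt_smul N (S := quot (inter (stab s) K)) t _ _).trans ?_
    rw [evalAt_one, toLim_transMap_one, hy]
    exact (hξ t s).symm
  choose x hx using fun (T : GSet 𝒦) (f : T ⟶ S) (hf : A f) ↦ hf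
  let fam : Presieve.FamilyOfElements (N ⋙ forget _) A.arrows := fun T f hf ↦ x T f hf
  -- Over a common refinement both restrictions have the values prescribed by `ξ`, so they coincide
  -- by `h₁`.
  have hfam : fam.Compatible := fun {Y₁ Y₂ Z} g₁ g₂ f₁ f₂ hf₁ hf₂ e ↦ by
    refine h₁ (S := Z) ((N.map g₁.op).hom (x _ f₁ hf₁)) ((N.map g₂.op).hom (x _ f₂ hf₂)) fun z ↦ ?_
    rw [evalAt_map, evalAt_map, hx, hx]
    exact congrArg ξ (congr_arg (fun h ↦ Hom.toFun h z) e)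
  obtain ⟨y, hy, -⟩ := hN' A hA fam hfam
  refine ⟨y, fun s ↦ ?_⟩
  obtain ⟨T, f, t, hf, rfl⟩ := hA s
  rw [← evalAt_map, ← hx T f hf]
  exact congrArg (evalAt N t) (hy f hf)

end Eval

end SmoothSheaves

/-! ### Smooth representations and sheaves on `𝒮`. -/

section SmoothAdjunction

open GSet

variable {G : Type u} [Group G] [TopologicalSpace G] [IsTopologicalGroup G] {𝒦 : SubgroupFamily G}
variable {R : Type (u + 1)} [CommRing R]

@[ext]
lemma smoothRep_hom_ext {M M' : SmoothRep R G} {f g : M ⟶ M'}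
    (h : ∀ m : M.obj.V, f.hom.hom m = g.hom.hom m) : f = g :=
  ObjectProperty.hom_ext _ (Rep.hom_ext (Representation.IntertwiningMap.toLinearMap_injective
    _ _ (LinearMap.ext h)))

instance : (limFunctor 𝒦 R).Linear R where
  map_smul {N N'} φ r := by
    ext v
    obtain ⟨K, x, rfl⟩ := exists_toLim N v
    change limMap (r • φ) (toLim N K x) = r • limMap φ (toLim N K x)
    rw [limMap_toLim, limMap_toLim, ← map_smul]
    rfl

section Counit

variable (M : SmoothRep R G)

variable (𝒦) in
/-- The morphism `Maps_G(·, M) ⟶ Maps_G(·, M')` induced by a morphism of representations. -/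
def mapsPresheafMap {M M' : SmoothRep R G} (f : M ⟶ M') : mapsPresheaf 𝒦 M ⟶ mapsPresheaf 𝒦 M' where
  app S := ModuleCat.ofHom
    { toFun := fun φ ↦ ⟨fun s ↦ f.hom.hom (φ.1 s), fun g s ↦
        (congrArg f.hom.hom (φ.2 g s)).trans (Rep.hom_comm_apply f.hom g (φ.1 s))⟩
      map_add' := fun φ ψ ↦ Subtype.ext (funext fun s ↦ map_add f.hom.hom (φ.1 s) (ψ.1 s))
      map_smul' := fun r φ ↦ Subtype.ext (funext fun s ↦ map_smul f.hom.hom r (φ.1 s)) }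

/-- The value at `1` of a function on `G ⧸ K`. -/
def evalOne (K : 𝒦.carrier) : equivariantMaps (quot K) M →ₗ[R] M.obj.V where
  toFun φ := φ.1 ((1 : G) : G ⧸ K.1)
  map_add' _ _ := rfl
  map_smul' _ _ := rfl

lemma equivariantMaps_coe (K : 𝒦.carrier) (φ : equivariantMaps (quot K) M) (g : G) :
    φ.1 ((g : G) : G ⧸ K.1) = M.obj.ρ g (evalOne M K φ) := by
  refine Eq.trans (congrArg φ.1 ?_) (φ.2 g ((1 : G) : G ⧸ K.1))
  exact congrArg _ (mul_one g).symm

/-- The map from the colimit of the modules of functions on the `G`-sets `G ⧸ K`. -/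
def limMapsLinear : Lim (mapsPresheaf 𝒦 M) →ₗ[R] M.obj.V :=
  Module.DirectLimit.lift R (𝒦.carrier)ᵒᵈ
    (fun K : (𝒦.carrier)ᵒᵈ ↦ (mapsPresheaf 𝒦 M).obj (op (quot (OrderDual.ofDual K))))
    (fun K L h ↦ res (mapsPresheaf 𝒦 M) K L h)
    (fun K ↦ evalOne M (OrderDual.ofDual K))
    (fun _ _ _ φ ↦ congrArg φ.1 (congrArg _ (one_mul (1 : G))))

lemma limMapsLinear_toLim (K : 𝒦.carrier) (φ : (mapsPresheaf 𝒦 M).obj (op (quot K))) :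
    limMapsLinear M (toLim (mapsPresheaf 𝒦 M) K φ) = evalOne M K φ :=
  Module.DirectLimit.lift_of
    (G := fun K : (𝒦.carrier)ᵒᵈ ↦ (mapsPresheaf 𝒦 M).obj (op (quot (OrderDual.ofDual K))))
    (f := fun K L h ↦ res (mapsPresheaf 𝒦 M) K L h) _ _ φ

/-- An equivariant function on `G ⧸ K` is determined by its value at `1`, which can be any vector
fixed by `K`. Smoothness and cofinality of the family say that such vectors exhaust `M`. -/
lemma limMapsLinear_bijective : Function.Bijective (limMapsLinear (𝒦 := 𝒦) M) := by
  refine ⟨(injective_iff_map_eq_zero _).2 fun v hv ↦ ?_, fun m ↦ ?_⟩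
  · obtain ⟨K, φ, rfl⟩ := exists_toLim (mapsPresheaf 𝒦 M) v
    rw [limMapsLinear_toLim] at hv
    have : φ = 0 := by
      refine Subtype.ext (funext fun x ↦ ?_)
      obtain ⟨x, rfl⟩ := QuotientGroup.mk_surjective (s := K.1) x
      refine (equivariantMaps_coe M K φ x).trans ?_
      rw [hv, map_zero]
      rfl
    rw [this, map_zero]
  · let H : Subgroup G :=
      { carrier := {g | M.obj.ρ g m = m}
        one_mem' := by simp
        mul_mem' := fun {a b} (ha : _ = _) (hb : _ = _) ↦ by
          change M.obj.ρ (a * b) m = m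
          rw [map_mul, Module.End.mul_apply, hb, ha]
        inv_mem' := fun {a} (ha : _ = _) ↦ by
          change M.obj.ρ a⁻¹ m = m
          conv_lhs => rw [← ha]
          rw [← Module.End.mul_apply, ← map_mul]
          simp }
    obtain ⟨K, hK, hKH⟩ := 𝒦.cofinal H (M.property m)
    let φ : equivariantMaps (quot (⟨K, hK⟩ : 𝒦.carrier)) M :=
      ⟨fun x : G ⧸ K ↦ Quotient.liftOn' x (fun g ↦ M.obj.ρ g m) fun a b hab ↦ by
        have h : M.obj.ρ (a⁻¹ * b) m = m := hKH (QuotientGroup.leftRel_apply.1 hab)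
        conv_lhs => rw [← h]
        rw [← Module.End.mul_apply, ← map_mul, mul_inv_cancel_left], by
      rintro g ⟨x⟩
      change M.obj.ρ (g * x) m = M.obj.ρ g (M.obj.ρ x m)
      rw [map_mul]
      rfl⟩
    refine ⟨toLim (mapsPresheaf 𝒦 M) ⟨K, hK⟩ φ, ?_⟩
    refine (limMapsLinear_toLim M _ φ).trans ?_
    change M.obj.ρ 1 m = m
    simp

lemma limMapsLinear_equivariant (g : G) (v : Lim (mapsPresheaf 𝒦 M)) :
    limMapsLinear M (limRho _ g v) = M.obj.ρ g (limMapsLinear M v) := by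
  obtain ⟨K, φ, rfl⟩ := exists_toLim (mapsPresheaf 𝒦 M) v
  have h := limAct_toLim (mapsPresheaf 𝒦 M) g K _ (conjK_spec K g) φ
  refine (congrArg (limMapsLinear M) h).trans ?_
  rw [limMapsLinear_toLim, limMapsLinear_toLim]
  refine Eq.trans ?_ (equivariantMaps_coe M K φ g)
  exact congrArg (show equivariantMaps (quot K) M from φ).1 (congrArg _ (one_mul g))

variable (𝒦) in
/-- The colimit of the modules of functions on the `G`-sets `G ⧸ K`. -/
def limMapsIso : (limFunctor 𝒦 R).obj (mapsPresheaf 𝒦 M) ≅ M :=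
  ObjectProperty.isoMk _ (Rep.mkIso (Representation.Equiv.mk
    (LinearEquiv.ofBijective (limMapsLinear M) (limMapsLinear_bijective M)) fun g ↦
      LinearMap.ext fun v ↦ limMapsLinear_equivariant M g v))

lemma limMapsIso_naturality {M M' : SmoothRep R G} (f : M ⟶ M') :
    (limFunctor 𝒦 R).map (mapsPresheafMap 𝒦 f) ≫ (limMapsIso 𝒦 M').hom =
      (limMapsIso 𝒦 M).hom ≫ f := by
  ext v
  obtain ⟨K, φ, rfl⟩ := exists_toLim (mapsPresheaf 𝒦 M) v
  change limMapsLinear M' (limMap (mapsPresheafMap 𝒦 f) (toLim (mapsPresheaf 𝒦 M) K φ)) =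
    f.hom.hom (limMapsLinear M (toLim (mapsPresheaf 𝒦 M) K φ))
  refine Eq.trans ?_ (congrArg f.hom.hom (limMapsLinear_toLim M K φ)).symm
  refine (congrArg (limMapsLinear M') (limMap_toLim (mapsPresheafMap 𝒦 f) K φ)).trans ?_
  exact limMapsLinear_toLim M' K _

end Counit

variable {N : (GSet 𝒦)ᵒᵖ ⥤ ModuleCat.{u + 1} R}

/-- A morphism into a determined presheaf is known from the values of its sections, hence from its
effect on colimits. Conversely, a `G`-map `η : M ⟶ Lim N` sends a function `m` on `S` to the unique
section with values `η (m s)`. -/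
lemma IsDetermined.limFunctor_map_bijective (hN : IsDetermined N) (M : SmoothRep R G) :
    Function.Bijective fun φ : mapsPresheaf 𝒦 M ⟶ N ↦
      (limMapsIso 𝒦 M).inv ≫ (limFunctor 𝒦 R).map φ := by
  constructor
  · intro φ ψ h
    replace h : (limFunctor 𝒦 R).map φ = (limFunctor 𝒦 R).map ψ := (cancel_epi _).1 h
    ext S : 2
    refine ModuleCat.hom_ext (LinearMap.ext fun m ↦ ?_)
    refine hN.ext (S := S.unop) _ _ fun s ↦ ?_
    refine (limMap_evalAt φ s m).symm.trans (Eq.trans ?_ (limMap_evalAt ψ s m))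
    exact congr($(h).hom.hom (evalAt (mapsPresheaf 𝒦 M) s m))
  · intro h
    let η (m : M.obj.V) : Lim N := h.hom.hom m
    have hη (g : G) (m : M.obj.V) : η (M.obj.ρ g m) = limRho N g (η m) :=
      Rep.hom_comm_apply h.hom g m
    have key (S : GSet 𝒦) (m : equivariantMaps S M) :
        ∃ x : N.obj (op S), ∀ s, evalAt N s x = η (m.1 s) :=
      hN.exists_eq (fun s ↦ η (m.1 s)) fun g s ↦ by rw [m.2 g s, hη]
    choose x hx using key
    let φ : mapsPresheaf 𝒦 M ⟶ N :=
      { app S := ModuleCat.ofHom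
          { toFun := fun m ↦ x S.unop m
            map_add' := fun m m' ↦ hN.ext (S := S.unop) _ _ fun s ↦ by
              rw [map_add, hx, hx, hx]
              exact map_add h.hom.hom (m.1 s) (m'.1 s)
            map_smul' := fun r m ↦ hN.ext (S := S.unop) _ _ fun s ↦ by
              rw [map_smul, hx, hx]
              exact map_smul h.hom.hom r (m.1 s) }
        naturality S T f := by
          refine ModuleCat.hom_ext (LinearMap.ext fun m ↦ hN.ext (S := T.unop) _ _ fun s ↦ ?_)
          refine (hx T.unop _ s).trans ?_
          exact ((evalAt_map N f.unop s (x S.unop m)).trans (hx S.unop m _)).symm }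
    refine ⟨φ, ?_⟩
    rw [Iso.inv_comp_eq]
    ext v
    obtain ⟨K, m, rfl⟩ := exists_toLim (mapsPresheaf 𝒦 M) v
    change limMap φ (toLim (mapsPresheaf 𝒦 M) K m) =
      η (limMapsLinear M (toLim (mapsPresheaf 𝒦 M) K m))
    rw [limMap_toLim, limMapsLinear_toLim, ← evalAt_one]
    exact hx (quot K) m ((1 : G) : G ⧸ K.1)

variable {C : Type (u + 1)} [Category.{u} C] (J : GrothendieckTopology C) {X : GSet 𝒦 ⥤ C}

/-- A morphism to `(X_S, α_S)`. -/
def homLiftColim {U : OverColim X} {S : GSet 𝒦} (a : U.base ⟶ X.obj S) (h : colimMk X a = U.sec) :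
    U ⟶ (liftColim X).obj S :=
  ⟨a, (congrArg (colimMk X) (Category.comp_id a)).trans h⟩

lemma colimMk_hom {U : OverColim X} {S : GSet 𝒦} (f : U ⟶ (liftColim X).obj S) :
    colimMk X (S := S) f.hom = U.sec :=
  (congrArg (colimMk X) (Category.comp_id _)).symm.trans f.map_sec

/-- Two morphisms to `X_{Y₁}` and `X_{Y₂}` that agree in `X_S` factor through `X` of the fibre
product. The factorization respects the classes in the colimit because these do not change along
transition maps, so it takes place in `C/colim X`. -/
lemma IsSObject.isContinuous_liftColim (hX : IsSObject J X) :
    (liftColim X).IsContinuous (GSet.topology 𝒦) (El.topology J (colimPresheaf X)) := by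
  have := hX.preservesPullbacks
  refine Functor.isContinuous_of_coverPreserving ⟨?_⟩ ⟨fun {S A} hA ↦ ?_⟩
  · intro ℱ S T x hx Y₁ Y₂ W f₁ f₂ g₁ g₂ hg₁ hg₂ e
    have e' : f₁.hom ≫ X.map g₁ = f₂.hom ≫ X.map g₂ := congr_arg El.Hom.hom e
    have hP := (GSet.isPullback g₁ g₂).map X
    let p : W.base ⟶ X.obj (pullbackObj g₁ g₂) := hP.lift _ _ e'
    have h₁ : p ≫ X.map (pullbackFst g₁ g₂) = f₁.hom := hP.lift_fst _ _ e'
    have h₂ : p ≫ X.map (pullbackSnd g₁ g₂) = f₂.hom := hP.lift_snd _ _ e'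
    let q : W ⟶ (liftColim X).obj (pullbackObj g₁ g₂) := homLiftColim p <| by
      rw [← colimMk_hom f₁, ← h₁, colimMk_comp_map]
    have q₁ : f₁ = q ≫ (liftColim X).map (pullbackFst g₁ g₂) := El.hom_ext h₁.symm
    have q₂ : f₂ = q ≫ (liftColim X).map (pullbackSnd g₁ g₂) := El.hom_ext h₂.symm
    have key := hx (pullbackFst g₁ g₂) (pullbackSnd g₁ g₂) hg₁ hg₂ (GSet.isPullback g₁ g₂).w
    rw [q₁, q₂, op_comp, op_comp, Functor.map_comp_apply, Functor.map_comp_apply]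
    exact congrArg (ℱ.obj.map q.op) key
  · rw [El.mem_topology_iff]
    refine J.superset_covering ?_ (hX.coverPreserving.cover_preserve hA)
    rintro V φ ⟨T, f, h, hf, rfl⟩
    refine ⟨T, f, ⟨h, ?_⟩, hf, El.hom_ext rfl⟩
    change colimMk X (h ≫ 𝟙 _) = colimMk X ((h ≫ X.map f) ≫ 𝟙 _)
    rw [Category.comp_id, Category.comp_id, colimMk_comp_map]

lemma IsSObject.isDetermined (hX : IsSObject J X) (F : Sh R J X) :
    IsDetermined ((toPresheaf J R X).obj F) :=
  have := hX.isContinuous_liftColim J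
  isDetermined_of_isSheaf _ (Functor.op_comp_isSheaf (liftColim X) (GSet.topology 𝒦)
    (El.topology J (colimPresheaf X)) F)

end SmoothAdjunction

/-! ### Derived functors of representable functors. -/

section DerivedRepresentable

universe v

variable {R : Type (u + 1)} [CommRing R] {B : Type v} [Category.{u + 1} B] [Abelian B] [Linear R B]
  [HasExt.{u + 1} B] [EnoughInjectives B] (A : B) {H : B ⥤ ModuleCat.{u + 1} R} [H.Additive]
  (e : (linearCoyoneda R B).obj (op A) ≅ H) (n : ℕ)

/-- The right derived functors of a representable functor are Ext modules. -/
def rightDerivedEquivOfIso (F : B) : (H.rightDerived n).obj F ≃ₗ[R] Abelian.Ext A F n :=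
  ((rightDerivedIso e n).symm.app F).toLinearEquiv.trans (rightDerivedCoyonedaEquiv A F n)

lemma rightDerivedEquivOfIso_naturality {F F' : B} (φ : F ⟶ F') (x : (H.rightDerived n).obj F) :
    rightDerivedEquivOfIso A e n F' (((H.rightDerived n).map φ).hom x) =
      (rightDerivedEquivOfIso A e n F x).comp (Abelian.Ext.mk₀ φ) (add_zero n) := by
  have h := (rightDerivedIso e n).inv.naturality φ
  have h₁ : ((rightDerivedIso e n).inv.app F').hom (((H.rightDerived n).map φ).hom x) =
      ((((linearCoyoneda R B).obj (op A)).rightDerived n).map φ).hom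
        (((rightDerivedIso e n).inv.app F).hom x) := congr($(h).hom x)
  exact (congrArg (rightDerivedCoyonedaEquiv (R := R) A F' n) h₁).trans
    (rightDerivedCoyonedaEquiv_naturality (R := R) A φ n _)

end DerivedRepresentable

/-! ### The representing sheaf `M_{X, G}` and the covering spectral sequence. -/

section InverseImage

open GSet

variable {G : Type u} [Group G] [TopologicalSpace G] [IsTopologicalGroup G] {𝒦 : SubgroupFamily G}
variable {R : Type (u + 1)} [CommRing R]
variable {C : Type (u + 1)} [Category.{u} C] (J : GrothendieckTopology C) (X : GSet 𝒦 ⥤ C)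

variable (R) in
/-- The left adjoint of the restriction of sheaves on `C/colim X` to presheaves on `𝒮`. -/
def fromPresheaf : ((GSet 𝒦)ᵒᵖ ⥤ ModuleCat.{u + 1} R) ⥤ Sh R J X :=
  (liftColim X).op.lan ⋙ presheafToSheaf (El.topology J (colimPresheaf X)) (ModuleCat.{u + 1} R)

variable (R) in
/-- The adjunction between presheaves on `𝒮` and sheaves on `C/colim X`. -/
def fromPresheafAdjunction : fromPresheaf R J X ⊣ toPresheaf J R X :=
  ((liftColim X).op.lanAdjunction (ModuleCat.{u + 1} R)).comp
    (sheafificationAdjunction (El.topology J (colimPresheaf X)) (ModuleCat.{u + 1} R))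

instance : (toPresheaf J R X).Linear R where
  map_smul _ _ := rfl

instance : (HZeroInf J R X).Linear R := by
  unfold HZeroInf
  infer_instance

/-- The universal morphism from `M` to `H⁰(X_∞, M_{X, G})`. -/
def toHZeroInf (M : SmoothRep R G) : M ⟶ (HZeroInf J R X).obj (inverseImage J X M) :=
  (limMapsIso 𝒦 M).inv ≫ (limFunctor 𝒦 R).map
    ((fromPresheafAdjunction R J X).unit.app (mapsPresheaf 𝒦 M))

/-- The morphism `M_{X, G} ⟶ M'_{X, G}` induced by a morphism of representations. -/
def inverseImageMap {M M' : SmoothRep R G} (f : M ⟶ M') :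
    inverseImage J X M ⟶ inverseImage J X M' :=
  (fromPresheaf R J X).map (mapsPresheafMap 𝒦 f)

lemma toHZeroInf_naturality {M M' : SmoothRep R G} (f : M ⟶ M') :
    f ≫ toHZeroInf J X M' = toHZeroInf J X M ≫
      (HZeroInf J R X).map (inverseImageMap J X f) := by
  have h₁ := (fromPresheafAdjunction R J X).unit.naturality (mapsPresheafMap 𝒦 f)
  have h₂ := congrArg (limFunctor 𝒦 R).map h₁
  rw [Functor.map_comp, Functor.map_comp] at h₂
  have h₃ : f ≫ (limMapsIso 𝒦 M').inv =
      (limMapsIso 𝒦 M).inv ≫ (limFunctor 𝒦 R).map (mapsPresheafMap 𝒦 f) := by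
    rw [Iso.eq_inv_comp, ← Category.assoc, Iso.comp_inv_eq, limMapsIso_naturality]
  refine (Category.assoc _ _ _).symm.trans ?_
  rw [h₃]
  refine (Category.assoc _ _ _).trans (Eq.trans ?_ (Category.assoc _ _ _).symm)
  exact congrArg ((limMapsIso 𝒦 M).inv ≫ ·) h₂

variable {X}

/-- This is the universal property of `toHZeroInf`: the adjunction bijection followed by the
bijection for the determined restriction of `F` to `𝒮`. -/
lemma IsSObject.bijective_toHZeroInf_comp (hX : IsSObject J X) (M : SmoothRep R G) (F : Sh R J X) :
    Function.Bijective fun f : inverseImage J X M ⟶ F ↦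
      toHZeroInf J X M ≫ (HZeroInf J R X).map f := by
  have h := ((hX.isDetermined J F).limFunctor_map_bijective M).comp
    ((fromPresheafAdjunction R J X).homEquiv (mapsPresheaf 𝒦 M) F).bijective
  have e : (fun f : inverseImage J X M ⟶ F ↦ toHZeroInf J X M ≫ (HZeroInf J R X).map f) =
      (fun φ ↦ (limMapsIso 𝒦 M).inv ≫ (limFunctor 𝒦 R).map φ) ∘
        (fromPresheafAdjunction R J X).homEquiv (mapsPresheaf 𝒦 M) F := funext fun f ↦ ?_
  · rw [e]
    exact h
  refine (Category.assoc _ _ _).trans (congrArg ((limMapsIso 𝒦 M).inv ≫ ·) ?_)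
  exact ((limFunctor 𝒦 R).map_comp _ _).symm

/-- `H⁰_R(X; M, ·)` is represented by the inverse image of `M`. -/
def IsSObject.hZeroIso (hX : IsSObject J X) (M : SmoothRep R G) :
    (linearCoyoneda R (Sh R J X)).obj (op (inverseImage J X M)) ≅ HZero J X M :=
  NatIso.ofComponents (fun F ↦ (LinearEquiv.ofBijective
      ({ toFun := fun f : inverseImage J X M ⟶ F ↦ toHZeroInf J X M ≫ (HZeroInf J R X).map f
         map_add' := fun f g ↦ by rw [Functor.map_add, Preadditive.comp_add]
         map_smul' := fun r f ↦ by rw [Functor.map_smul, Linear.comp_smul]; rfl } :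
        (inverseImage J X M ⟶ F) →ₗ[R] (M ⟶ (HZeroInf J R X).obj F))
      (hX.bijective_toHZeroInf_comp J M F)).toModuleIso)
    fun {F F'} φ ↦ ModuleCat.hom_ext (LinearMap.ext fun f : inverseImage J X M ⟶ F ↦ by
      change toHZeroInf J X M ≫ (HZeroInf J R X).map (f ≫ φ) =
        (toHZeroInf J X M ≫ (HZeroInf J R X).map f) ≫ (HZeroInf J R X).map φ
      rw [Functor.map_comp, Category.assoc])

/-- The right derived functors of `H⁰_R(X; M, ·)` are Ext modules. -/
def IsSObject.hREquiv (hX : IsSObject J X) (M : SmoothRep R G) (n : ℕ) (F : Sh R J X) :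
    (HR J X M n).obj F ≃ₗ[R] Abelian.Ext (inverseImage J X M) F n :=
  rightDerivedEquivOfIso (inverseImage J X M) (hX.hZeroIso J M) n F

set_option maxHeartbeats 2000000 in
lemma IsSObject.hREquiv_naturality (hX : IsSObject J X) (M : SmoothRep R G) (n : ℕ)
    (F F' : Sh R J X) (φ : F ⟶ F') (x : (HR J X M n).obj F) :
    hX.hREquiv J M n F' (((HR J X M n).map φ).hom x) =
      (hX.hREquiv J M n F x).comp (Abelian.Ext.mk₀ φ) (add_zero n) := by
  have h₁ : hX.hREquiv J M n F' (((HR J X M n).map φ).hom x) =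
      rightDerivedEquivOfIso (inverseImage J X M) (hX.hZeroIso J M) n F'
        ((((HZero J X M).rightDerived n).map φ).hom x) := rfl
  refine h₁.trans ?_
  apply rightDerivedEquivOfIso_naturality

section Exact

/-- Equality in the colimit is the equivalence relation generated by transition maps. Being
dominated by a common span already is an equivalence relation: fibre products in `𝒮`, preserved by
`X`, compose two spans. -/
lemma exists_span_of_colimMk_eq (hX : PreservesLimitsOfShape WalkingCospan X) {U : C}
    {S T : GSet 𝒦} (a : U ⟶ X.obj S) (b : U ⟶ X.obj T) (h : colimMk X a = colimMk X b) :
    ∃ (W : GSet 𝒦) (c : U ⟶ X.obj W) (f : W ⟶ S) (g : W ⟶ T),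
      c ≫ X.map f = a ∧ c ≫ X.map g = b := by
  have h' := Quot.eqvGen_exact h
  have key (p q : Σ S, U ⟶ X.obj S) (hpq : Relation.EqvGen
      ((X ⋙ coyoneda.obj (op U)).ColimitTypeRel) p q) :
      ∃ (W : GSet 𝒦) (c : U ⟶ X.obj W) (f : W ⟶ p.1) (g : W ⟶ q.1),
        c ≫ X.map f = p.2 ∧ c ≫ X.map g = q.2 := by
    induction hpq with
    | rel p q h =>
      obtain ⟨f, hf⟩ := h
      exact ⟨p.1, p.2, 𝟙 _, f, by simp, hf.symm⟩
    | refl p => exact ⟨p.1, p.2, 𝟙 _, 𝟙 _, by simp, by simp⟩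
    | symm p q _ ih =>
      obtain ⟨W, c, f, g, h₁, h₂⟩ := ih
      exact ⟨W, c, g, f, h₂, h₁⟩
    | trans p q r _ _ ih ih' =>
      obtain ⟨W, c, f, g, h₁, h₂⟩ := ih
      obtain ⟨W', c', f', g', h₁', h₂'⟩ := ih'
      have hP := (GSet.isPullback g f').map X
      refine ⟨_, hP.lift c c' (h₂.trans h₁'.symm), pullbackFst g f' ≫ f, pullbackSnd g f' ≫ g',
        ?_, ?_⟩
      · rw [X.map_comp, ← Category.assoc, hP.lift_fst, h₁]
      · rw [X.map_comp, ← Category.assoc, hP.lift_snd, h₂']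
  exact key ⟨S, a⟩ ⟨T, b⟩ h'

lemma exists_colimMk_eq {U : C} (α : (colimPresheaf X).obj (op U)) :
    ∃ (S : GSet 𝒦) (a : U ⟶ X.obj S), colimMk X a = α := by
  obtain ⟨⟨S, a⟩, rfl⟩ := Quot.exists_rep α
  exact ⟨S, a, rfl⟩

lemma exists_comp_equalizerι (hX : IsExact X) {S T : GSet 𝒦} (f g : S ⟶ T) {U : C}
    (a : U ⟶ X.obj S) (h : a ≫ X.map f = a ≫ X.map g) :
    ∃ b : U ⟶ X.obj (equalizerObj f g), b ≫ X.map (equalizerι f g) = a := by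
  have : PreservesLimitsOfShape WalkingParallelPair X := hX
  have hl := isLimitForkMapOfIsLimit X _ (isLimitEqualizer f g)
  exact ⟨Fork.IsLimit.lift hl a h, Fork.IsLimit.lift_ι hl⟩

/-- Two objects are dominated by a span because they define the same class. Parallel arrows are
equalized over the equalizer in `𝒮`; this is where preservation of equalizers is needed. -/
lemma isCofiltered_structuredArrow_liftColim (hX : PreservesLimitsOfShape WalkingCospan X)
    (hX' : IsExact X) (U : OverColim X) : IsCofiltered (StructuredArrow U (liftColim X)) where
  nonempty := by
    obtain ⟨S, a, ha⟩ := exists_colimMk_eq U.sec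
    exact ⟨StructuredArrow.mk (homLiftColim a ha)⟩
  cone_objs a b := by
    have ha := colimMk_hom a.hom
    have hb := colimMk_hom b.hom
    obtain ⟨W, c, f, g, h₁, h₂⟩ := exists_span_of_colimMk_eq hX _ _ (ha.trans hb.symm)
    refine ⟨StructuredArrow.mk (homLiftColim c ?_), StructuredArrow.homMk f (El.hom_ext h₁),
      StructuredArrow.homMk g (El.hom_ext h₂), trivial⟩
    rw [← ha, ← h₁, colimMk_comp_map]
  cone_maps a b f g := by
    let a' : U.base ⟶ X.obj a.right := a.hom.hom
    have hf : a' ≫ X.map f.right = b.hom.hom :=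
      congrArg El.Hom.hom (StructuredArrow.w f)
    have hg : a' ≫ X.map g.right = b.hom.hom :=
      congrArg El.Hom.hom (StructuredArrow.w g)
    obtain ⟨c, hc⟩ := exists_comp_equalizerι hX' f.right g.right a' (hf.trans hg.symm)
    refine ⟨StructuredArrow.mk (homLiftColim c ?_),
      StructuredArrow.homMk (equalizerι f.right g.right) (El.hom_ext hc), ?_⟩
    · refine Eq.trans ?_ (colimMk_hom a.hom)
      change _ = colimMk X a'
      rw [← hc, colimMk_comp_map]
    · exact StructuredArrow.hom_ext _ _ (equalizer_condition f.right g.right)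

/-- Filtered colimits of modules are exact, so a monomorphism of representations stays mono on
inverse images. The universal property turns an extension problem for `H⁰(X_∞, F)` into one for the
injective sheaf `F`. -/
lemma IsSObject.preservesInjectiveObjects_hZeroInf (hX : IsSObject J X) (hX' : IsExact X) :
    (HZeroInf J R X).PreservesInjectiveObjects where
  injective_obj {F} hF := by
    have := preservesMonomorphisms_lan R (liftColim X) fun U ↦ by
      have := isCofiltered_structuredArrow_liftColim hX.preservesPullbacks hX' U.unop
      have : IsFiltered (CostructuredArrow (liftColim X).op U) :=
        IsFiltered.of_equivalence (structuredArrowOpEquivalence (liftColim X) U.unop)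
      exact preservesMonomorphisms_colim_of_isFiltered R _
    refine ⟨fun {M M'} g ι hι ↦ ?_⟩
    have : Mono (inverseImageMap J X ι) := by
      have (S : (GSet 𝒦)ᵒᵖ) : Mono ((mapsPresheafMap 𝒦 ι).app S) := by
        refine (ModuleCat.mono_iff_injective _).2 fun φ ψ h ↦ ?_
        refine Subtype.ext (funext fun s ↦ ?_)
        have hι' : Mono ι.hom := by
          have := (isSmooth R G).preservesMonomorphisms_ι_of_isNormalEpiCategory
          exact inferInstanceAs (Mono ((isSmooth R G).ι.map ι))
        exact (Rep.mono_iff_injective ι.hom).1 hι' (congr_fun (congr_arg Subtype.val h) s)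
      have : Mono (mapsPresheafMap 𝒦 ι) := NatTrans.mono_of_mono_app _
      have : (presheafToSheaf (El.topology J (colimPresheaf X))
        (ModuleCat.{u + 1} R)).PreservesMonomorphisms := inferInstance
      exact inferInstanceAs (Mono ((presheafToSheaf _ _).map ((liftColim X).op.lan.map
        (mapsPresheafMap 𝒦 ι))))
    obtain ⟨f, rfl⟩ := (hX.bijective_toHZeroInf_comp J M F).surjective g
    let f' : inverseImage J X M' ⟶ F :=
      Injective.factorThru f (inverseImageMap J X ι)
    have hf' : inverseImageMap J X ι ≫ f' = f :=
      Injective.comp_factorThru _ _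
    refine ⟨toHZeroInf J X M' ≫ (HZeroInf J R X).map f', ?_⟩
    refine (Category.assoc _ _ _).symm.trans ?_
    rw [toHZeroInf_naturality]
    refine (Category.assoc _ _ _).trans ?_
    refine congrArg (toHZeroInf J X M ≫ ·) ?_
    exact ((HZeroInf J R X).map_comp _ _).symm.trans (congrArg _ hf')

/-- The covering spectral sequence. -/
lemma IsSObject.hasSpectralSequence_hInf (hX : IsSObject J X) (hX' : IsExact X) (M : SmoothRep R G)
    (F : Sh R J X) :
    HasSpectralSequence (fun r s ↦ ModuleCat.of R (Abelian.Ext M ((HInf J R X s).obj F) r))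
      (fun n ↦ (HR J X M n).obj F) :=
  have := hX.preservesInjectiveObjects_hZeroInf (R := R) J hX'
  hasSpectralSequence_comp (HZeroInf J R X) M F

end Exact

end InverseImage

/-! ### Frobenius reciprocity for compact induction from an open subgroup. -/

section Frobenius

variable {R : Type (u + 1)} [CommRing R] {G : Type u} [Group G] [TopologicalSpace G]
  [IsTopologicalGroup G] (K : Subgroup G)

variable (R) in
/-- The restriction of smooth representations to a subgroup. -/
def restrictRep : SmoothRep R G ⥤ SmoothRep R K where
  obj V := ⟨Rep.of (V.obj.ρ.comp K.subtype), fun v ↦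
    (V.property v).preimage continuous_subtype_val⟩
  map f := ObjectProperty.homMk (Rep.ofHom
    { toLinearMap := f.hom.hom.toLinearMap
      isIntertwining' := fun k ↦ f.hom.hom.isIntertwining' (k : G) })

variable {K} (hK : IsOpen (K : Set G)) (M : SmoothRep R K) {V V' : SmoothRep R G}

/-- The function with support in `K` and value `m` at `1`. -/
def cIndSingle : M.obj.V →ₗ[R] cIndModule K M where
  toFun m := ⟨open Classical in fun g ↦ if h : g ∈ K then M.obj.ρ ⟨g, h⟩ m else 0, by
    refine ⟨fun k g ↦ ?_, ?_, {1}, isCompact_singleton, fun g hg ↦ ?_⟩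
    · beta_reduce
      by_cases h : g ∈ K
      · rw [dif_pos h, dif_pos (mul_mem k.2 h), ← Module.End.mul_apply, ← map_mul]
        rfl
      · rw [dif_neg h, dif_neg ((K.mul_mem_cancel_left k.2).not.2 h), map_zero]
    -- The function is right invariant under the stabilizer of `m` in `K`, which is open in `G`
    -- because `K` is.
    · let U : Subgroup G := Subgroup.map K.subtype
        { carrier := {g | M.obj.ρ g m = m}
          one_mem' := by simp
          mul_mem' := fun {a b} (ha : _ = _) (hb : _ = _) ↦ by
            change M.obj.ρ (a * b) m = m
            rw [map_mul, Module.End.mul_apply, hb, ha]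
          inv_mem' := fun {a} (ha : _ = _) ↦ by
            change M.obj.ρ a⁻¹ m = m
            conv_lhs => rw [← ha]
            rw [← Module.End.mul_apply, ← map_mul]
            simp }
      refine ⟨U, hK.isOpenMap_subtype_val _ (M.property m), ?_⟩
      rintro g _ ⟨u, hu, rfl⟩
      have hu' : M.obj.ρ u m = m := hu
      rw [Subgroup.coe_subtype]
      beta_reduce
      by_cases h : g ∈ K
      · rw [dif_pos h, dif_pos (mul_mem h u.2)]
        conv_rhs => rw [← hu']
        rw [← Module.End.mul_apply, ← map_mul]
        rfl
      · rw [dif_neg h, dif_neg ((K.mul_mem_cancel_right u.2).not.2 h)]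
    · by_cases h : g ∈ K
      · exact ⟨⟨g, h⟩, 1, rfl, (mul_one g).symm⟩
      · exact absurd (dif_neg h) hg⟩
  map_add' m m' := by
    classical
    refine Subtype.ext (funext fun g ↦ ?_)
    by_cases h : g ∈ K
    · simp [dif_pos h]
    · simp [dif_neg h]
  map_smul' r m := by
    classical
    refine Subtype.ext (funext fun g ↦ ?_)
    by_cases h : g ∈ K
    · simp [dif_pos h]
    · simp [dif_neg h]

lemma cIndSingle_of_mem (m : M.obj.V) (k : K) :
    (cIndSingle hK M m).1 k = M.obj.ρ k m := dif_pos k.2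

lemma cIndSingle_of_notMem (m : M.obj.V) {g : G} (hg : g ∉ K) :
    (cIndSingle hK M m).1 g = 0 := dif_neg hg

lemma cIndSingle_ρ (k : K) (m : M.obj.V) :
    cIndSingle hK M (M.obj.ρ k m) = cIndRho K M k (cIndSingle hK M m) := by
  refine Subtype.ext (funext fun g ↦ ?_)
  change _ = (cIndSingle hK M m).1 (g * k)
  by_cases h : g ∈ K
  · refine (cIndSingle_of_mem hK M _ ⟨g, h⟩).trans ?_
    refine Eq.trans ?_ (cIndSingle_of_mem hK M _ (⟨g, h⟩ * k)).symm
    rw [map_mul]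
    rfl
  · rw [cIndSingle_of_notMem hK M _ h, cIndSingle_of_notMem hK M _
      ((K.mul_mem_cancel_right k.2).not.2 h)]

variable {M}

-- Right cosets of the open subgroup `K` are open, so finitely many of them cover a compact set that
-- meets every coset in the support. This makes the sum in `cIndLift` finite.
include hK in
lemma finite_cosets (Φ : cIndModule K M) :
    {q : Quotient (QuotientGroup.rightRel K) | ∃ x, Quotient.mk _ x = q ∧ Φ.1 x ≠ 0}.Finite := by
  obtain ⟨Z, hZ, h⟩ := Φ.2.2.2
  obtain ⟨t, ht, htZ⟩ := hZ.elim_nhds_subcover (fun z ↦ (· * z⁻¹) ⁻¹' (K : Set G)) fun z _ ↦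
    (hK.preimage (by fun_prop)).mem_nhds (by simp)
  refine (t.finite_toSet.image (Quotient.mk (QuotientGroup.rightRel K))).subset ?_
  rintro _ ⟨x, rfl, hx⟩
  obtain ⟨k, z, hz, rfl⟩ := h x hx
  obtain ⟨y, hy, hyz⟩ := Set.mem_iUnion₂.1 (htZ hz)
  refine ⟨y, hy, Quotient.sound (QuotientGroup.rightRel_apply.2 ?_)⟩
  have : (k : G) * (z * y⁻¹) ∈ K := mul_mem k.2 hyz
  simpa [mul_assoc] using this

variable (h : M.obj.V →ₗ[R] V.obj.V)
  (hh : ∀ (k : K) (m : M.obj.V), h (M.obj.ρ k m) = V.obj.ρ k (h m))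

/-- The contribution of a coset to the morphism which corresponds to a `K`-linear map `h`. -/
def cIndTerm (Φ : cIndModule K M) : Quotient (QuotientGroup.rightRel K) → V.obj.V :=
  Quotient.lift (fun x ↦ V.obj.ρ x⁻¹ (h (Φ.1 x))) fun x y hxy ↦ by
    have hk : y * x⁻¹ ∈ K := QuotientGroup.rightRel_apply.1 hxy
    have e : y = (⟨y * x⁻¹, hk⟩ : K) * x := by simp
    have e' : h (Φ.1 y) = V.obj.ρ (y * x⁻¹) (h (Φ.1 x)) := by
      conv_lhs => rw [e, Φ.2.1]
      exact hh _ _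
    change V.obj.ρ x⁻¹ (h (Φ.1 x)) = V.obj.ρ y⁻¹ (h (Φ.1 y))
    rw [e', ← Module.End.mul_apply, ← map_mul, inv_mul_cancel_left]

include hK in
lemma finite_support_cIndTerm (Φ : cIndModule K M) :
    (Function.support (cIndTerm h hh Φ)).Finite := by
  refine (finite_cosets hK Φ).subset ?_
  rintro ⟨x⟩ hx
  refine ⟨x, rfl, fun h0 ↦ hx ?_⟩
  change V.obj.ρ x⁻¹ (h (Φ.1 x)) = 0
  rw [h0, map_zero, map_zero]

/-- The linear map which corresponds to a `K`-linear map `h`. -/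
def cIndLift : cIndModule K M →ₗ[R] V.obj.V where
  toFun Φ := ∑ᶠ q, cIndTerm h hh Φ q
  map_add' Φ Ψ := by
    rw [← finsum_add_distrib (finite_support_cIndTerm hK h hh Φ)
      (finite_support_cIndTerm hK h hh Ψ)]
    refine finsum_congr ?_
    rintro ⟨x⟩
    change V.obj.ρ x⁻¹ (h (Φ.1 x + Ψ.1 x)) = _
    rw [map_add, map_add]
    rfl
  map_smul' r Φ := by
    rw [RingHom.id_apply, smul_finsum' r (finite_support_cIndTerm hK h hh Φ)]
    refine finsum_congr ?_
    rintro ⟨x⟩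
    change V.obj.ρ x⁻¹ (h (r • Φ.1 x)) = _
    rw [map_smul, map_smul]
    rfl

/-- Right translation on the set of right cosets. -/
def cosetEquiv (g : G) :
    Quotient (QuotientGroup.rightRel K) ≃ Quotient (QuotientGroup.rightRel K) where
  toFun := Quotient.map (· * g) fun x y h ↦ QuotientGroup.rightRel_apply.2 <| by
    simpa [mul_assoc] using QuotientGroup.rightRel_apply.1 h
  invFun := Quotient.map (· * g⁻¹) fun x y h ↦ QuotientGroup.rightRel_apply.2 <| by
    simpa [mul_assoc] using QuotientGroup.rightRel_apply.1 h
  left_inv := by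
    rintro ⟨x⟩
    exact congrArg (Quotient.mk _) (mul_inv_cancel_right x g)
  right_inv := by
    rintro ⟨x⟩
    exact congrArg (Quotient.mk _) (inv_mul_cancel_right x g)

/-- Right translation by `g` permutes the right cosets; reindexing the sum by `cosetEquiv` brings
out the factor `V.obj.ρ g`. -/
lemma cIndLift_equivariant (g : G) (Φ : cIndModule K M) :
    cIndLift hK h hh (cIndRho K M g Φ) = V.obj.ρ g (cIndLift hK h hh Φ) := by
  change ∑ᶠ q, cIndTerm h hh (cIndRho K M g Φ) q = V.obj.ρ g (∑ᶠ q, cIndTerm h hh Φ q)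
  refine Eq.trans ?_
    ((V.obj.ρ g).toAddMonoidHom.map_finsum (finite_support_cIndTerm hK h hh Φ)).symm
  refine Eq.trans ?_ (finsum_comp_equiv (cosetEquiv g))
  refine finsum_congr ?_
  rintro ⟨x⟩
  change V.obj.ρ x⁻¹ (h (Φ.1 (x * g))) = V.obj.ρ g (V.obj.ρ (x * g)⁻¹ (h (Φ.1 (x * g))))
  rw [← Module.End.mul_apply, ← map_mul]
  simp

lemma cIndLift_single (m : M.obj.V) : cIndLift hK h hh (cIndSingle hK M m) = h m := by
  refine (finsum_eq_single _ (Quotient.mk _ 1) ?_).trans ?_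
  · rintro ⟨x⟩ hx
    have hx' : x ∉ K := fun hx' ↦ hx <| Quotient.sound <| QuotientGroup.rightRel_apply.2 <| by
      simpa using hx'
    change V.obj.ρ x⁻¹ (h ((cIndSingle hK M m).1 x)) = 0
    rw [cIndSingle_of_notMem hK M m hx', map_zero, map_zero]
  · change V.obj.ρ 1⁻¹ (h ((cIndSingle hK M m).1 (1 : K))) = _
    rw [cIndSingle_of_mem]
    simp

/-- The summand of a coset `q` is the restriction of `Φ` to `q`: a translate of a function supported
on `K`. So the functions `cIndSingle` generate the compact induction, and a `G`-map is determined by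
them. -/
lemma eq_finsum_single (Φ : cIndModule K M) (q₀ : Quotient (QuotientGroup.rightRel K) → G)
    (hq₀ : ∀ q, Quotient.mk _ (q₀ q) = q) :
    Φ = ∑ᶠ q, cIndRho K M (q₀ q)⁻¹ (cIndSingle hK M (Φ.1 (q₀ q))) := by
  have hfin : (Function.support fun q ↦
      cIndRho K M (q₀ q)⁻¹ (cIndSingle hK M (Φ.1 (q₀ q)))).Finite := by
    refine (finite_cosets hK Φ).subset fun q hq ↦ ⟨q₀ q, hq₀ q, fun h0 ↦ hq ?_⟩
    change cIndRho K M (q₀ q)⁻¹ (cIndSingle hK M (Φ.1 (q₀ q))) = 0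
    rw [h0, map_zero, map_zero]
  refine Subtype.ext (funext fun x ↦ ?_)
  let ev : cIndModule K M →ₗ[R] M.obj.V := LinearMap.proj x ∘ₗ (cIndModule K M).subtype
  refine Eq.trans ?_ (ev.toAddMonoidHom.map_finsum hfin).symm
  symm
  refine (finsum_eq_single _ (Quotient.mk _ x) fun q hq ↦ ?_).trans ?_
  · refine cIndSingle_of_notMem hK M _ fun h ↦ hq ?_
    exact (hq₀ q).symm.trans (Quotient.sound (QuotientGroup.rightRel_apply.2 h))
  · have hk : x * (q₀ (Quotient.mk _ x))⁻¹ ∈ K :=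
      QuotientGroup.rightRel_apply.1 (Quotient.exact (hq₀ (Quotient.mk _ x)))
    refine (cIndSingle_of_mem hK M _ ⟨_, hk⟩).trans ?_
    rw [← Φ.2.1]
    exact congrArg Φ.1 (inv_mul_cancel_right _ _)

lemma cIndRestrict_apply_ρ (f : cInd K M ⟶ V) (k : K) (m : M.obj.V) :
    f.hom.hom (cIndSingle hK M (M.obj.ρ k m)) = V.obj.ρ k (f.hom.hom (cIndSingle hK M m)) := by
  rw [cIndSingle_ρ]
  exact Rep.hom_comm_apply f.hom (k : G) (cIndSingle hK M m)

lemma cIndLift_restrict (f : cInd K M ⟶ V) (Φ : cIndModule K M) :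
    cIndLift hK (f.hom.hom.toLinearMap ∘ₗ cIndSingle hK M) (cIndRestrict_apply_ρ hK f) Φ =
      f.hom.hom Φ := by
  have hfin : (Function.support fun q : Quotient (QuotientGroup.rightRel K) ↦
      cIndRho K M q.out⁻¹ (cIndSingle hK M (Φ.1 q.out))).Finite := by
    refine (finite_cosets hK Φ).subset fun q hq ↦ ⟨q.out, Quotient.out_eq q, fun h0 ↦ hq ?_⟩
    change cIndRho K M q.out⁻¹ (cIndSingle hK M (Φ.1 q.out)) = 0
    rw [h0, map_zero, map_zero]
  have h := congrArg f.hom.hom.toLinearMap (eq_finsum_single hK Φ Quotient.out Quotient.out_eq)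
  refine Eq.trans ?_ (h.trans (f.hom.hom.toLinearMap.toAddMonoidHom.map_finsum hfin)).symm
  refine finsum_congr fun q ↦ ?_
  conv_lhs => rw [← Quotient.out_eq q]
  exact (Rep.hom_comm_apply f.hom q.out⁻¹ (cIndSingle hK M (Φ.1 q.out))).symm

variable (M V) in
/-- Frobenius reciprocity for compact induction from an open subgroup. -/
def frobeniusEquiv : (cInd K M ⟶ V) ≃ₗ[R] (M ⟶ (restrictRep R K).obj V) where
  toFun f := ObjectProperty.homMk (Rep.ofHom
    { toLinearMap := f.hom.hom.toLinearMap ∘ₗ cIndSingle hK M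
      isIntertwining' := fun k ↦ LinearMap.ext fun m ↦ cIndRestrict_apply_ρ hK f k m })
  map_add' _ _ := rfl
  map_smul' _ _ := rfl
  invFun h := ObjectProperty.homMk (Rep.ofHom
    { toLinearMap := cIndLift hK (show M.obj.V →ₗ[R] V.obj.V from h.hom.hom.toLinearMap)
        fun k m ↦ Rep.hom_comm_apply h.hom k m
      isIntertwining' := fun g ↦ LinearMap.ext fun Φ ↦ cIndLift_equivariant hK _ _ g Φ })
  left_inv f := by
    ext Φ
    exact cIndLift_restrict hK f Φ
  right_inv h := by
    ext m
    exact cIndLift_single hK _ _ m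

variable (M) in
/-- Frobenius reciprocity as an isomorphism of functors. -/
def frobeniusIso : (linearCoyoneda R (SmoothRep R G)).obj (op (cInd K M)) ≅
    restrictRep R K ⋙ (linearCoyoneda R (SmoothRep R K)).obj (op M) :=
  NatIso.ofComponents (fun V ↦ (frobeniusEquiv hK M V).toModuleIso) fun _ ↦ rfl

end Frobenius

/-! ### The colimit after restriction to `K`-sets. -/

section LimInduced

open GSet

variable {G : Type u} [Group G] [TopologicalSpace G] [IsTopologicalGroup G] {𝒦 : SubgroupFamily G}
variable {R : Type (u + 1)} [CommRing R] (K : 𝒦.carrier)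

/-- The class of `(g, s)` in `G ×_K S`. -/
def inducedMk (S : GSet (SubgroupFamily.all K.1)) (g : G) (s : S.carrier) :
    ((inducedFunctor K).obj S).carrier :=
  Quotient.mk (inducedSetoid K S) (g, s)

lemma inducedMk_mul (S : GSet (SubgroupFamily.all K.1)) (g : G) (k : K.1) (s : S.carrier) :
    inducedMk K S (g * k) s = inducedMk K S g (k • s) :=
  (Quotient.sound (s := inducedSetoid K S) ⟨k, by simp⟩).symm

lemma inducedMk_mul_one (L : (SubgroupFamily.all K.1).carrier) (g : G) (k : K.1) :
    inducedMk K (quot L) (g * k) ((1 : K.1) : K.1 ⧸ L.1) =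
      inducedMk K (quot L) g ((k : K.1) : K.1 ⧸ L.1) :=
  (inducedMk_mul K (quot L) g k _).trans (congrArg (inducedMk K (quot L) g)
    (congrArg (fun k : K.1 ↦ (k : K.1 ⧸ L.1)) (mul_one k)))

/-- The base point of `G ×_K (K ⧸ L)`. -/
def inducedPt (L : (SubgroupFamily.all K.1).carrier) :
    ((inducedFunctor K).obj (quot L)).carrier :=
  inducedMk K (quot L) 1 ((1 : K.1) : K.1 ⧸ L.1)

/-- The map `G ×_K (K ⧸ L) ⟶ G ⧸ K'` for a subgroup `L` of `K'`. -/
def inducedToQuot (L : (SubgroupFamily.all K.1).carrier) (K' : 𝒦.carrier)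
    (h : ∀ k ∈ L.1, (k : G) ∈ K'.1) : (inducedFunctor K).obj (quot L) ⟶ quot K' where
  toFun := Quotient.lift (s := inducedSetoid K (quot L))
    (fun p : G × (K.1 ⧸ L.1) ↦ p.1 • Quotient.liftOn' p.2 (fun k ↦ ((k : G) : G ⧸ K'.1))
      fun a b hab ↦ QuotientGroup.eq.2 (h _ (QuotientGroup.leftRel_apply.1 hab))) (by
      rintro ⟨g, ⟨x⟩⟩ _ ⟨k, rfl⟩
      change ((g * (x : G) : G) : G ⧸ K'.1) = ((g * k * ((k⁻¹ * x : K.1) : G) : G) : G ⧸ K'.1)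
      simp [mul_assoc])
  map_smul := by
    rintro g ⟨⟨g', ⟨x⟩⟩⟩
    change ((g * g' * (x : G) : G) : G ⧸ K'.1) = ((g * (g' * (x : G)) : G) : G ⧸ K'.1)
    rw [mul_assoc]

lemma inducedToQuot_pt (L : (SubgroupFamily.all K.1).carrier) (K' : 𝒦.carrier)
    (h : ∀ k ∈ L.1, (k : G) ∈ K'.1) :
    (inducedToQuot K L K' h).toFun (inducedPt K L) = ((1 : G) : G ⧸ K'.1) := by
  change ((1 * ((1 : K.1) : G) : G) : G ⧸ K'.1) = _
  simp

/-- The intersection of an element of the family with `K`, as a subgroup of `K`. -/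
def comapAll (K' : 𝒦.carrier) : (SubgroupFamily.all K.1).carrier :=
  ⟨K'.1.subgroupOf K.1, (𝒦.isOpen _ K'.2).preimage continuous_subtype_val⟩

variable (N N' : (GSet 𝒦)ᵒᵖ ⥤ ModuleCat.{u + 1} R)

/-- The comparison map from the colimit for the restriction of `N` to `K`-sets. -/
def limInduced : Lim ((inducedFunctor K).op ⋙ N) →ₗ[R] Lim N :=
  Module.DirectLimit.lift R ((SubgroupFamily.all K.1).carrier)ᵒᵈ
    (fun L : ((SubgroupFamily.all K.1).carrier)ᵒᵈ ↦
      ((inducedFunctor K).op ⋙ N).obj (op (quot (OrderDual.ofDual L))))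
    (fun L L' h ↦ res ((inducedFunctor K).op ⋙ N) L L' h)
    (fun L ↦ evalAt N (inducedPt K (OrderDual.ofDual L)))
    (fun L L' h x ↦ by
      have h' : ∀ k ∈ (OrderDual.ofDual L').1, (1 : K.1)⁻¹ * k * 1 ∈ (OrderDual.ofDual L).1 :=
        fun k hk ↦ by
          simpa using (show (OrderDual.ofDual L').1 ≤ (OrderDual.ofDual L).1 from h) hk
      refine (evalAt_map N ((inducedFunctor K).map (quotMul _ _ 1 h')) _ x).trans ?_
      refine congrArg (fun s ↦ evalAt N s x) ?_
      exact congrArg (inducedMk K _ 1) (congrArg _ (one_mul (1 : K.1))))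

lemma limInduced_toLim (L : (SubgroupFamily.all K.1).carrier)
    (x : N.obj (op ((inducedFunctor K).obj (quot L)))) :
    limInduced K N (toLim ((inducedFunctor K).op ⋙ N) L x) = evalAt N (inducedPt K L) x :=
  Module.DirectLimit.lift_of
    (G := fun L : ((SubgroupFamily.all K.1).carrier)ᵒᵈ ↦
      ((inducedFunctor K).op ⋙ N).obj (op (quot (OrderDual.ofDual L))))
    (f := fun L L' h ↦ res ((inducedFunctor K).op ⋙ N) L L' h) _ _ x

/-- The `G`-set `G ×_K (K ⧸ L)` is generated by its base point, and it maps to `G ⧸ K'` as soon as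
`L ⊆ K'`. Intersecting with `K` therefore lifts elements; a section that vanishes on some `G ⧸ K'`
also vanishes on `G ×_K (K ⧸ L')` for `L' = K' ∩ L`. -/
lemma limInduced_bijective : Function.Bijective (limInduced K N) := by
  refine ⟨(injective_iff_map_eq_zero _).2 fun v hv ↦ ?_, fun v ↦ ?_⟩
  · obtain ⟨L, x, rfl⟩ := exists_toLim _ v
    rw [limInduced_toLim] at hv
    obtain ⟨K', hK', hx⟩ := exists_map_quotHom_eq_zero N _ _ hv
    let L' := inter (comapAll K K') L
    have h : ∀ k ∈ L'.1, (1 : K.1)⁻¹ * k * 1 ∈ L.1 := fun k hk ↦ by simpa using hk.2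
    have h' : (inducedFunctor K).map (quotMul L' L 1 h) =
        inducedToQuot K L' K' (fun k hk ↦ hk.1) ≫ quotHom K' (inducedPt K L) hK' := by
      ext s
      obtain ⟨⟨g, y⟩, rfl⟩ := Quotient.exists_rep (s := inducedSetoid K (quot L')) s
      obtain ⟨y, rfl⟩ := QuotientGroup.mk_surjective (s := L'.1) y
      refine Eq.trans ?_ ((inducedMk_mul_one K L g y).symm.trans
        (congrArg (fun g ↦ inducedMk K (quot L) g ((1 : K.1) : K.1 ⧸ L.1)) (mul_one _).symm))
      exact congrArg (fun k : K.1 ↦ inducedMk K (quot L) g (k : K.1 ⧸ L.1)) (mul_one y)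
    rw [← toLim_transMap_one ((inducedFunctor K).op ⋙ N) L L' h]
    have h₀ : transMap ((inducedFunctor K).op ⋙ N) L' L 1 h x = 0 := by
      change (N.map ((inducedFunctor K).map (quotMul L' L 1 h)).op).hom x = 0
      rw [h', ← map_map_apply, hx, map_zero]
    rw [h₀, map_zero]
  · obtain ⟨K', x, rfl⟩ := exists_toLim _ v
    refine ⟨toLim ((inducedFunctor K).op ⋙ N) (comapAll K K')
      ((N.map (inducedToQuot K (comapAll K K') K' fun _ h ↦ h).op).hom x), ?_⟩
    rw [limInduced_toLim, evalAt_map, ← evalAt_one]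
    exact congrArg (fun s ↦ evalAt N s x) (inducedToQuot_pt K _ K' _)

/-- In `G ×_K (K ⧸ L)` the class of `(1, k L)` is that of `(k, L)`, which is `k` times the base
point. -/
lemma limInduced_equivariant (k : K.1) (v : Lim ((inducedFunctor K).op ⋙ N)) :
    limInduced K N (limRho _ k v) = limRho N (k : G) (limInduced K N v) := by
  obtain ⟨L, x, rfl⟩ := exists_toLim _ v
  have h := limAct_toLim ((inducedFunctor K).op ⋙ N) k L _ (conjK_spec L k) x
  refine (congrArg (limInduced K N) h).trans ?_
  rw [limInduced_toLim, limInduced_toLim, ← evalAt_smul]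
  refine (evalAt_map N ((inducedFunctor K).map (quotMul _ _ k (conjK_spec L k))) _ x).trans ?_
  refine congrArg (fun s ↦ evalAt N s x) ?_
  refine (congrArg (fun k : K.1 ↦ inducedMk K (quot L) 1 (k : K.1 ⧸ L.1)) (one_mul k)).trans ?_
  refine (inducedMk_mul_one K L 1 k).symm.trans ?_
  exact congrArg (fun g ↦ inducedMk K (quot L) g ((1 : K.1) : K.1 ⧸ L.1))
    ((one_mul _).trans (mul_one _).symm)

/-- The colimit for the restriction of `N` to `K`-sets is the restriction of the colimit for `N`. -/
def limInducedIso : (limFunctor (SubgroupFamily.all K.1) R).obj ((inducedFunctor K).op ⋙ N) ≅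
    (restrictRep R K.1).obj ((limFunctor 𝒦 R).obj N) :=
  ObjectProperty.isoMk _ (Rep.mkIso (Representation.Equiv.mk
    (LinearEquiv.ofBijective (limInduced K N) (limInduced_bijective K N)) fun k ↦
      LinearMap.ext fun v ↦ limInduced_equivariant K N k v))

variable {N N'}

lemma limInducedIso_naturality (φ : N ⟶ N') :
    (limFunctor (SubgroupFamily.all K.1) R).map ((inducedFunctor K).op.whiskerLeft φ) ≫
        (limInducedIso K N').hom =
      (limInducedIso K N).hom ≫ (restrictRep R K.1).map ((limFunctor 𝒦 R).map φ) := by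
  ext v
  obtain ⟨L, x, rfl⟩ := exists_toLim ((inducedFunctor K).op ⋙ N) v
  change limInduced K N' (limMap ((inducedFunctor K).op.whiskerLeft φ) (toLim _ L x)) =
    limMap φ (limInduced K N (toLim _ L x))
  rw [limMap_toLim, limInduced_toLim, limInduced_toLim, limMap_evalAt]
  rfl

end LimInduced

/-! ### Sections over `G ⧸ K` as `K`-invariants. -/

section Invariants

open GSet

variable {G : Type u} [Group G] [TopologicalSpace G] [IsTopologicalGroup G] {𝒦 : SubgroupFamily G}
variable {R : Type (u + 1)} [CommRing R] (K : 𝒦.carrier) {N N' : (GSet 𝒦)ᵒᵖ ⥤ ModuleCat.{u + 1} R}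

lemma limRho_toLim_of_mem (k : G) (hk : k ∈ K.1) (x : N.obj (op (quot K))) :
    limRho N k (toLim N K x) = toLim N K x := by
  have h : ∀ l ∈ K.1, k⁻¹ * l * k ∈ K.1 := fun l hl ↦ mul_mem (mul_mem (inv_mem hk) hl) hk
  refine (limAct_toLim N k K K h x).trans ?_
  rw [transMap_of_mem N K k hk]

variable (N) in
/-- The `K`-invariant vector attached to a section over `G ⧸ K`. -/
def toInvariants : N.obj (op (quot K)) →ₗ[R]
    (trivialRep R K.1 ⟶ (restrictRep R K.1).obj ((limFunctor 𝒦 R).obj N)) where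
  toFun x := ObjectProperty.homMk (Rep.ofHom
    { toLinearMap := LinearMap.toSpanSingleton R (Lim N) (toLim N K x)
      isIntertwining' := fun k ↦ LinearMap.ext fun r : R ↦ by
        change r • toLim N K x = limRho N (k : G) (r • toLim N K x)
        rw [map_smul, limRho_toLim_of_mem K _ k.2] })
  map_add' x y := by
    ext r
    change (show R from r) • toLim N K (x + y) =
      (show R from r) • toLim N K x + (show R from r) • toLim N K y
    rw [map_add, smul_add]
  map_smul' c x := by
    ext r
    change (show R from r) • toLim N K (c • x) = c • (show R from r) • toLim N K x
    rw [map_smul, smul_comm]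

/-- Equivariant maps from `G ⧸ K` to `Lim N` are the `K`-fixed vectors, through the value at `1`; a
fixed vector `v` gives the map `g K ↦ g v`. -/
lemma IsDetermined.bijective_toInvariants (hN : IsDetermined N) :
    Function.Bijective (toInvariants K N) := by
  constructor
  · intro x y h
    have h₁ : toLim N K x = toLim N K y := by
      have : (1 : R) • toLim N K x = (1 : R) • toLim N K y := congr($(h).hom.hom (1 : R))
      rwa [one_smul, one_smul] at this
    refine hN.ext (S := quot K) x y fun s ↦ ?_
    obtain ⟨g, rfl⟩ := QuotientGroup.mk_surjective (s := K.1) s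
    have e : ((g : G) : G ⧸ K.1) = g • ((1 : G) : G ⧸ K.1) := by
      rw [MulAction.Quotient.smul_coe, smul_eq_mul, mul_one]
    have hx (z : N.obj (op (quot K))) : evalAt N (S := quot K) ((g : G) : G ⧸ K.1) z =
        limRho N g (toLim N K z) := by
      refine Eq.trans ?_ (congrArg (limRho N g) (evalAt_one N K z))
      refine Eq.trans ?_ (evalAt_smul N (S := quot K) g _ z)
      exact congrArg (fun s ↦ evalAt N (S := quot K) s z) e
    rw [hx, hx, h₁]
  · intro f
    let v : Lim N := f.hom.hom (1 : R)
    have hv (k : K.1) : limRho N (k : G) v = v := (Rep.hom_comm_apply f.hom k (1 : R)).symm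
    obtain ⟨x, hx⟩ := hN.exists_eq (S := quot K)
      (fun s : G ⧸ K.1 ↦ Quotient.liftOn' s (fun g ↦ limRho N g v) fun a b hab ↦ by
        have h := hv ⟨a⁻¹ * b, QuotientGroup.leftRel_apply.1 hab⟩
        change limRho N (a⁻¹ * b) v = v at h
        conv_lhs => rw [← h]
        rw [← Module.End.mul_apply, ← map_mul, mul_inv_cancel_left]) (by
      rintro g ⟨y⟩
      change limRho N (g * y) v = limRho N g (limRho N y v)
      rw [map_mul]
      rfl)
    refine ⟨x, ?_⟩
    have hx' : toLim N K x = v := by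
      rw [← evalAt_one]
      refine (hx ((1 : G) : G ⧸ K.1)).trans ?_
      change limRho N 1 v = v
      rw [map_one]
      rfl
    ext r
    change (show R from r) • toLim N K x = f.hom.hom r
    rw [hx']
    refine (map_smul f.hom.hom (show R from r) (1 : R)).symm.trans ?_
    exact congrArg f.hom.hom (mul_one (show R from r))

lemma toInvariants_naturality (φ : N ⟶ N') (x : N.obj (op (quot K))) :
    toInvariants K N' ((φ.app (op (quot K))).hom x) =
      toInvariants K N x ≫ (restrictRep R K.1).map ((limFunctor 𝒦 R).map φ) := by
  ext r
  change (show R from r) • toLim N' K ((φ.app (op (quot K))).hom x) =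
    limMap φ ((show R from r) • toLim N K x)
  rw [map_smul, limMap_toLim]

end Invariants

/-! ### Cohomology with compactly induced coefficients. -/

section CompactlyInduced

open GSet

variable {G : Type u} [Group G] [TopologicalSpace G] [IsTopologicalGroup G] {𝒦 : SubgroupFamily G}
variable {R : Type (u + 1)} [CommRing R] (K : 𝒦.carrier)
variable {C : Type (u + 1)} [Category.{u} C] (J : GrothendieckTopology C) (X : GSet 𝒦 ⥤ C)

variable (R) in
/-- The restriction of `H⁰(X_∞, F)` to `K` only depends on the restriction of `F` to `X|_K`. -/
def resSubHZeroInfIso :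
    resSub J R X K ⋙ HZeroInf J R (restrictSub X K) ≅ HZeroInf J R X ⋙ restrictRep R K.1 :=
  NatIso.ofComponents (fun F ↦ limInducedIso K ((toPresheaf J R X).obj F)) fun φ ↦
    limInducedIso_naturality K ((toPresheaf J R X).map φ)

/-- `H⁰_R` with coefficients in a compactly induced representation. -/
def hZeroCIndIso (M : SmoothRep R K.1) :
    HZero J X (cInd K.1 M) ≅ resSub J R X K ⋙ HZero J (restrictSub X K) M :=
  Functor.isoWhiskerLeft (HZeroInf J R X) (frobeniusIso (𝒦.isOpen _ K.2) M) ≪≫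
    (Functor.associator _ _ _).symm ≪≫
    Functor.isoWhiskerRight (resSubHZeroInfIso R K J X).symm _ ≪≫
    Functor.associator _ _ _

instance : (resSub J R X K).Additive := by
  unfold resSub
  infer_instance

instance : (resSub J R X K).PreservesInjectiveObjects := by
  unfold resSub
  infer_instance

instance : PreservesFiniteLimits (resSub J R X K) := by
  unfold resSub
  infer_instance

instance : PreservesFiniteColimits (resSub J R X K) := by
  unfold resSub
  infer_instance

/-- The cohomology with coefficients in a compactly induced representation. -/
def hRCIndIso (M : SmoothRep R K.1) (n : ℕ) :
    HR J X (cInd K.1 M) n ≅ resSub J R X K ⋙ HR J (restrictSub X K) M n :=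
  -- Restriction is exact and preserves injectives, so it maps injective resolutions to injective
  -- resolutions.
  rightDerivedIso (hZeroCIndIso K J X M) n ≪≫ rightDerivedCompIso _ _ n

/-- The isomorphism between `(U, α)` and the image of the final object of `C/U`. -/
def ofOverIso {P : Cᵒᵖ ⥤ Type (u + 1)} (a : El P) :
    (El.ofOver P a.sec).obj (Over.mk (𝟙 a.base)) ≅ a where
  hom := ⟨𝟙 _, rfl⟩
  inv := ⟨𝟙 _, by
    change P.map (𝟙 _) (P.map (𝟙 _) a.sec) = a.sec
    simp⟩
  hom_inv_id := El.hom_ext (Category.comp_id _)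
  inv_hom_id := El.hom_ext (Category.comp_id _)

variable (R) in
/-- Sections over `(X_S, α_S)` are the sections over `X_S` of the restriction to `C/X_S`. -/
def resLayerSectionsIso (S : GSet 𝒦) :
    toPresheaf J R X ⋙ (evaluation _ _).obj (op S) ≅ resLayer J R X S ⋙
      (sheafSections (J.over (X.obj S)) (ModuleCat.{u + 1} R)).obj (op (Over.mk (𝟙 _))) :=
  NatIso.ofComponents (fun F ↦ F.obj.mapIso (ofOverIso ((liftColim X).obj S)).op) fun φ ↦
    (φ.hom.naturality (ofOverIso ((liftColim X).obj S)).hom.op).symm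

variable {X}

/-- Sections over `(X_K, α_K)` are the `K`-invariants of `H⁰(X_∞, F)`. -/
def IsSObject.invariantsIso (hX : IsSObject J X) :
    toPresheaf J R X ⋙ (evaluation _ _).obj (op (quot K)) ≅
      HZeroInf J R X ⋙ restrictRep R K.1 ⋙
        (linearCoyoneda R (SmoothRep R K.1)).obj (op (trivialRep R K.1)) :=
  NatIso.ofComponents (fun F ↦ (LinearEquiv.ofBijective (toInvariants K ((toPresheaf J R X).obj F))
      ((hX.isDetermined J F).bijective_toInvariants K)).toModuleIso) fun φ ↦
    ModuleCat.hom_ext (LinearMap.ext fun x ↦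
      toInvariants_naturality K ((toPresheaf J R X).map φ) x)

/-- `H⁰_R` with coefficients in the compact induction of the trivial representation. -/
def IsSObject.hZeroCIndTrivialIso (hX : IsSObject J X) :
    HZero J X (cInd K.1 (trivialRep R K.1)) ≅ resLayer J R X (quot K) ⋙
      (sheafSections (J.over (X.obj (quot K))) (ModuleCat.{u + 1} R)).obj (op (Over.mk (𝟙 _))) :=
  Functor.isoWhiskerLeft (HZeroInf J R X) (frobeniusIso (𝒦.isOpen _ K.2) (trivialRep R K.1)) ≪≫
    (hX.invariantsIso K J).symm ≪≫ resLayerSectionsIso R J X (quot K)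

variable (X) in
instance (S : GSet 𝒦) : (resLayer J R X S).Additive := by
  unfold resLayer
  infer_instance

variable (X) in
instance (S : GSet 𝒦) : (resLayer J R X S).PreservesInjectiveObjects := by
  unfold resLayer
  infer_instance

variable (X) in
instance (S : GSet 𝒦) : PreservesFiniteLimits (resLayer J R X S) := by
  unfold resLayer
  infer_instance

variable (X) in
instance (S : GSet 𝒦) : PreservesFiniteColimits (resLayer J R X S) := by
  unfold resLayer
  infer_instance

/-- The cohomology with coefficients in the compact induction of the trivial representation. -/
def IsSObject.hRCIndTrivialIso (hX : IsSObject J X) (n : ℕ) :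
    HR J X (cInd K.1 (trivialRep R K.1)) n ≅
      resLayer J R X (quot K) ⋙ HOver J R (X.obj (quot K)) n :=
  rightDerivedIso (hX.hZeroCIndTrivialIso K J) n ≪≫ rightDerivedCompIso _ _ n

end CompactlyInduced

/-! ### Direct images and the Leray spectral sequence. -/

section DirectImage

open GSet

variable {G : Type u} [Group G] [TopologicalSpace G] [IsTopologicalGroup G] {𝒦 : SubgroupFamily G}
variable {R : Type (u + 1)} [CommRing R]
variable {C : Type (u + 1)} [Category.{u} C] (J : GrothendieckTopology C) {X Y : GSet 𝒦 ⥤ C}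
variable (f : X ⟶ Y)

lemma colimMap_colimMk {U : C} {S : GSet 𝒦} (a : U ⟶ X.obj S) :
    (colimMap f).app (op U) (colimMk X a) = colimMk Y (a ≫ f.app S) := rfl

/-- The morphisms `(X_S, f α_S) ⟶ (Y_S, α_S)`. -/
def liftColimMap : liftColim X ⋙ El.map (colimMap f) ⟶ liftColim Y where
  app S := ⟨f.app S, by
    change colimMk Y (f.app S ≫ 𝟙 _) = colimMk Y (𝟙 _ ≫ f.app S)
    rw [Category.comp_id, Category.id_comp]⟩
  naturality _ _ g := El.hom_ext (f.naturality g)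

variable {f}

/-- Write the two morphisms as `c ≫ X.map p` and `c ≫ X.map q`. Their images in `Y` agree, so `c ≫
f.app W` factors through `Y` of the equalizer of `p` and `q`. The cartesian square of `equalizerι`
lifts this factorization to `X`, where `p` and `q` become equal. -/
lemma isRepresentable_of_isExact (hX : PreservesLimitsOfShape WalkingCospan X) (hY : IsExact Y)
    (hf : NatTrans.Equifibered f) : IsRepresentable f := by
  intro S U a b h h'
  obtain ⟨W, c, p, q, rfl, rfl⟩ := exists_span_of_colimMk_eq hX a b h'
  obtain ⟨d, hd⟩ := exists_comp_equalizerι hY p q (c ≫ f.app W) (by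
    rw [Category.assoc, Category.assoc, ← f.naturality, ← f.naturality, ← Category.assoc, h,
      Category.assoc])
  have hP := hf (equalizerι p q)
  rw [← hP.lift_fst c d hd.symm, Category.assoc, Category.assoc, ← X.map_comp, ← X.map_comp,
    equalizer_condition]

/-- A span in `Y` connects `g` with the image of a representative `a` of `α`. The cartesian square
over the leg `p` lifts the span to `X`, and the other leg `q` yields `b`. -/
lemma exists_comp_app_eq (hY : PreservesLimitsOfShape WalkingCospan Y)
    (hf : NatTrans.Equifibered f) {S : GSet 𝒦} {U : C} (α : (colimPresheaf X).obj (op U))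
    (g : U ⟶ Y.obj S) (h : colimMk Y g = (colimMap f).app (op U) α) :
    ∃ b : U ⟶ X.obj S, b ≫ f.app S = g ∧ colimMk X b = α := by
  obtain ⟨T, a, rfl⟩ := exists_colimMk_eq α
  obtain ⟨W, c, p, q, h₁, h₂⟩ := exists_span_of_colimMk_eq hY (a ≫ f.app T) g
    ((colimMap_colimMk f a).symm.trans h.symm)
  have hP := hf p
  refine ⟨hP.lift a c h₁.symm ≫ X.map q, ?_, ?_⟩
  · rw [Category.assoc, f.naturality, ← Category.assoc, hP.lift_snd, h₂]
  · rw [colimMk_comp_map]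
    conv_rhs => rw [← hP.lift_fst a c h₁.symm, colimMk_comp_map]

/-- If `f` is cartesian and representable, then `(X_S, α_S)` is the final object of `C/colim X`
over `(Y_S, α_S)`. -/
def isInitialLiftColimMap (hY : PreservesLimitsOfShape WalkingCospan Y)
    (hf : NatTrans.Equifibered f) (hf' : IsRepresentable f) (S : GSet 𝒦) :
    IsInitial (StructuredArrow.mk (S := op ((liftColim Y).obj S)) (T := (El.map (colimMap f)).op)
      (Y := op ((liftColim X).obj S)) ((liftColimMap f).app S).op) := by
  -- Existence comes from cartesianness of `f`, uniqueness from `hf'`.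
  have key (j : StructuredArrow (op ((liftColim Y).obj S)) (El.map (colimMap f)).op) :
      ∃! b : j.right.unop.base ⟶ X.obj S,
        b ≫ f.app S = j.hom.unop.hom ∧ colimMk X b = j.right.unop.sec := by
    let g : (El.map (colimMap f)).obj j.right.unop ⟶ (liftColim Y).obj S := j.hom.unop
    obtain ⟨b, h₁, h₂⟩ := exists_comp_app_eq hY hf j.right.unop.sec
      (show j.right.unop.base ⟶ Y.obj S from g.hom) (colimMk_hom g)
    exact ⟨b, ⟨h₁, h₂⟩, fun b' h ↦ hf' S _ b' b (h.1.trans h₁.symm) (h.2.trans h₂.symm)⟩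
  exact IsInitial.ofUniqueHom (fun j ↦ StructuredArrow.homMk
      (homLiftColim (key j).choose (key j).choose_spec.1.2).op
      (Quiver.Hom.unop_inj (El.hom_ext (key j).choose_spec.1.1)))
    fun j m ↦ StructuredArrow.hom_ext _ _ (Quiver.Hom.unop_inj (El.hom_ext
      ((key j).choose_spec.2 _ ⟨congrArg (fun φ ↦ El.Hom.hom (Quiver.Hom.unop φ))
        (StructuredArrow.w m), colimMk_hom m.right.unop⟩)))

variable (R f) in
/-- The comparison map between the values of `f_* F` and `F` on `G`-sets. -/
def directImageToPresheaf : directImage J R f ⋙ toPresheaf J R Y ⟶ toPresheaf J R X where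
  app F := Functor.whiskerRight (NatTrans.op (liftColimMap f))
      ((El.map (colimMap f)).op.ran.obj F.obj) ≫
    (liftColim X).op.whiskerLeft ((El.map (colimMap f)).op.ranCounit.app F.obj)
  naturality F F' φ := by
    ext S : 2
    have h₁ := ((El.map (colimMap f)).op.ran.map φ.hom).naturality
      ((liftColimMap f).app S.unop).op
    have h₂ := congr_app ((El.map (colimMap f)).op.ranCounit.naturality φ.hom)
      (op ((liftColim X).obj S.unop))
    refine (Category.assoc _ _ _).symm.trans ((congrArg (· ≫ _) h₁.symm).trans ?_)
    refine (Category.assoc _ _ _).trans ((congrArg (_ ≫ ·) h₂).trans ?_)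
    exact (Category.assoc _ _ _).symm

/-- The value of `f_* F` at `(Y_S, α_S)` is a limit over structured arrows. That category has `(X_S,
α_S)` as initial object, so the limit is the value of `F` there. -/
lemma IsSObject.isIso_directImageToPresheaf (hY : IsSObject J Y)
    (hf : NatTrans.Equifibered f) (hf' : IsRepresentable f) :
    IsIso (directImageToPresheaf R J f) := by
  have (F : Sh R J X) (S : (GSet 𝒦)ᵒᵖ) :
      IsIso (((directImageToPresheaf R J f).app F).app S) :=
    ((El.map (colimMap f)).op.isPointwiseRightKanExtensionRanCounit F.obj
      (op ((liftColim Y).obj S.unop))).isIso_π_app_of_isInitial _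
        (isInitialLiftColimMap hY.preservesPullbacks hf hf' S.unop)
  have (F : Sh R J X) : IsIso ((directImageToPresheaf R J f).app F) := NatIso.isIso_of_isIso_app _
  exact NatIso.isIso_of_isIso_app _

/-- `H⁰_R` of a direct image. -/
def IsSObject.directImageHZeroIso (hY : IsSObject J Y)
    (hf : NatTrans.Equifibered f) (hf' : IsRepresentable f) (M : SmoothRep R G) :
    directImage J R f ⋙ HZero J Y M ≅ HZero J X M :=
  have := hY.isIso_directImageToPresheaf (R := R) J hf hf'
  Functor.isoWhiskerRight (asIso (directImageToPresheaf R J f))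
    (limFunctor 𝒦 R ⋙ (linearCoyoneda R (SmoothRep R G)).obj (op M))

instance : (directImage J R f).PreservesInjectiveObjects := by
  unfold directImage
  infer_instance

/-- The Leray spectral sequence. -/
lemma IsSObject.hasSpectralSequence_directImage (hY : IsSObject J Y)
    (hf : NatTrans.Equifibered f) (hf' : IsRepresentable f) (M : SmoothRep R G) (F : Sh R J X) :
    HasSpectralSequence (fun r s ↦ (HR J Y M r).obj ((higherDirectImage J R f s).obj F))
      (fun n ↦ (HR J X M n).obj F) :=
  -- Taking `A = M_{Y, G}`, the Ext terms become `H^r_R(Y; M, ·)`, and `Hom(A, f_* ·)` is identified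
  -- with `H⁰_R(X; M, ·)`, so `f^* M_{Y, G}` need not be computed.
  (hasSpectralSequence_comp (directImage J R f) (inverseImage J Y M) F).of_iso
    (fun r s ↦ ⟨(hY.hREquiv J M r ((higherDirectImage J R f s).obj F)).symm.toModuleIso⟩)
    (fun n ↦ ⟨(rightDerivedIso (Functor.isoWhiskerLeft (directImage J R f) (hY.hZeroIso J M) ≪≫
      hY.directImageHZeroIso J hf hf' M) n).app F⟩)

end DirectImage

end SSheaf

end

theorem proposition2p18 {G : Type u} [Group G] [TopologicalSpace G] [IsTopologicalGroup G]
    [T2Space G] [LocallyCompactSpace G] [TotallyDisconnectedSpace G] (𝒦 : SubgroupFamily G)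
    {C : Type (u + 1)} [Category.{u} C] [HasPullbacks C] [HasEqualizers C] [HasCoproducts.{u} C]
    (J : GrothendieckTopology C) (R : Type (u + 1)) [CommRing R]
    (X : GSet 𝒦 ⥤ C) (hX : IsSObject J X) :
    -- the derived functors of `H⁰_R(X; M, ·)` are the Ext groups of `M_{X, G}`
    (∀ M : SmoothRep R G,
      ∃ e : ∀ (n : ℕ) (F : Sh R J X),
          (HR J X M n).obj F ≃ₗ[R] Abelian.Ext (inverseImage J X M) F n,
        ∀ (n : ℕ) (F F' : Sh R J X) (φ : F ⟶ F') (x : (HR J X M n).obj F),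
          e n F' (((HR J X M n).map φ).hom x) =
            (e n F x).comp (Abelian.Ext.mk₀ φ) (add_zero n)) ∧
    -- compact induction
    (∀ (K : 𝒦.carrier) (M : SmoothRep R K.1) (n : ℕ),
      Nonempty (HR J X (cInd K.1 M) n ≅ resSub J R X K ⋙ HR J (restrictSub X K) M n)) ∧
    (∀ (K : 𝒦.carrier) (n : ℕ),
      Nonempty (HR J X (cInd K.1 (trivialRep R K.1)) n ≅
        resLayer J R X (GSet.quot K) ⋙ HOver J R (X.obj (GSet.quot K)) n)) ∧
    -- the covering spectral sequence
    (IsExact X → ∀ (M : SmoothRep R G) (F : Sh R J X),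
      HasSpectralSequence (fun r s ↦ ModuleCat.of R (Abelian.Ext M ((HInf J R X s).obj F) r))
        (fun n ↦ (HR J X M n).obj F)) ∧
    -- the Leray spectral sequence
    (∀ (Y : GSet 𝒦 ⥤ C), IsSObject J Y → ∀ f : X ⟶ Y, NatTrans.Equifibered f →
      (IsExact Y ∨ IsRepresentable f) → ∀ (M : SmoothRep R G) (F : Sh R J X),
        HasSpectralSequence (fun r s ↦ (HR J Y M r).obj ((higherDirectImage J R f s).obj F))
          (fun n ↦ (HR J X M n).obj F)) := by
  exact ⟨fun M ↦ ⟨fun n F ↦ hX.hREquiv J M n F, fun n F F' φ x ↦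
      hX.hREquiv_naturality J M n F F' φ x⟩,
    fun K M n ↦ ⟨hRCIndIso K J X M n⟩, fun K n ↦ ⟨hX.hRCIndTrivialIso K J n⟩,
    fun hX' M F ↦ hX.hasSpectralSequence_hInf J hX' M F,
    fun Y hY f hf h M F ↦ hY.hasSpectralSequence_directImage J hf
      (h.elim (fun hY' ↦ isRepresentable_of_isExact hX.preservesPullbacks hY' hf) id) M F⟩
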